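/- Let $(V,g)$ be a $C^3$ spacetime, i.e. a connected, Hausdorff, paracompact, oriented and time-orientable four-dimensional $C^4$ manifold with a $C^3$ Lorentzian metric of signature $(-,+,+,+)$, Levi-Civita connection $\nabla$ and volume form $\eta_{\alpha\beta\gamma\delta}$. Assume that $g$ satisfies the vacuum equations $R_{\alpha\beta}=0$ and that $(V,g)$ is not locally flat (its curvature tensor does not vanish identically). Let $\xi$ be a ($C^2$) Killing vector field on $V$. Put $F_{\alpha\beta}=\nabla_\alpha\xi_\beta$, $\mathcal F_{\alpha\beta}=F_{\alpha\beta}+\frac i2\eta_{\alpha\beta\gamma\delta}F^{\gamma\delta}$, $\mathcal F^2=\mathcal F_{\alpha\beta}\mathcal F^{\alpha\beta}$, $\lambda=-\xi^\alpha\xi_\alpha$, $\gamma_{\alpha\beta}=\lambda g_{\alpha\beta}+\xi_\alpha\xi_\beta$, $\sigma_\mu=2\xi^\alpha\mathcal F_{\alpha\mu}$ (the Ernst one-form), and, with $C_{\alpha\beta\gamma\delta}$ the Weyl tensor, $$\mathcal C_{\alpha\beta\gamma\delta}=C_{\alpha\beta\gamma\delta}+\tfrac i2\eta_{\gamma\delta\rho\sigma}C_{\alpha\beta}{}^{\rho\sigma},\qquad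 \mathcal I_{\alpha\beta\gamma\delta}=\tfrac14\left(g_{\alpha\gamma}g_{\beta\delta}-g_{\alpha\delta}g_{\beta\gamma}+i\,\eta_{\alpha\beta\gamma\delta}\right).$$ The curvature sign is fixed by $\nabla_\gamma\nabla_\beta v_\alpha-\nabla_\beta\nabla_\gamma v_\alpha=v_\delta R^\delta{}_{\alpha\beta\gamma}$. Suppose that $\xi$ is non-null on a dense subset of $V$, that $\mathcal F^2\neq0$ everywhere, and that the spacetime Simon tensor $$S_{\alpha\beta\nu}=2\xi^\mu\xi^\rho\mathcal C_{\mu\alpha\rho\beta}\sigma_\nu-2\xi^\mu\xi^\rho\mathcal C_{\mu\alpha\rho\nu}\sigma_\beta-\tfrac12\gamma_{\alpha\beta}\,\xi^\mu\mathcal C_{\mu\nu\rho\delta}\mathcal F^{\rho\delta}+\tfrac12\gamma_{\alpha\nu}\,\xi^\mu\mathcal C_{\mu\beta\rho\delta}\mathcal F^{\rho\delta}$$ vanishes everywhere. Then the Ernst one-form is exact: there is a function $\sigma:V\to\mathbb C$ with $\sigma_\alpha=\nabla_\alpha\sigma$. Moreover there are complex constants $c$ and $A\neq0$ such that $c-\sigma$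 vanishes nowhere and, everywhere on $V$, $$\mathcal C_{\alpha\beta\gamma\delta}=\frac{-6}{c-\sigma}\left(\mathcal F_{\alpha\beta}\mathcal F_{\gamma\delta}-\tfrac13\,\mathcal I_{\alpha\beta\gamma\delta}\,\mathcal F^2\right),\qquad \mathcal F^2=A\,(c-\sigma)^4 .$$ -/

import Mathlib

open scoped Manifold ContDiff

noncomputable section

namespace KillingGeometry

/-- The model space `ℝ⁴` of coordinates. -/
abbrev E4 : Type := EuclideanSpace ℝ (Fin 4)

/-! ## Tensor calculus in one coordinate system

Here `G x` is the matrix `g_{ab}(x)` of components of a metric, `X x` the components `ξ^a(x)` of a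
vector field and `H x a b c d` the components `η_{abcd}(x)` of a volume form.  All of them are
functions of the coordinates `x ∈ ℝ⁴`. -/

/-- The partial derivative `∂_i f`. -/
def pd (i : Fin 4) (f : E4 → ℝ) (x : E4) : ℝ :=
  fderiv ℝ f x (EuclideanSpace.single i 1)

/-- The inverse metric `g^{ab}`. -/
def ginv (G : E4 → Matrix (Fin 4) (Fin 4) ℝ) (x : E4) (a b : Fin 4) : ℝ :=
  (G x)⁻¹ a b

/-- The Christoffel symbols `Γ^a_{bc}` of the Levi-Civita connection. -/
def christoffel (G : E4 → Matrix (Fin 4) (Fin 4) ℝ) (a b c : Fin 4) (x : E4) : ℝ :=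
  (1 / 2) * ∑ d, ginv G x a d *
    (pd b (fun y => G y d c) x + pd c (fun y => G y d b) x - pd d (fun y => G y b c) x)

/-- The curvature tensor `R^a_{bcd}`, with
`(∇_d ∇_c - ∇_c ∇_d) v_b = v_a R^a_{bcd}`. -/
def riemannUp (G : E4 → Matrix (Fin 4) (Fin 4) ℝ) (x : E4) (a b c d : Fin 4) : ℝ :=
  pd c (christoffel G a b d) x - pd d (christoffel G a b c) x +
    ∑ k, (christoffel G a c k x * christoffel G k b d x
      - christoffel G a d k x * christoffel G k b c x)

/-- The curvature tensor `R_{abcd}`. -/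
def riemann (G : E4 → Matrix (Fin 4) (Fin 4) ℝ) (x : E4) (a b c d : Fin 4) : ℝ :=
  ∑ k, G x a k * riemannUp G x k b c d

/-- The Ricci tensor `R_{ab} = R^c_{acb}`. -/
def ricci (G : E4 → Matrix (Fin 4) (Fin 4) ℝ) (x : E4) (a b : Fin 4) : ℝ :=
  ∑ c, riemannUp G x c a c b

/-- The scalar curvature. -/
def scalarCurv (G : E4 → Matrix (Fin 4) (Fin 4) ℝ) (x : E4) : ℝ :=
  ∑ a, ∑ b, ginv G x a b * ricci G x a b

/-- The Weyl tensor `C_{abcd}` in dimension four. -/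
def weyl (G : E4 → Matrix (Fin 4) (Fin 4) ℝ) (x : E4) (a b c d : Fin 4) : ℝ :=
  riemann G x a b c d
    - (1 / 2) * (G x a c * ricci G x b d - G x a d * ricci G x b c
        - G x b c * ricci G x a d + G x b d * ricci G x a c)
    + (scalarCurv G x / 6) * (G x a c * G x b d - G x a d * G x b c)

/-- The right self-dual Weyl tensor
`𝒞_{abcd} = C_{abcd} + (i/2) η_{cdrs} C_{ab}^{rs}`. -/
def weylSD (G : E4 → Matrix (Fin 4) (Fin 4) ℝ)
    (H : E4 → Fin 4 → Fin 4 → Fin 4 → Fin 4 → ℝ) (x : E4) (a b c d : Fin 4) : ℂ :=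
  (weyl G x a b c d : ℂ) + (Complex.I / 2) *
    ((∑ r, ∑ s, ∑ m, ∑ n,
      H x c d r s * ginv G x r m * ginv G x s n * weyl G x a b m n : ℝ) : ℂ)

/-- The metric `ℐ_{abcd} = (g_{ac} g_{bd} - g_{ad} g_{bc} + i η_{abcd}) / 4` of the space of
self-dual two-forms. -/
def idSD (G : E4 → Matrix (Fin 4) (Fin 4) ℝ)
    (H : E4 → Fin 4 → Fin 4 → Fin 4 → Fin 4 → ℝ) (x : E4) (a b c d : Fin 4) : ℂ :=
  (((G x a c * G x b d - G x a d * G x b c : ℝ) : ℂ) + Complex.I * (H x a b c d : ℂ)) / 4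

/-- The covector components `ξ_a = g_{ab} ξ^b`. -/
def lower (G : E4 → Matrix (Fin 4) (Fin 4) ℝ) (X : E4 → Fin 4 → ℝ) (a : Fin 4) (x : E4) : ℝ :=
  ∑ b, G x a b * X x b

/-- The covariant derivative `∇_a ξ_b`. -/
def nablaLower (G : E4 → Matrix (Fin 4) (Fin 4) ℝ) (X : E4 → Fin 4 → ℝ) (x : E4)
    (a b : Fin 4) : ℝ :=
  pd a (lower G X b) x - ∑ c, christoffel G c a b x * lower G X c x

/-- The Killing form `ℱ_{ab} = F_{ab} + i F⋆_{ab}`, where `F_{ab} = ∇_a ξ_b` and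
`F⋆_{ab} = (1/2) η_{abcd} F^{cd}`. -/
def killingForm (G : E4 → Matrix (Fin 4) (Fin 4) ℝ)
    (H : E4 → Fin 4 → Fin 4 → Fin 4 → Fin 4 → ℝ) (X : E4 → Fin 4 → ℝ) (x : E4)
    (a b : Fin 4) : ℂ :=
  (nablaLower G X x a b : ℂ) + Complex.I *
    (((1 / 2) * ∑ c, ∑ d, ∑ m, ∑ n,
      H x a b c d * ginv G x c m * ginv G x d n * nablaLower G X x m n : ℝ) : ℂ)

/-- The Killing form with raised indices, `ℱ^{ab}`. -/
def killingFormUp (G : E4 → Matrix (Fin 4) (Fin 4) ℝ)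
    (H : E4 → Fin 4 → Fin 4 → Fin 4 → Fin 4 → ℝ) (X : E4 → Fin 4 → ℝ) (x : E4)
    (a b : Fin 4) : ℂ :=
  ∑ m, ∑ n, (ginv G x a m : ℂ) * (ginv G x b n : ℂ) * killingForm G H X x m n

/-- The complex scalar `ℱ² = ℱ_{ab} ℱ^{ab}`. -/
def killingFormSq (G : E4 → Matrix (Fin 4) (Fin 4) ℝ)
    (H : E4 → Fin 4 → Fin 4 → Fin 4 → Fin 4 → ℝ) (X : E4 → Fin 4 → ℝ) (x : E4) : ℂ :=
  ∑ a, ∑ b, killingForm G H X x a b * killingFormUp G H X x a b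

/-- The Ernst one-form `σ_m = 2 ξ^a ℱ_{am}`. -/
def ernst (G : E4 → Matrix (Fin 4) (Fin 4) ℝ)
    (H : E4 → Fin 4 → Fin 4 → Fin 4 → Fin 4 → ℝ) (X : E4 → Fin 4 → ℝ) (x : E4)
    (m : Fin 4) : ℂ :=
  2 * ∑ a, (X x a : ℂ) * killingForm G H X x a m

/-- `λ = - ξ^a ξ_a`. -/
def normSqNeg (G : E4 → Matrix (Fin 4) (Fin 4) ℝ) (X : E4 → Fin 4 → ℝ) (x : E4) : ℝ :=
  - ∑ a, X x a * lower G X a x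

/-- `γ_{ab} = λ g_{ab} + ξ_a ξ_b`. -/
def gammaTensor (G : E4 → Matrix (Fin 4) (Fin 4) ℝ) (X : E4 → Fin 4 → ℝ) (x : E4)
    (a b : Fin 4) : ℝ :=
  normSqNeg G X x * G x a b + lower G X a x * lower G X b x

/-- `ξ^m 𝒞_{mbrd} ℱ^{rd}`. -/
def weylKilling (G : E4 → Matrix (Fin 4) (Fin 4) ℝ)
    (H : E4 → Fin 4 → Fin 4 → Fin 4 → Fin 4 → ℝ) (X : E4 → Fin 4 → ℝ) (x : E4)
    (b : Fin 4) : ℂ :=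
  ∑ m, ∑ r, ∑ d, (X x m : ℂ) * weylSD G H x m b r d * killingFormUp G H X x r d

/-- `Y_{ab} = 2 ξ^m ξ^r 𝒞_{marb}`. -/
def weylElectric (G : E4 → Matrix (Fin 4) (Fin 4) ℝ)
    (H : E4 → Fin 4 → Fin 4 → Fin 4 → Fin 4 → ℝ) (X : E4 → Fin 4 → ℝ) (x : E4)
    (a b : Fin 4) : ℂ :=
  2 * ∑ m, ∑ r, (X x m : ℂ) * (X x r : ℂ) * weylSD G H x m a r b

/-- The spacetime Simon tensor
`S_{abn} = Y_{ab} σ_n - Y_{an} σ_b - (1/2) γ_{ab} ξ^m 𝒞_{mnrd} ℱ^{rd}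
  + (1/2) γ_{an} ξ^m 𝒞_{mbrd} ℱ^{rd}`. -/
def simon (G : E4 → Matrix (Fin 4) (Fin 4) ℝ)
    (H : E4 → Fin 4 → Fin 4 → Fin 4 → Fin 4 → ℝ) (X : E4 → Fin 4 → ℝ) (x : E4)
    (a b n : Fin 4) : ℂ :=
  weylElectric G H X x a b * ernst G H X x n - weylElectric G H X x a n * ernst G H X x b
    - (1 / 2) * (gammaTensor G X x a b : ℂ) * weylKilling G H X x n
    + (1 / 2) * (gammaTensor G X x a n : ℂ) * weylKilling G H X x b

/-! ## Components of tensor fields on a manifold in a chart -/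

section Manifold

variable {M : Type*} [TopologicalSpace M] [ChartedSpace E4 M]

/-- The coordinate vector `∂_i` of the chart `e` at the point with coordinates `x`. -/
def coordVec (e : OpenPartialHomeomorph M E4) (x : E4) (i : Fin 4) :
    TangentSpace (𝓡 4) (e.symm x) :=
  mfderiv (𝓡 4) (𝓡 4) e.symm x (EuclideanSpace.single i (1 : ℝ) : E4)

/-- The components `g(∂_i, ∂_j)` of a field of bilinear forms. -/
def metricIn (g : ∀ p : M, LinearMap.BilinForm ℝ (TangentSpace (𝓡 4) p))
    (e : OpenPartialHomeomorph M E4) (x : E4) : Matrix (Fin 4) (Fin 4) ℝ :=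
  Matrix.of fun i j => g (e.symm x) (coordVec e x i) (coordVec e x j)

/-- The components `η(∂_a, ∂_b, ∂_c, ∂_d)` of a four-form. -/
def volIn (η : ∀ p : M, (TangentSpace (𝓡 4) p) [⋀^Fin 4]→ₗ[ℝ] ℝ)
    (e : OpenPartialHomeomorph M E4) (x : E4) (a b c d : Fin 4) : ℝ :=
  η (e.symm x) ![coordVec e x a, coordVec e x b, coordVec e x c, coordVec e x d]

/-- The components `ξ^i = dx^i(ξ)` of a vector field. -/
def vecIn (ξ : ∀ p : M, TangentSpace (𝓡 4) p)
    (e : OpenPartialHomeomorph M E4) (x : E4) (i : Fin 4) : ℝ :=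
  EuclideanSpace.proj (𝕜 := ℝ) i (mfderiv (𝓡 4) (𝓡 4) e (e.symm x) (ξ (e.symm x)))

/-- The entries of `diag(-1, 1, 1, 1)`. -/
def minkowski (i j : Fin 4) : ℝ :=
  if i = j then (if i = 0 then -1 else 1) else 0

variable (M) in
/-- A `C³` Lorentzian metric of signature `(-1, 1, 1, 1)` on a `C⁴` four-manifold, together with
an orientation, given by its metric volume form, and time-orientability.  Charts range over all
coordinate systems of class `C⁴`. -/
structure C3Spacetime where
  /-- the metric -/
  metric : ∀ p : M, LinearMap.BilinForm ℝ (TangentSpace (𝓡 4) p)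
  signature : ∀ p : M, ∃ b : Module.Basis (Fin 4) ℝ (TangentSpace (𝓡 4) p),
    ∀ i j, metric p (b i) (b j) = minkowski i j
  contDiff_metric : ∀ e ∈ IsManifold.maximalAtlas (𝓡 4) 4 M, ∀ i j,
    ContDiffOn ℝ 3 (fun x => metricIn metric e x i j) e.target
  /-- the volume form -/
  vol : ∀ p : M, (TangentSpace (𝓡 4) p) [⋀^Fin 4]→ₗ[ℝ] ℝ
  vol_unit : ∀ (p : M) (b : Module.Basis (Fin 4) ℝ (TangentSpace (𝓡 4) p)),
    (∀ i j, metric p (b i) (b j) = minkowski i j) → |vol p b| = 1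
  continuous_vol : ∀ e ∈ IsManifold.maximalAtlas (𝓡 4) 4 M, ∀ a b c d,
    ContinuousOn (fun x => volIn vol e x a b c d) e.target
  time_orientable : ∃ T : ∀ p : M, TangentSpace (𝓡 4) p,
    (∀ e ∈ IsManifold.maximalAtlas (𝓡 4) 4 M, ∀ i,
      ContinuousOn (fun x => vecIn T e x i) e.target) ∧
    ∀ p, metric p (T p) (T p) < 0

namespace C3Spacetime

variable (S : C3Spacetime M)

/-- The vacuum field equations `R_{ab} = 0`. -/
def IsVacuum : Prop :=
  ∀ e ∈ IsManifold.maximalAtlas (𝓡 4) 4 M, ∀ x ∈ e.target, ∀ a b,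
    ricci (metricIn S.metric e) x a b = 0

/-- Local flatness: the curvature tensor vanishes identically. -/
def IsLocallyFlat : Prop :=
  ∀ e ∈ IsManifold.maximalAtlas (𝓡 4) 4 M, ∀ x ∈ e.target, ∀ a b c d,
    riemann (metricIn S.metric e) x a b c d = 0

/-- `ξ` is a (`C²`) Killing vector field: `∇_a ξ_b + ∇_b ξ_a = 0`. -/
structure IsKilling (ξ : ∀ p : M, TangentSpace (𝓡 4) p) : Prop where
  contDiff : ∀ e ∈ IsManifold.maximalAtlas (𝓡 4) 4 M, ∀ i,
    ContDiffOn ℝ 2 (fun x => vecIn ξ e x i) e.target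
  killing : ∀ e ∈ IsManifold.maximalAtlas (𝓡 4) 4 M, ∀ x ∈ e.target, ∀ a b,
    nablaLower (metricIn S.metric e) (vecIn ξ e) x a b
      + nablaLower (metricIn S.metric e) (vecIn ξ e) x b a = 0

/-- The spacetime Simon tensor with respect to `ξ` vanishes everywhere. -/
def SimonVanishes (ξ : ∀ p : M, TangentSpace (𝓡 4) p) : Prop :=
  ∀ e ∈ IsManifold.maximalAtlas (𝓡 4) 4 M, ∀ x ∈ e.target, ∀ a b n,
    simon (metricIn S.metric e) (volIn S.vol e) (vecIn ξ e) x a b n = 0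

/-- `σ` is a potential of the Ernst one-form of `ξ`: `σ_m = ∂_m σ` in every chart. -/
def IsErnstPotential (ξ : ∀ p : M, TangentSpace (𝓡 4) p) (σ : M → ℂ) : Prop :=
  MDifferentiable (𝓡 4) 𝓘(ℝ, ℂ) σ ∧
  ∀ e ∈ IsManifold.maximalAtlas (𝓡 4) 4 M, ∀ x ∈ e.target, ∀ m,
    ernst (metricIn S.metric e) (volIn S.vol e) (vecIn ξ e) x m =
      fderiv ℝ (fun y => σ (e.symm y)) x (EuclideanSpace.single m 1)

end C3Spacetime

end Manifold

end KillingGeometry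

end

noncomputable section
namespace KillingGeometry

/-- Square matrices of size four. -/
abbrev Mat (K : Type*) : Type _ := Matrix (Fin 4) (Fin 4) K

section Star

variable {K : Type*} [Field K]

/-- The skew matrix with the given entries above the diagonal. -/
def skewMat {K : Type*} [CommRing K] (a b c d e f : K) : Mat K :=
  !![0, a, b, c; -a, 0, d, e; -b, -d, 0, f; -c, -e, -f, 0]

/-- The matrix `(1/2) ε_{abcd} B^{cd}` of a bivector `B`. -/
def starMat (B : Mat K) : Mat K :=
  skewMat (B 2 3) (-B 1 3) (B 1 2) (B 0 3) (-B 0 2) (B 0 1)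

theorem eq_skewMat [CharZero K] {B : Mat K} (hB : B.transpose = -B) :
    B = skewMat (B 0 1) (B 0 2) (B 0 3) (B 1 2) (B 1 3) (B 2 3) := by
  have h : ∀ i j, B j i = - B i j := fun i j => congrFun (congrFun hB i) j
  have h0 : ∀ i, B i i = 0 := fun i => self_eq_neg.mp (h i i)
  ext i j
  fin_cases i <;> fin_cases j <;> simp [skewMat, h0] <;> exact h _ _

theorem skewMat_transpose (a b c d e f : K) :
    (skewMat a b c d e f).transpose = -skewMat a b c d e f := by
  ext i j
  fin_cases i <;> fin_cases j <;> simp [skewMat]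

theorem starMat_transpose (B : Mat K) : (starMat B).transpose = -starMat B :=
  skewMat_transpose _ _ _ _ _ _

theorem starMat_add (A B : Mat K) : starMat (A + B) = starMat A + starMat B := by
  ext i j
  fin_cases i <;> fin_cases j <;> simp [starMat, skewMat] <;> ring

theorem starMat_smul (r : K) (A : Mat K) : starMat (r • A) = r • starMat A := by
  ext i j
  fin_cases i <;> fin_cases j <;> simp [starMat, skewMat]

set_option maxHeartbeats 2000000 in
theorem starMat_infinitesimal [CharZero K] (M B : Mat K) (hB : B.transpose = -B) :
    M.transpose * starMat B + starMat B * M + starMat (M * B + B * M.transpose) =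
      M.trace • starMat B := by
  rw [eq_skewMat hB]
  ext i j
  fin_cases i <;> fin_cases j <;>
    simp only [starMat, Matrix.mul_apply, Fin.sum_univ_four, Matrix.trace, Matrix.add_apply,
      Matrix.smul_apply, Matrix.transpose_apply, Matrix.diag_apply, smul_eq_mul] <;>
    simp [skewMat] <;> ring

theorem mul_skewMat_mul_transpose (M : Mat K) (a b c d e f : K) :
    M * skewMat a b c d e f * M.transpose =
      let m : Fin 4 → Fin 4 → K := fun i j =>
        a * (M i 0 * M j 1 - M i 1 * M j 0) + b * (M i 0 * M j 2 - M i 2 * M j 0)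
        + c * (M i 0 * M j 3 - M i 3 * M j 0) + d * (M i 1 * M j 2 - M i 2 * M j 1)
        + e * (M i 1 * M j 3 - M i 3 * M j 1) + f * (M i 2 * M j 3 - M i 3 * M j 2)
      skewMat (m 0 1) (m 0 2) (m 0 3) (m 1 2) (m 1 3) (m 2 3) := by
  ext i j
  fin_cases i <;> fin_cases j <;>
    simp only [Matrix.mul_apply, Fin.sum_univ_four, Matrix.transpose_apply] <;>
    simp [skewMat] <;> ring

theorem det_fin_four (J : Mat K) : J.det =
    J 0 0 * (J 1 1 * (J 2 2 * J 3 3 - J 2 3 * J 3 2) - J 1 2 * (J 2 1 * J 3 3 - J 2 3 * J 3 1)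
      + J 1 3 * (J 2 1 * J 3 2 - J 2 2 * J 3 1))
    - J 0 1 * (J 1 0 * (J 2 2 * J 3 3 - J 2 3 * J 3 2) - J 1 2 * (J 2 0 * J 3 3 - J 2 3 * J 3 0)
      + J 1 3 * (J 2 0 * J 3 2 - J 2 2 * J 3 0))
    + J 0 2 * (J 1 0 * (J 2 1 * J 3 3 - J 2 3 * J 3 1) - J 1 1 * (J 2 0 * J 3 3 - J 2 3 * J 3 0)
      + J 1 3 * (J 2 0 * J 3 1 - J 2 1 * J 3 0))
    - J 0 3 * (J 1 0 * (J 2 1 * J 3 2 - J 2 2 * J 3 1) - J 1 1 * (J 2 0 * J 3 2 - J 2 2 * J 3 0)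
      + J 1 2 * (J 2 0 * J 3 1 - J 2 1 * J 3 0)) := by
  simp [Matrix.det_succ_row_zero, Fin.sum_univ_succ, Fin.succAbove]
  ring

set_option maxHeartbeats 4000000 in
theorem starMat_congr [CharZero K] (J B : Mat K) (hB : B.transpose = -B) :
    J.transpose * starMat (J * B * J.transpose) * J = J.det • starMat B := by
  rw [eq_skewMat hB, mul_skewMat_mul_transpose, det_fin_four, starMat]
  have h := mul_skewMat_mul_transpose J.transpose
  rw [Matrix.transpose_transpose] at h
  rw [h]
  ext i j
  fin_cases i <;> fin_cases j <;>
    simp only [skewMat, starMat, Matrix.transpose_apply, Matrix.smul_apply, smul_eq_mul] <;>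
    simp <;> ring

/-- The Hodge dual of the two-form `A`, for the metric with inverse `gi` and the volume form with
`η_{0123} = h`. -/
def hodge (h : K) (gi A : Mat K) : Mat K := h • starMat (gi * A * gi)

theorem hodge_transpose (h : K) (gi A : Mat K) :
    (hodge h gi A).transpose = -hodge h gi A := by
  rw [hodge, Matrix.transpose_smul, starMat_transpose, smul_neg]

theorem hodge_add (h : K) (gi A B : Mat K) :
    hodge h gi (A + B) = hodge h gi A + hodge h gi B := by
  simp only [hodge, mul_add, add_mul, starMat_add, smul_add]

theorem hodge_smul (h : K) (gi : Mat K) (r : K) (A : Mat K) :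
    hodge h gi (r • A) = r • hodge h gi A := by
  simp only [hodge, Matrix.mul_smul, Matrix.smul_mul, starMat_smul]
  rw [smul_comm]

theorem hodge_congr [CharZero K] (h : K) {g J A : Mat K} (hJ : IsUnit J.det)
    (hg : g.transpose = g) (hA : A.transpose = -A) :
    hodge (h * J.det) (J.transpose * g * J)⁻¹ (J.transpose * A * J) =
      J.transpose * hodge h g⁻¹ A * J := by
  have hJt : IsUnit J.transpose.det := by rwa [Matrix.det_transpose]
  have hgi : (g⁻¹).transpose = g⁻¹ := by rw [Matrix.transpose_nonsing_inv, hg]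
  set B := J⁻¹ * (g⁻¹ * A * g⁻¹) * (J.transpose)⁻¹ with hBdef
  have hB : (J.transpose * g * J)⁻¹ * (J.transpose * A * J) * (J.transpose * g * J)⁻¹ = B := by
    rw [Matrix.mul_inv_rev, Matrix.mul_inv_rev, hBdef]
    simp only [Matrix.mul_assoc]
    rw [Matrix.nonsing_inv_mul_cancel_left _ _ hJt, Matrix.mul_nonsing_inv_cancel_left _ _ hJ]
  have hJB : J * B * J.transpose = g⁻¹ * A * g⁻¹ := by
    rw [hBdef]
    simp only [Matrix.mul_assoc]
    rw [Matrix.nonsing_inv_mul _ hJt, Matrix.mul_one, Matrix.mul_nonsing_inv_cancel_left _ _ hJ]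
  have hBs : B.transpose = -B := by
    rw [hBdef]
    simp only [Matrix.transpose_mul, Matrix.transpose_nonsing_inv, hA, hg,
      Matrix.transpose_transpose, Matrix.mul_assoc, Matrix.neg_mul, Matrix.mul_neg]
  rw [hodge, hB, mul_smul, ← starMat_congr J B hBs, hJB, hodge]
  simp only [Matrix.mul_smul, Matrix.smul_mul]

end Star
end KillingGeometry
end

noncomputable section
namespace KillingGeometry

section Frame

variable {K : Type*} [Field K]

/-- The Minkowski metric. -/
def minkMat (K : Type*) [Field K] : Mat K := Matrix.diagonal ![-1, 1, 1, 1]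

theorem minkMat_mul_self : minkMat K * minkMat K = 1 := by
  rw [minkMat, Matrix.diagonal_mul_diagonal, ← Matrix.diagonal_one]
  congr 1
  ext i
  fin_cases i <;> simp

theorem minkMat_inv : (minkMat K)⁻¹ = minkMat K := Matrix.inv_eq_right_inv minkMat_mul_self

theorem minkMat_transpose : (minkMat K).transpose = minkMat K := Matrix.diagonal_transpose _

/-- `P` is the matrix of an orthonormal coframe of the metric `g`, in which the volume form with
`η_{0123} = h` has the component `s = ± 1`. -/
structure IsCoframe (P : Mat K) (s : K) (g : Mat K) (h : K) : Prop where
  isUnit : IsUnit P.det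
  sq_eq : s * s = 1
  metric_eq : g = P.transpose * minkMat K * P
  vol_eq : h = s * P.det

namespace IsCoframe

variable {P g : Mat K} {s h : K}

theorem isUnit_transpose (H : IsCoframe P s g h) : IsUnit P.transpose.det := by
  rw [Matrix.det_transpose]; exact H.isUnit

theorem transpose_eq (H : IsCoframe P s g h) : g.transpose = g := by
  rw [H.metric_eq]
  simp only [Matrix.transpose_mul, Matrix.transpose_transpose, minkMat_transpose, Matrix.mul_assoc]

theorem isUnit_metric (H : IsCoframe P s g h) : IsUnit g.det := by
  rw [H.metric_eq, Matrix.det_mul, Matrix.det_mul]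
  refine (H.isUnit_transpose.mul ?_).mul H.isUnit
  exact (Matrix.isUnit_iff_isUnit_det _).mp (IsUnit.of_mul_eq_one _ minkMat_mul_self)

theorem inv_eq (H : IsCoframe P s g h) : g⁻¹ = P⁻¹ * minkMat K * P.transpose⁻¹ := by
  rw [H.metric_eq, Matrix.mul_inv_rev, Matrix.mul_inv_rev, minkMat_inv, Matrix.mul_assoc]

theorem mul_inv_mul (H : IsCoframe P s g h) (A B : Mat K) :
    P.transpose * A * P * g⁻¹ * (P.transpose * B * P) =
      P.transpose * (A * minkMat K * B) * P := by
  rw [H.inv_eq]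
  simp only [Matrix.mul_assoc]
  rw [Matrix.mul_nonsing_inv_cancel_left _ _ H.isUnit,
    Matrix.nonsing_inv_mul_cancel_left _ _ H.isUnit_transpose]

theorem trace_eq (H : IsCoframe P s g h) (A B : Mat K) :
    (P.transpose * A * P * g⁻¹ * (P.transpose * B * P) * g⁻¹).trace =
      (A * minkMat K * B * minkMat K).trace := by
  rw [H.mul_inv_mul, H.inv_eq]
  simp only [Matrix.mul_assoc]
  rw [Matrix.mul_nonsing_inv_cancel_left _ _ H.isUnit, Matrix.trace_mul_comm]
  simp only [Matrix.mul_assoc]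
  rw [Matrix.nonsing_inv_mul _ H.isUnit_transpose, Matrix.mul_one]

theorem congr_inv_congr (H : IsCoframe P s g h) (A : Mat K) :
    P.transpose * (P⁻¹.transpose * A * P⁻¹) * P = A := by
  simp only [Matrix.mul_assoc, Matrix.transpose_nonsing_inv]
  rw [Matrix.nonsing_inv_mul _ H.isUnit, Matrix.mul_one,
    Matrix.mul_nonsing_inv_cancel_left _ _ H.isUnit_transpose]

theorem congr_injective (H : IsCoframe P s g h) {A B : Mat K}
    (e : P.transpose * A * P = P.transpose * B * P) : A = B := by
  have := congrArg (fun C => P.transpose⁻¹ * C * P⁻¹) e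
  simp only [Matrix.mul_assoc] at this
  simpa only [Matrix.nonsing_inv_mul_cancel_left _ _ H.isUnit_transpose,
    Matrix.mul_nonsing_inv _ H.isUnit, Matrix.mul_one] using this

theorem hodge_eq [CharZero K] (H : IsCoframe P s g h) {A : Mat K} (hA : A.transpose = -A) :
    hodge h g⁻¹ (P.transpose * A * P) = P.transpose * hodge s (minkMat K) A * P := by
  rw [H.vol_eq, H.metric_eq, hodge_congr s H.isUnit minkMat_transpose hA, minkMat_inv]

theorem skew_frame (A : Mat K) (hA : A.transpose = -A) :
    (P⁻¹.transpose * A * P⁻¹).transpose = -(P⁻¹.transpose * A * P⁻¹) := by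
  simp only [Matrix.transpose_mul, Matrix.transpose_transpose, hA, Matrix.mul_assoc,
    Matrix.mul_neg, Matrix.neg_mul]

end IsCoframe

theorem hodge_minkMat (s a b c d e f : K) :
    hodge s (minkMat K) (skewMat a b c d e f) =
      skewMat (s * f) (-(s * e)) (s * d) (-(s * c)) (s * b) (-(s * a)) := by
  have h : minkMat K * skewMat a b c d e f * minkMat K = skewMat (-a) (-b) (-c) d e f := by
    ext i j
    fin_cases i <;> fin_cases j <;> simp [minkMat, skewMat]
  rw [hodge, h]
  ext i j
  fin_cases i <;> fin_cases j <;> simp [starMat, skewMat]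

theorem IsCoframe.hodge_hodge [CharZero K] {P g : Mat K} {s h : K} (H : IsCoframe P s g h)
    {A : Mat K} (hA : A.transpose = -A) : hodge h g⁻¹ (hodge h g⁻¹ A) = -A := by
  obtain ⟨B, hB, rfl⟩ : ∃ B : Mat K, B.transpose = -B ∧ A = P.transpose * B * P :=
    ⟨_, IsCoframe.skew_frame A hA, (H.congr_inv_congr A).symm⟩
  rw [H.hodge_eq hB, H.hodge_eq (hodge_transpose _ _ _)]
  have h : hodge s (minkMat K) (hodge s (minkMat K) B) = -B := by
    rw [eq_skewMat hB, hodge_minkMat, hodge_minkMat]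
    have h2 : ∀ x : K, s * (s * x) = x := fun x => by rw [← mul_assoc, H.sq_eq, one_mul]
    ext i j
    fin_cases i <;> fin_cases j <;> simp [skewMat, h2]
  rw [h]
  simp

end Frame

section SelfDual

open Complex

/-- Self-dual two-forms: `(1/2) η_{abcd} A^{cd} = -i A_{ab}`. -/
structure IsSelfDual (h : ℂ) (gi A : Mat ℂ) : Prop where
  skew : A.transpose = -A
  hodge_eq : hodge h gi A = -I • A

theorem clifford_minkMat {k : ℂ} (hk : k * k = -1) (u v w x y z : ℂ) :
    skewMat (k * u) (-(k * v)) (k * w) w v u * minkMat ℂ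
        * skewMat (k * x) (-(k * y)) (k * z) z y x
      + skewMat (k * x) (-(k * y)) (k * z) z y x * minkMat ℂ
        * skewMat (k * u) (-(k * v)) (k * w) w v u
      = ((1 / 2) * (skewMat (k * u) (-(k * v)) (k * w) w v u * minkMat ℂ
        * skewMat (k * x) (-(k * y)) (k * z) z y x * minkMat ℂ).trace) • minkMat ℂ := by
  have h2 : k ^ 2 = -1 := by rw [sq, hk]
  ext i j
  fin_cases i <;> fin_cases j <;>
    simp only [Matrix.mul_apply, Fin.sum_univ_four, Matrix.trace, Matrix.add_apply,
      Matrix.smul_apply, Matrix.diag_apply, smul_eq_mul] <;>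
    simp [minkMat, skewMat] <;> ring_nf <;> (try rw [h2]) <;> ring

theorem IsCoframe.clifford {P g : Mat ℂ} {s h : ℂ} (H : IsCoframe P s g h) {A B : Mat ℂ}
    (hA : IsSelfDual h g⁻¹ A) (hB : IsSelfDual h g⁻¹ B) :
    A * g⁻¹ * B + B * g⁻¹ * A = ((1 / 2) * (A * g⁻¹ * B * g⁻¹).trace) • g := by
  have key : ∀ C : Mat ℂ, IsSelfDual h g⁻¹ C → ∃ u v w : ℂ, C = P.transpose *
      skewMat (I * s * u) (-(I * s * v)) (I * s * w) w v u * P := by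
    intro C hC
    obtain ⟨D, hD⟩ : ∃ D, D = P⁻¹.transpose * C * P⁻¹ := ⟨_, rfl⟩
    have hDs := IsCoframe.skew_frame (P := P) C hC.skew
    rw [← hD] at hDs
    have hDC : P.transpose * D * P = C := by rw [hD, H.congr_inv_congr C]
    have h1 := H.hodge_eq hDs
    rw [hDC, hC.hodge_eq, ← hDC] at h1
    have h2 : -I • D = hodge s (minkMat ℂ) D := by
      apply H.congr_injective
      rw [← h1, Matrix.mul_smul, Matrix.smul_mul]
    have hDe := eq_skewMat hDs
    rw [hDe, hodge_minkMat] at h2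
    have e (i j) := congrFun (congrFun h2 i) j
    have e0 := e 0 1
    have e1 := e 0 2
    have e2 := e 0 3
    simp [skewMat] at e0 e1 e2
    refine ⟨D 2 3, D 1 3, D 1 2, ?_⟩
    have f0 : I * s * D 2 3 = D 0 1 := by
      linear_combination (-I) * e0 - D 0 1 * I_mul_I
    have f1 : -(I * s * D 1 3) = D 0 2 := by
      linear_combination I * e1 - D 0 2 * I_mul_I
    have f2 : I * s * D 1 2 = D 0 3 := by
      linear_combination (-I) * e2 - D 0 3 * I_mul_I
    rw [f0, f1, f2, ← hDe, hDC]
  obtain ⟨u, v, w, rfl⟩ := key A hA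
  obtain ⟨x, y, z, rfl⟩ := key B hB
  have hk : (I * s) * (I * s) = -1 := by
    linear_combination s * s * I_mul_I - H.sq_eq
  rw [H.trace_eq, H.mul_inv_mul, H.mul_inv_mul, H.metric_eq, ← Matrix.add_mul, ← Matrix.mul_add,
    clifford_minkMat hk, Matrix.mul_smul, Matrix.smul_mul]

end SelfDual

end KillingGeometry
end

noncomputable section
namespace KillingGeometry

section Curvature

theorem skew_ext {A B : Mat ℝ} (hA : A.transpose = -A) (hB : B.transpose = -B)
    (h01 : A 0 1 = B 0 1) (h02 : A 0 2 = B 0 2) (h03 : A 0 3 = B 0 3) (h12 : A 1 2 = B 1 2)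
    (h13 : A 1 3 = B 1 3) (h23 : A 2 3 = B 2 3) : A = B := by
  rw [eq_skewMat hA, eq_skewMat hB, h01, h02, h03, h12, h13, h23]

set_option maxHeartbeats 1000000 in
theorem starMat_pair_symm (R : Fin 4 → Fin 4 → Mat ℝ) (h1 : ∀ a b, (R a b).transpose = -R a b)
    (h2 : ∀ a b, R b a = -R a b) (h3 : ∀ a b c d, R a b c d = R c d a b)
    (hric : ∀ b d, -R 0 b 0 d + R 1 b 1 d + R 2 b 2 d + R 3 b 3 d = 0) (a b c d : Fin 4) :
    hodge 1 (minkMat ℝ) (R a b) c d = hodge 1 (minkMat ℝ) (R c d) a b := by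
  have h2' : ∀ a b i j, R b a i j = - R a b i j := fun a b i j => by rw [h2 a b]; rfl
  have hz : ∀ a i j, R a a i j = 0 := fun a i j => self_eq_neg.mp (h2' a a i j)
  have h1' : ∀ a b i j, R a b j i = - R a b i j := fun a b i j => congrFun (congrFun (h1 a b) i) j
  have hz' : ∀ a b i, R a b i i = 0 := fun a b i => self_eq_neg.mp (h1' a b i i)
  have e : ∀ a b, hodge 1 (minkMat ℝ) (R a b) =
      skewMat (R a b 2 3) (-(R a b 1 3)) (R a b 1 2) (-(R a b 0 3)) (R a b 0 2) (-(R a b 0 1)) := by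
    intro a b
    conv_lhs => rw [eq_skewMat (h1 a b), hodge_minkMat]
    simp only [one_mul]
  have r00 := hric 0 0
  have r11 := hric 1 1
  have r22 := hric 2 2
  have r33 := hric 3 3
  have r01 := hric 0 1
  have r02 := hric 0 2
  have r03 := hric 0 3
  have r12 := hric 1 2
  have r13 := hric 1 3
  have r23 := hric 2 3
  simp only [hz, hz', h2' 0 1, h2' 0 2, h2' 0 3, h2' 1 2, h2' 1 3, h2' 2 3, h1' _ _ 0 1,
    h1' _ _ 0 2, h1' _ _ 0 3, h1' _ _ 1 2, h1' _ _ 1 3, h1' _ _ 2 3, neg_neg, neg_zero, zero_add,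
    add_zero] at r00 r11 r22 r33 r01 r02 r03 r12 r13 r23
  have s0102 := h3 0 1 0 2
  have s0103 := h3 0 1 0 3
  have s0112 := h3 0 1 1 2
  have s0113 := h3 0 1 1 3
  have s0123 := h3 0 1 2 3
  have s0203 := h3 0 2 0 3
  have s0212 := h3 0 2 1 2
  have s0213 := h3 0 2 1 3
  have s0223 := h3 0 2 2 3
  have s0312 := h3 0 3 1 2
  have s0313 := h3 0 3 1 3
  have s0323 := h3 0 3 2 3
  have s1213 := h3 1 2 1 3
  have s1223 := h3 1 2 2 3
  have s1323 := h3 1 3 2 3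
  have main : ∀ a b, hodge 1 (minkMat ℝ) (R a b) =
      Matrix.of fun c d => hodge 1 (minkMat ℝ) (R c d) a b := by
    have hs : ∀ a b, (Matrix.of fun c d => hodge 1 (minkMat ℝ) (R c d) a b).transpose =
        -Matrix.of fun c d => hodge 1 (minkMat ℝ) (R c d) a b := by
      intro a b
      ext c d
      have : hodge 1 (minkMat ℝ) (R d c) = -hodge 1 (minkMat ℝ) (R c d) := by
        rw [h2, ← neg_one_smul ℝ (R c d), hodge_smul, neg_one_smul]
      simp [this]
    have neg : ∀ a b, hodge 1 (minkMat ℝ) (R a b) =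
        (Matrix.of fun c d => hodge 1 (minkMat ℝ) (R c d) a b) →
        hodge 1 (minkMat ℝ) (R b a) =
          Matrix.of fun c d => hodge 1 (minkMat ℝ) (R c d) b a := by
      intro a b hab
      rw [h2, ← neg_one_smul ℝ (R a b), hodge_smul, neg_one_smul, hab]
      ext c d
      exact (congrFun (congrFun (hodge_transpose 1 (minkMat ℝ) (R c d)) a) b).symm
    have diag : ∀ a, hodge 1 (minkMat ℝ) (R a a) =
        (Matrix.of fun c d => hodge 1 (minkMat ℝ) (R c d) a a) := by
      intro a
      have h0 : R a a = (0 : ℝ) • R a a := by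
        ext i j
        rw [zero_smul, hz, Matrix.zero_apply]
      rw [h0, hodge_smul, zero_smul]
      ext c d
      exact (self_eq_neg.mp
        (congrFun (congrFun (hodge_transpose 1 (minkMat ℝ) (R c d)) a) a)).symm
    have p01 : hodge 1 (minkMat ℝ) (R 0 1) =
        (Matrix.of fun c d => hodge 1 (minkMat ℝ) (R c d) 0 1) := by
      apply skew_ext (hodge_transpose _ _ _) (hs _ _) <;> simp [e, skewMat] <;> linarith
    have p02 : hodge 1 (minkMat ℝ) (R 0 2) =
        (Matrix.of fun c d => hodge 1 (minkMat ℝ) (R c d) 0 2) := by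
      apply skew_ext (hodge_transpose _ _ _) (hs _ _) <;> simp [e, skewMat] <;> linarith
    have p03 : hodge 1 (minkMat ℝ) (R 0 3) =
        (Matrix.of fun c d => hodge 1 (minkMat ℝ) (R c d) 0 3) := by
      apply skew_ext (hodge_transpose _ _ _) (hs _ _) <;> simp [e, skewMat] <;> linarith
    have p12 : hodge 1 (minkMat ℝ) (R 1 2) =
        (Matrix.of fun c d => hodge 1 (minkMat ℝ) (R c d) 1 2) := by
      apply skew_ext (hodge_transpose _ _ _) (hs _ _) <;> simp [e, skewMat] <;> linarith
    have p13 : hodge 1 (minkMat ℝ) (R 1 3) =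
        (Matrix.of fun c d => hodge 1 (minkMat ℝ) (R c d) 1 3) := by
      apply skew_ext (hodge_transpose _ _ _) (hs _ _) <;> simp [e, skewMat] <;> linarith
    have p23 : hodge 1 (minkMat ℝ) (R 2 3) =
        (Matrix.of fun c d => hodge 1 (minkMat ℝ) (R c d) 2 3) := by
      apply skew_ext (hodge_transpose _ _ _) (hs _ _) <;> simp [e, skewMat] <;> linarith
    intro a b
    fin_cases a <;> fin_cases b
    exacts [diag 0, p01, p02, p03, neg _ _ p01, diag 1, p12, p13, neg _ _ p02, neg _ _ p12,
      diag 2, p23, neg _ _ p03, neg _ _ p13, neg _ _ p23, diag 3]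
  exact congrFun (congrFun (main a b) c) d

theorem sum_pair_comm {N : Type*} [AddCommMonoid N] (f : Fin 4 → Fin 4 → Fin 4 → Fin 4 → N) :
    ∑ a, ∑ b, ∑ c, ∑ d, f a b c d = ∑ c, ∑ d, ∑ a, ∑ b, f a b c d := by
  have e : ∀ F : Fin 4 → Fin 4 → Fin 4 → N, ∑ a, ∑ c, ∑ d, F a c d = ∑ c, ∑ d, ∑ a, F a c d :=
    fun F => Finset.sum_comm.trans (Finset.sum_congr rfl fun _ _ => Finset.sum_comm)
  simp only [e (fun b c d => f _ b c d)]
  exact e _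

theorem conj_apply (A P : Mat ℝ) (c d : Fin 4) : (P.transpose * A * P) c d =
    ∑ p, ∑ q, P p c * P q d * A p q := by
  simp only [Matrix.mul_apply, Matrix.transpose_apply, Finset.sum_mul]
  rw [Finset.sum_comm]
  exact Finset.sum_congr rfl fun _ _ => Finset.sum_congr rfl fun _ _ => by ring

theorem hodge_sum {ι : Type*} (t : Finset ι) (h : ℝ) (gi : Mat ℝ) (A : ι → Mat ℝ) :
    hodge h gi (∑ i ∈ t, A i) = ∑ i ∈ t, hodge h gi (A i) :=
  map_sum (AddMonoidHom.mk' (hodge h gi) (hodge_add h gi)) A t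

/-- In vacuum the left dual of the curvature tensor is equal to its right dual. -/
theorem IsCoframe.hodge_pair_symm {P g : Mat ℝ} {s h : ℝ} (H : IsCoframe P s g h)
    (R : Fin 4 → Fin 4 → Mat ℝ) (h1 : ∀ a b, (R a b).transpose = -R a b)
    (h2 : ∀ a b, R b a = -R a b) (h3 : ∀ a b c d, R a b c d = R c d a b)
    (hric : ∀ b d, ∑ a, ∑ c, g⁻¹ a c * R a b c d = 0) (a b c d : Fin 4) :
    hodge h g⁻¹ (R a b) c d = hodge h g⁻¹ (R c d) a b := by
  set Q := P⁻¹ with hQ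
  let R' : Fin 4 → Fin 4 → Mat ℝ := fun m n =>
    ∑ a, ∑ b, (Q a m * Q b n) • (Q.transpose * R a b * Q)
  have hR'a : ∀ m n p q, R' m n p q = ∑ a, ∑ b, ∑ c, ∑ d,
      (Q a m * Q b n * Q c p * Q d q) * R a b c d := by
    intro m n p q
    simp only [R', Matrix.sum_apply, Matrix.smul_apply, conj_apply, smul_eq_mul, Finset.mul_sum]
    refine Finset.sum_congr rfl fun _ _ => Finset.sum_congr rfl fun _ _ =>
      Finset.sum_congr rfl fun _ _ => Finset.sum_congr rfl fun _ _ => by ring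
  have k1 : ∀ m n, (R' m n).transpose = -R' m n := by
    intro m n
    simp only [R', Matrix.transpose_sum, Matrix.transpose_smul, Matrix.transpose_mul,
      Matrix.transpose_transpose, h1, Matrix.neg_mul, Matrix.mul_neg, smul_neg,
      Finset.sum_neg_distrib, Matrix.mul_assoc]
  have k2 : ∀ m n, R' n m = -R' m n := by
    intro m n
    simp only [R']
    rw [Finset.sum_comm, ← Finset.sum_neg_distrib]
    refine Finset.sum_congr rfl fun a _ => ?_
    rw [← Finset.sum_neg_distrib]
    refine Finset.sum_congr rfl fun b _ => ?_
    rw [h2 a b, mul_comm]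
    simp
  have k3 : ∀ m n p q, R' m n p q = R' p q m n := by
    intro m n p q
    rw [hR'a, hR'a]
    rw [sum_pair_comm]
    refine Finset.sum_congr rfl fun a _ => Finset.sum_congr rfl fun b _ =>
      Finset.sum_congr rfl fun c _ => Finset.sum_congr rfl fun d _ => ?_
    rw [h3 c d a b]
    ring
  have hgi : ∀ a c, g⁻¹ a c =
      -(Q a 0 * Q c 0) + Q a 1 * Q c 1 + Q a 2 * Q c 2 + Q a 3 * Q c 3 := by
    intro a c
    rw [H.inv_eq, ← Matrix.transpose_nonsing_inv, ← hQ]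
    simp [Matrix.mul_apply, minkMat, Fin.sum_univ_four, Matrix.diagonal]
  have k4 : ∀ n q, -R' 0 n 0 q + R' 1 n 1 q + R' 2 n 2 q + R' 3 n 3 q = 0 := by
    intro n q
    have : ∑ b, ∑ d, Q b n * Q d q * ∑ a, ∑ c, g⁻¹ a c * R a b c d = 0 := by
      simp only [hric, mul_zero, Finset.sum_const_zero]
    rw [← this]
    have sw : ∀ f : Fin 4 → Fin 4 → Fin 4 → Fin 4 → ℝ, ∑ a, ∑ b, ∑ c, ∑ d, f a b c d =
        ∑ b, ∑ d, ∑ a, ∑ c, f a b c d := by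
      intro f
      rw [Finset.sum_comm]
      refine Finset.sum_congr rfl fun b _ => ?_
      rw [Finset.sum_comm]
      conv_rhs => rw [Finset.sum_comm]; enter [2, a]; rw [Finset.sum_comm]
      rw [Finset.sum_comm]
    have hR'b : ∀ m n p q, R' m n p q = ∑ b, ∑ d, ∑ a, ∑ c,
        (Q a m * Q b n * Q c p * Q d q) * R a b c d := by
      intro m n p q
      rw [hR'a, sw]
    simp only [hR'b, Finset.mul_sum, hgi, ← Finset.sum_neg_distrib, ← Finset.sum_add_distrib]
    refine Finset.sum_congr rfl fun a _ => Finset.sum_congr rfl fun b _ =>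
      Finset.sum_congr rfl fun c _ => Finset.sum_congr rfl fun d _ => by ring
  have back : ∀ a b, R a b = P.transpose * (∑ m, ∑ n, (P m a * P n b) • R' m n) * P := by
    intro a b
    have hPQ : ∀ i j, ∑ m, Q i m * P m j = if i = j then 1 else 0 := by
      intro i j
      have := congrFun (congrFun (Matrix.nonsing_inv_mul P H.isUnit) i) j
      rwa [Matrix.mul_apply, Matrix.one_apply] at this
    have : ∑ m, ∑ n, (P m a * P n b) • R' m n = Q.transpose * R a b * Q := by
      have e : ∀ m n, (P m a * P n b) • R' m n = ∑ i, ∑ j,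
          ((Q i m * P m a) * (Q j n * P n b)) • (Q.transpose * R i j * Q) := by
        intro m n
        simp only [R', Finset.smul_sum, smul_smul]
        refine Finset.sum_congr rfl fun _ _ => Finset.sum_congr rfl fun _ _ => ?_
        congr 1
        ring
      simp only [e]
      rw [sum_pair_comm]
      simp only [← Finset.sum_smul, ← Finset.mul_sum, ← Finset.sum_mul, hPQ]
      simp
    rw [this, hQ, H.congr_inv_congr]
  have hD : ∀ a b c d, hodge h g⁻¹ (R a b) c d = s * ∑ m, ∑ n, ∑ p, ∑ q,
      (P m a * P n b * P p c * P q d) * hodge 1 (minkMat ℝ) (R' m n) p q := by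
    intro a b c d
    have hsk : (∑ m, ∑ n, (P m a * P n b) • R' m n).transpose =
        -∑ m, ∑ n, (P m a * P n b) • R' m n := by
      simp only [Matrix.transpose_sum, Matrix.transpose_smul, k1, smul_neg,
        Finset.sum_neg_distrib]
    have hs : ∀ A, hodge s (minkMat ℝ) A = s • hodge 1 (minkMat ℝ) A := by
      intro A
      rw [hodge, hodge, one_smul]
    rw [back a b, H.hodge_eq hsk, hs, Matrix.mul_smul, Matrix.smul_mul, Matrix.smul_apply,
      smul_eq_mul, hodge_sum]
    simp only [hodge_sum, hodge_smul, conj_apply, Matrix.sum_apply, Matrix.smul_apply, smul_eq_mul]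
    simp only [Finset.mul_sum]
    rw [sum_pair_comm]
    refine Finset.sum_congr rfl fun a _ => Finset.sum_congr rfl fun b _ =>
      Finset.sum_congr rfl fun c _ => Finset.sum_congr rfl fun d _ => by ring
  rw [hD, hD]
  congr 1
  rw [sum_pair_comm]
  refine Finset.sum_congr rfl fun m _ => Finset.sum_congr rfl fun n _ =>
    Finset.sum_congr rfl fun p _ => Finset.sum_congr rfl fun q _ => ?_
  rw [starMat_pair_symm R' k1 k2 k3 k4 p q m n]
  ring

end Curvature
end KillingGeometry
end

noncomputable section
namespace KillingGeometry

section SelfDualAlgebra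

open Complex

/-- The contraction `A_{ab} B^{ab}` of two two-forms. -/
def pairing (gi A B : Mat ℂ) : ℂ := -(A * gi * B * gi).trace

theorem pairing_comm (gi A B : Mat ℂ) : pairing gi A B = pairing gi B A := by
  simp only [pairing, Matrix.mul_assoc]
  rw [← Matrix.mul_assoc, Matrix.trace_mul_comm, Matrix.mul_assoc]

theorem pairing_add_left (gi A B C : Mat ℂ) :
    pairing gi (A + B) C = pairing gi A C + pairing gi B C := by
  simp only [pairing, Matrix.add_mul, Matrix.trace_add, neg_add]

theorem pairing_smul_left (gi : Mat ℂ) (r : ℂ) (A C : Mat ℂ) :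
    pairing gi (r • A) C = r * pairing gi A C := by
  simp only [pairing, Matrix.smul_mul, Matrix.trace_smul, smul_eq_mul, mul_neg]

theorem pairing_sub_left (gi A B C : Mat ℂ) :
    pairing gi (A - B) C = pairing gi A C - pairing gi B C := by
  rw [sub_eq_add_neg, ← neg_one_smul ℂ B, pairing_add_left, pairing_smul_left]
  ring

theorem pairing_add_right (gi A B C : Mat ℂ) :
    pairing gi A (B + C) = pairing gi A B + pairing gi A C := by
  rw [pairing_comm, pairing_add_left, pairing_comm gi B, pairing_comm gi C]

theorem pairing_smul_right (gi : Mat ℂ) (r : ℂ) (A C : Mat ℂ) :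
    pairing gi A (r • C) = r * pairing gi A C := by
  rw [pairing_comm, pairing_smul_left, pairing_comm]

theorem pairing_sub_right (gi A B C : Mat ℂ) :
    pairing gi A (B - C) = pairing gi A B - pairing gi A C := by
  rw [pairing_comm, pairing_sub_left, pairing_comm gi B, pairing_comm gi C]

theorem pairing_sum_left {ι : Type*} (t : Finset ι) (gi : Mat ℂ) (A : ι → Mat ℂ) (C : Mat ℂ) :
    pairing gi (∑ i ∈ t, A i) C = ∑ i ∈ t, pairing gi (A i) C :=
  map_sum (AddMonoidHom.mk' (fun A => pairing gi A C) fun A B => pairing_add_left gi A B C) A t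

theorem pairing_eq_sum {gi : Mat ℂ} (hgi : gi.transpose = gi) (A : Mat ℂ) {B : Mat ℂ}
    (hB : B.transpose = -B) :
    pairing gi A B = ∑ a, ∑ b, A a b * (gi * B * gi) a b := by
  have h : ∀ a b, (gi * B * gi) b a = - (gi * B * gi) a b := by
    intro a b
    have : (gi * B * gi).transpose = -(gi * B * gi) := by
      simp only [Matrix.transpose_mul, hgi, hB, Matrix.mul_assoc, Matrix.neg_mul, Matrix.mul_neg]
    exact congrFun (congrFun this a) b
  rw [pairing, Matrix.mul_assoc, Matrix.mul_assoc, ← Matrix.mul_assoc gi, Matrix.trace]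
  simp only [Matrix.diag_apply, Matrix.mul_apply (M := A), ← Finset.sum_neg_distrib]
  exact Finset.sum_congr rfl fun a _ => Finset.sum_congr rfl fun b _ => by rw [h a b, mul_neg, neg_neg]

theorem IsSelfDual.smul {h : ℂ} {gi A : Mat ℂ} (hA : IsSelfDual h gi A) (r : ℂ) :
    IsSelfDual h gi (r • A) where
  skew := by rw [Matrix.transpose_smul, hA.skew, smul_neg]
  hodge_eq := by rw [hodge_smul, hA.hodge_eq, smul_comm]

theorem IsSelfDual.add {h : ℂ} {gi A B : Mat ℂ} (hA : IsSelfDual h gi A)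
    (hB : IsSelfDual h gi B) : IsSelfDual h gi (A + B) where
  skew := by rw [Matrix.transpose_add, hA.skew, hB.skew, neg_add]
  hodge_eq := by rw [hodge_add, hA.hodge_eq, hB.hodge_eq, smul_add]

theorem IsSelfDual.zero (h : ℂ) (gi : Mat ℂ) : IsSelfDual h gi 0 where
  skew := by simp
  hodge_eq := by
    rw [← zero_smul ℂ (0 : Mat ℂ), hodge_smul, zero_smul, zero_smul, smul_zero]

theorem IsSelfDual.sum {ι : Type*} (t : Finset ι) {h : ℂ} {gi : Mat ℂ} {A : ι → Mat ℂ}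
    (hA : ∀ i, IsSelfDual h gi (A i)) : IsSelfDual h gi (∑ i ∈ t, A i) :=
  Finset.sum_induction A (IsSelfDual h gi) (fun _ _ => IsSelfDual.add) (IsSelfDual.zero h gi)
    fun i _ => hA i

/-- The self-dual part of a two-form, up to a factor two. -/
theorem IsCoframe.isSelfDual_add {P g : Mat ℂ} {s h : ℂ} (H : IsCoframe P s g h) {A : Mat ℂ}
    (hA : A.transpose = -A) : IsSelfDual h g⁻¹ (A + I • hodge h g⁻¹ A) where
  skew := by
    rw [Matrix.transpose_add, Matrix.transpose_smul, hodge_transpose, hA, smul_neg, neg_add]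
  hodge_eq := by
    rw [hodge_add, hodge_smul, H.hodge_hodge hA, smul_add, smul_smul, neg_mul, I_mul_I, smul_neg,
      neg_neg, one_smul, neg_smul, add_comm]

theorem starMat_adjoint {A B : Mat ℂ} (hA : A.transpose = -A) (hB : B.transpose = -B) :
    (starMat A * B).trace = (A * starMat B).trace := by
  rw [eq_skewMat hA, eq_skewMat hB]
  simp [starMat, skewMat, Matrix.trace, Fin.sum_univ_four]
  ring

theorem pairing_hodge_left {h : ℂ} {gi : Mat ℂ} (hgi : gi.transpose = gi) {A B : Mat ℂ}
    (hA : A.transpose = -A) (hB : B.transpose = -B) :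
    pairing gi (hodge h gi A) B = pairing gi A (hodge h gi B) := by
  have h1 : ∀ C : Mat ℂ, C.transpose = -C → (gi * C * gi).transpose = -(gi * C * gi) := by
    intro C hC
    simp only [Matrix.transpose_mul, hgi, hC, Matrix.mul_assoc, Matrix.neg_mul, Matrix.mul_neg]
  have h2 := starMat_adjoint (h1 A hA) (h1 B hB)
  simp only [pairing, hodge, Matrix.smul_mul, Matrix.mul_smul, Matrix.trace_smul]
  congr 2
  rw [Matrix.mul_assoc (starMat _), Matrix.mul_assoc (starMat _), h2, Matrix.mul_assoc gi A,
    Matrix.mul_assoc gi, Matrix.trace_mul_comm gi]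

/-- The two-form `(g_{ac} g_{bd} - g_{ad} g_{bc})_{cd}`. -/
def wedgeForm (g : Mat ℂ) (a b : Fin 4) : Mat ℂ :=
  Matrix.of fun c d => g a c * g b d - g a d * g b c

/-- The self-dual two-form `(ℐ_{abcd})_{cd}`. -/
def idForm (g : Mat ℂ) (h : ℂ) (a b : Fin 4) : Mat ℂ :=
  (1 / 4 : ℂ) • (wedgeForm g a b + I • hodge h g⁻¹ (wedgeForm g a b))

theorem wedgeForm_transpose (g : Mat ℂ) (a b : Fin 4) :
    (wedgeForm g a b).transpose = -wedgeForm g a b := by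
  ext c d
  simp [wedgeForm]

theorem pairing_wedgeForm {g : Mat ℂ} (hg : g.transpose = g) (hu : IsUnit g.det) (a b : Fin 4)
    {A : Mat ℂ} (hA : A.transpose = -A) : pairing g⁻¹ (wedgeForm g a b) A = 2 * A a b := by
  have hgi : (g⁻¹).transpose = g⁻¹ := by rw [Matrix.transpose_nonsing_inv, hg]
  have hgs : ∀ i j, g i j = g j i := fun i j => congrFun (congrFun hg j) i
  have h1 : g * (g⁻¹ * A * g⁻¹) * g = A := by
    simp only [Matrix.mul_assoc]
    rw [Matrix.nonsing_inv_mul _ hu, Matrix.mul_one, Matrix.mul_nonsing_inv_cancel_left _ _ hu]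
  have h2 : ∀ a b, A a b = ∑ c, ∑ d, g a c * g b d * (g⁻¹ * A * g⁻¹) c d := by
    intro a b
    conv_lhs => rw [← h1]
    rw [Matrix.mul_apply]
    simp only [Matrix.mul_apply (M := g), Finset.sum_mul]
    rw [Finset.sum_comm]
    exact Finset.sum_congr rfl fun c _ => Finset.sum_congr rfl fun d _ => by rw [hgs b d]; ring
  have h3 : A b a = - A a b := congrFun (congrFun hA a) b
  rw [pairing_eq_sum hgi _ hA]
  have h4 : ∑ c, ∑ d, wedgeForm g a b c d * (g⁻¹ * A * g⁻¹) c d = A a b - A b a := by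
    rw [h2 a b, h2 b a, ← Finset.sum_sub_distrib]
    refine Finset.sum_congr rfl fun c _ => ?_
    rw [← Finset.sum_sub_distrib]
    refine Finset.sum_congr rfl fun d _ => ?_
    rw [wedgeForm, Matrix.of_apply]
    ring
  rw [h4, h3]
  ring

theorem IsCoframe.inv_transpose {P g : Mat ℂ} {s h : ℂ} (H : IsCoframe P s g h)
    : (g⁻¹).transpose = g⁻¹ := by
  rw [Matrix.transpose_nonsing_inv, H.transpose_eq]

theorem IsCoframe.isSelfDual_idForm {P g : Mat ℂ} {s h : ℂ} (H : IsCoframe P s g h)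
    (a b : Fin 4) : IsSelfDual h g⁻¹ (idForm g h a b) :=
  (H.isSelfDual_add (wedgeForm_transpose g a b)).smul _

theorem IsCoframe.pairing_idForm {P g : Mat ℂ} {s h : ℂ} (H : IsCoframe P s g h)
    (a b : Fin 4) {A : Mat ℂ} (hA : IsSelfDual h g⁻¹ A) :
    pairing g⁻¹ (idForm g h a b) A = A a b := by
  have e : A + I • hodge h g⁻¹ A = (2 : ℂ) • A := by
    rw [hA.hodge_eq, smul_smul, mul_neg, I_mul_I, neg_neg, one_smul, two_smul]
  rw [idForm, pairing_smul_left, pairing_add_left, pairing_smul_left,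
    pairing_hodge_left H.inv_transpose (wedgeForm_transpose g a b) hA.skew,
    ← pairing_smul_right, ← pairing_add_right, e, pairing_smul_right,
    pairing_wedgeForm H.transpose_eq H.isUnit_metric a b hA.skew]
  ring

theorem IsCoframe.clifford_pairing {P g : Mat ℂ} {s h : ℂ} (H : IsCoframe P s g h)
    {A B : Mat ℂ} (hA : IsSelfDual h g⁻¹ A)
    (hB : IsSelfDual h g⁻¹ B) :
    A * g⁻¹ * B + B * g⁻¹ * A = (-(1 / 2) * pairing g⁻¹ A B) • g := by
  rw [H.clifford hA hB, pairing]
  congr 1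
  ring

/-- The contraction with a vector maps self-dual two-forms conformally to one-forms. -/
theorem IsCoframe.dot_mul_dot {P g : Mat ℂ} {s h : ℂ} (H : IsCoframe P s g h)
    {A B : Mat ℂ} (hA : IsSelfDual h g⁻¹ A) (hB : IsSelfDual h g⁻¹ B)
    (X : Fin 4 → ℂ) : Matrix.vecMul X A ⬝ᵥ (g⁻¹.mulVec (Matrix.vecMul X B)) =
      1 / 4 * (X ⬝ᵥ g.mulVec X) * pairing g⁻¹ A B := by
  have e1 : ∀ A B : Mat ℂ, B.transpose = -B →
      Matrix.vecMul X A ⬝ᵥ (g⁻¹.mulVec (Matrix.vecMul X B)) =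
      -(X ⬝ᵥ (A * g⁻¹ * B).mulVec X) := by
    intro A B hB
    have : Matrix.vecMul X B = -(B.mulVec X) := by
      rw [← Matrix.mulVec_transpose, hB, Matrix.neg_mulVec]
    rw [this, Matrix.mulVec_neg, dotProduct_neg, ← Matrix.dotProduct_mulVec, Matrix.mulVec_mulVec,
      Matrix.mulVec_mulVec, Matrix.mul_assoc]
  have e2 : X ⬝ᵥ (B * g⁻¹ * A).mulVec X = X ⬝ᵥ (A * g⁻¹ * B).mulVec X := by
    have : (B * g⁻¹ * A).transpose = A * g⁻¹ * B := by
      simp only [Matrix.transpose_mul, H.inv_transpose, hA.skew, hB.skew, Matrix.mul_assoc,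
        Matrix.neg_mul, Matrix.mul_neg, neg_neg]
    rw [← this, Matrix.mulVec_transpose, Matrix.dotProduct_mulVec, dotProduct_comm]
  have e3 := congrArg (fun C : Mat ℂ => X ⬝ᵥ C.mulVec X) (H.clifford_pairing hA hB)
  simp only [Matrix.add_mulVec, dotProduct_add, e2, Matrix.smul_mulVec, dotProduct_smul,
    smul_eq_mul] at e3
  rw [e1 A B hB.skew]
  linear_combination (-(1 / 2)) * e3

end SelfDualAlgebra
end KillingGeometry
end

noncomputable section
namespace KillingGeometry

section SimonAlgebra

open Complex

/-- The contraction `W_{abcd} U^{cd}` of a pair-symmetric tensor with a two-form. -/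
def contr (gi : Mat ℂ) (W : Fin 4 → Fin 4 → Mat ℂ) (U : Mat ℂ) : Mat ℂ :=
  ∑ c, ∑ d, (gi * U * gi) c d • W c d

variable {P g : Mat ℂ} {s h : ℂ} {W : Fin 4 → Fin 4 → Mat ℂ}

theorem isSelfDual_contr {gi : Mat ℂ} (hW : ∀ a b, IsSelfDual h gi (W a b)) (U : Mat ℂ) :
    IsSelfDual h gi (contr gi W U) :=
  IsSelfDual.sum _ fun _ => IsSelfDual.sum _ fun _ => (hW _ _).smul _

theorem IsCoframe.pairing_eq_contr (H : IsCoframe P s g h)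
    (hp : ∀ a b c d, W a b c d = W c d a b) {U : Mat ℂ} (hU : IsSelfDual h g⁻¹ U) (a b : Fin 4) :
    pairing g⁻¹ (W a b) U = contr g⁻¹ W U a b := by
  rw [pairing_eq_sum H.inv_transpose _ hU.skew, contr]
  simp only [Matrix.sum_apply, Matrix.smul_apply, smul_eq_mul]
  exact Finset.sum_congr rfl fun c _ => Finset.sum_congr rfl fun d _ => by rw [hp, mul_comm]

theorem IsCoframe.pairing_contr_comm (H : IsCoframe P s g h)
    (hp : ∀ a b c d, W a b c d = W c d a b) {U V : Mat ℂ} (hU : IsSelfDual h g⁻¹ U) (hV : IsSelfDual h g⁻¹ V) :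
    pairing g⁻¹ (contr g⁻¹ W U) V = pairing g⁻¹ (contr g⁻¹ W V) U := by
  rw [pairing_eq_sum H.inv_transpose (contr g⁻¹ W V) hU.skew, contr, pairing_sum_left]
  refine Finset.sum_congr rfl fun c _ => ?_
  rw [pairing_sum_left]
  refine Finset.sum_congr rfl fun d _ => ?_
  rw [pairing_smul_left, H.pairing_eq_contr hp hV, mul_comm]

/-- A tensor with the symmetries of the self-dual Weyl tensor that satisfies the contraction of
the Simon equation with self-dual two-forms. -/
theorem IsCoframe.eq_of_contracted_simon (H : IsCoframe P s g h)
    (hW : ∀ a b, IsSelfDual h g⁻¹ (W a b)) (hp : ∀ a b c d, W a b c d = W c d a b)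
    {F : Mat ℂ} (hF : IsSelfDual h g⁻¹ F) (hF0 : pairing g⁻¹ F F ≠ 0)
    (hS : ∀ U V Z, IsSelfDual h g⁻¹ U → IsSelfDual h g⁻¹ V → IsSelfDual h g⁻¹ Z →
      2 * (pairing g⁻¹ (contr g⁻¹ W U) V * pairing g⁻¹ F Z)
        - 2 * (pairing g⁻¹ (contr g⁻¹ W U) Z * pairing g⁻¹ F V)
        + pairing g⁻¹ U V * pairing g⁻¹ (contr g⁻¹ W F) Z
        - pairing g⁻¹ U Z * pairing g⁻¹ (contr g⁻¹ W F) V = 0) (a b : Fin 4) :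
    W a b = (3 / 2 * pairing g⁻¹ (contr g⁻¹ W F) F / pairing g⁻¹ F F ^ 2) •
      (F a b • F - (1 / 3 * pairing g⁻¹ F F) • idForm g h a b) := by
  have hI := H.isSelfDual_idForm
  set p := pairing g⁻¹ with hpdef
  set C : Mat ℂ → Mat ℂ → ℂ := fun U V => p (contr g⁻¹ W U) V with hC
  have hCs : ∀ U V, IsSelfDual h g⁻¹ U → IsSelfDual h g⁻¹ V → C U V = C V U :=
    fun U V hU hV => H.pairing_contr_comm hp hU hV
  have hps : ∀ U V, p U V = p V U := fun U V => pairing_comm _ U V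
  have e1 : ∀ V, IsSelfDual h g⁻¹ V → C V F * p F F = C F F * p F V := by
    intro V hV
    have h1 := hS V F F hV hF hF
    have h2 := hS F V F hF hV hF
    change 2 * (C F V * p F F) - 2 * (C F F * p F V) + p F V * C F F - p F F * C F V = 0 at h2
    rw [hCs F V hF hV] at h2
    linear_combination h2
  have e2 : ∀ U V, IsSelfDual h g⁻¹ U → IsSelfDual h g⁻¹ V →
      2 * C U V * p F F ^ 2 = C F F * (3 * p F U * p F V - p U V * p F F) := by
    intro U V hU hV
    have h1 := hS U V F hU hV hF
    change 2 * (C U V * p F F) - 2 * (C U F * p F V) + p U V * C F F - p U F * C F V = 0 at h1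
    rw [hCs F V hF hV, hps U F] at h1
    linear_combination p F F * h1 + 2 * p F V * e1 U hU + p F U * e1 V hV
  ext c d
  have e3 := e2 _ _ (hI a b) (hI c d)
  have e4 : C (idForm g h a b) (idForm g h c d) = W a b c d := by
    change p (contr g⁻¹ W (idForm g h a b)) (idForm g h c d) = _
    rw [hps, hpdef, H.pairing_idForm c d (isSelfDual_contr hW _), ← H.pairing_eq_contr hp (hI a b),
      pairing_comm, H.pairing_idForm a b (hW c d), hp]
  have e5 : p F (idForm g h a b) = F a b := by rw [hps, hpdef, H.pairing_idForm a b hF]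
  have e6 : p F (idForm g h c d) = F c d := by rw [hps, hpdef, H.pairing_idForm c d hF]
  have e7 : p (idForm g h a b) (idForm g h c d) = idForm g h a b c d := by
    rw [hps, hpdef, H.pairing_idForm c d (hI a b)]
  rw [e4, e5, e6, e7] at e3
  change _ = (3 / 2 * C F F / p F F ^ 2) * (F a b * F c d - (1 / 3 * p F F) * idForm g h a b c d)
  field_simp
  linear_combination e3

/-- `ξ^m A_{ma}`, as a vector. -/
def dualVec (g : Mat ℂ) (X : Fin 4 → ℂ) (U : Mat ℂ) : Fin 4 → ℂ :=
  g⁻¹.mulVec (Matrix.vecMul X U)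

theorem IsCoframe.sum_dualVec (H : IsCoframe P s g h) {A U : Mat ℂ} (hA : IsSelfDual h g⁻¹ A)
    (hU : IsSelfDual h g⁻¹ U) (X : Fin 4 → ℂ) :
    ∑ a, (∑ m, X m * A m a) * dualVec g X U a =
      1 / 4 * (X ⬝ᵥ g.mulVec X) * pairing g⁻¹ A U :=
  H.dot_mul_dot hA hU X

theorem IsCoframe.lower_dualVec (H : IsCoframe P s g h) {U : Mat ℂ} (hU : IsSelfDual h g⁻¹ U)
    (X : Fin 4 → ℂ) : ∑ a, g.mulVec X a * dualVec g X U a = 0 := by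
  change g.mulVec X ⬝ᵥ g⁻¹.mulVec (Matrix.vecMul X U) = 0
  rw [← H.transpose_eq, Matrix.mulVec_transpose, ← Matrix.dotProduct_mulVec, H.transpose_eq,
    Matrix.mulVec_mulVec, Matrix.mul_nonsing_inv _ H.isUnit_metric, Matrix.one_mulVec]
  have : X ⬝ᵥ Matrix.vecMul X U = - (X ⬝ᵥ Matrix.vecMul X U) := by
    conv_lhs => rw [← Matrix.mulVec_transpose, hU.skew, Matrix.neg_mulVec, dotProduct_neg,
      Matrix.dotProduct_mulVec, dotProduct_comm]
  exact self_eq_neg.mp this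

theorem IsCoframe.metric_dualVec (H : IsCoframe P s g h) {U V : Mat ℂ}
    (hU : IsSelfDual h g⁻¹ U) (hV : IsSelfDual h g⁻¹ V) (X : Fin 4 → ℂ) :
    ∑ a, ∑ b, dualVec g X U a * dualVec g X V b * g a b =
      1 / 4 * (X ⬝ᵥ g.mulVec X) * pairing g⁻¹ U V := by
  have : ∑ a, ∑ b, dualVec g X U a * dualVec g X V b * g a b =
      dualVec g X U ⬝ᵥ g.mulVec (dualVec g X V) := by
    simp only [dotProduct, Matrix.mulVec, Finset.mul_sum]
    exact Finset.sum_congr rfl fun a _ => Finset.sum_congr rfl fun b _ => by ring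
  rw [this, dualVec, dualVec, Matrix.mulVec_mulVec, Matrix.mul_nonsing_inv _ H.isUnit_metric,
    Matrix.one_mulVec, dotProduct_comm]
  have := H.dot_mul_dot hV hU X
  rw [this, pairing_comm]

theorem sum_simon (u v w : Fin 4 → ℂ) (A G : Fin 4 → Fin 4 → ℂ) (B K : Fin 4 → ℂ) :
    ∑ a, ∑ b, ∑ n, u a * v b * w n *
        (A a b * B n - A a n * B b - G a b * K n + G a n * K b) =
      (∑ a, ∑ b, u a * v b * A a b) * ∑ n, w n * B n
        - (∑ a, ∑ b, u a * w b * A a b) * ∑ n, v n * B n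
        - (∑ a, ∑ b, u a * v b * G a b) * ∑ n, w n * K n
        + (∑ a, ∑ b, u a * w b * G a b) * ∑ n, v n * K n := by
  have fac : ∀ (v w : Fin 4 → ℂ) (A : Fin 4 → Fin 4 → ℂ) (B : Fin 4 → ℂ),
      (∑ a, ∑ b, u a * v b * A a b) * ∑ n, w n * B n =
        ∑ a, ∑ b, ∑ n, u a * v b * w n * (A a b * B n) := by
    intro v w A B
    simp only [Finset.sum_mul]
    refine Finset.sum_congr rfl fun _ _ => Finset.sum_congr rfl fun _ _ => ?_
    rw [Finset.mul_sum]
    exact Finset.sum_congr rfl fun _ _ => by ring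
  have fac' : ∀ (v w : Fin 4 → ℂ) (A : Fin 4 → Fin 4 → ℂ) (B : Fin 4 → ℂ),
      (∑ a, ∑ b, u a * w b * A a b) * ∑ n, v n * B n =
        ∑ a, ∑ b, ∑ n, u a * v b * w n * (A a n * B b) := by
    intro v w A B
    rw [fac w v A B]
    refine Finset.sum_congr rfl fun _ _ => ?_
    rw [Finset.sum_comm]
    exact Finset.sum_congr rfl fun _ _ => Finset.sum_congr rfl fun _ _ => by ring
  rw [fac v w A B, fac' v w A B, fac v w G K, fac' v w G K]
  simp only [← Finset.sum_add_distrib, ← Finset.sum_sub_distrib]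
  exact Finset.sum_congr rfl fun _ _ => Finset.sum_congr rfl fun _ _ =>
    Finset.sum_congr rfl fun _ _ => by ring

/-- The pointwise consequence of the Simon equation at a point where the vector `X` is non-null. -/
theorem IsCoframe.eq_of_simon (H : IsCoframe P s g h)
    (hW : ∀ a b, IsSelfDual h g⁻¹ (W a b)) (hp : ∀ a b c d, W a b c d = W c d a b)
    {F : Mat ℂ} (hF : IsSelfDual h g⁻¹ F) (hF0 : pairing g⁻¹ F F ≠ 0)
    {X : Fin 4 → ℂ} (hX : X ⬝ᵥ g.mulVec X ≠ 0)
    (hS : ∀ a b n,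
      (2 * ∑ m, ∑ r, X m * X r * W m a r b) * (2 * ∑ m, X m * F m n)
        - (2 * ∑ m, ∑ r, X m * X r * W m a r n) * (2 * ∑ m, X m * F m b)
        - 1 / 2 * (-(X ⬝ᵥ g.mulVec X) * g a b + g.mulVec X a * g.mulVec X b)
          * (∑ m, X m * pairing g⁻¹ (W m n) F)
        + 1 / 2 * (-(X ⬝ᵥ g.mulVec X) * g a n + g.mulVec X a * g.mulVec X n)
          * (∑ m, X m * pairing g⁻¹ (W m b) F) = 0) (a b : Fin 4) :
    W a b = (3 / 2 * pairing g⁻¹ (contr g⁻¹ W F) F / pairing g⁻¹ F F ^ 2) •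
      (F a b • F - (1 / 3 * pairing g⁻¹ F F) • idForm g h a b) := by
  refine H.eq_of_contracted_simon hW hp hF hF0 (fun U V Z hU hV hZ => ?_) a b
  set k : ℂ := X ⬝ᵥ g.mulVec X with hk
  have hY : ∀ V, IsSelfDual h g⁻¹ V →
      ∑ a, ∑ b, dualVec g X U a * dualVec g X V b * (2 * ∑ m, ∑ r, X m * X r * W m a r b) =
        2 * (1 / 4 * k) * (1 / 4 * k) * pairing g⁻¹ (contr g⁻¹ W U) V := by
    intro V hV
    have h1 := H.sum_dualVec (isSelfDual_contr hW U) hV X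
    have h2 : ∀ r b, ∑ a, (∑ m, X m * W r b m a) * dualVec g X U a =
        1 / 4 * k * contr g⁻¹ W U r b := by
      intro r b
      rw [H.sum_dualVec (hW r b) hU X, H.pairing_eq_contr hp hU]
    have h3 : ∑ b, (∑ r, X r * ∑ a, (∑ m, X m * W r b m a) * dualVec g X U a) * dualVec g X V b =
        1 / 4 * k * (1 / 4 * k * pairing g⁻¹ (contr g⁻¹ W U) V) := by
      rw [← h1]
      simp only [h2]
      simp only [Finset.mul_sum, Finset.sum_mul]
      exact Finset.sum_congr rfl fun _ _ => Finset.sum_congr rfl fun _ _ => by ring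
    rw [Finset.sum_comm]
    have h4 : ∀ b, ∑ a, dualVec g X U a * dualVec g X V b * (2 * ∑ m, ∑ r, X m * X r * W m a r b) =
        2 * ((∑ r, X r * ∑ a, (∑ m, X m * W r b m a) * dualVec g X U a) * dualVec g X V b) := by
      intro b
      simp only [Finset.mul_sum, Finset.sum_mul]
      conv_rhs => rw [Finset.sum_comm]; enter [2, a]; rw [Finset.sum_comm]
      exact Finset.sum_congr rfl fun a _ => Finset.sum_congr rfl fun m _ =>
        Finset.sum_congr rfl fun r _ => by rw [hp m a r b]; ring
    simp only [h4, ← Finset.mul_sum, h3]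
    ring
  have hs : ∀ Z, IsSelfDual h g⁻¹ Z → ∑ n, dualVec g X Z n * (2 * ∑ m, X m * F m n) =
      2 * (1 / 4 * k) * pairing g⁻¹ F Z := by
    intro Z hZ
    have h1 := H.sum_dualVec hF hZ X
    rw [mul_assoc 2, ← h1, Finset.mul_sum]
    exact Finset.sum_congr rfl fun n _ => by ring
  have hK : ∀ Z, IsSelfDual h g⁻¹ Z → ∑ n, dualVec g X Z n * (∑ m, X m * pairing g⁻¹ (W m n) F) =
      (1 / 4 * k) * pairing g⁻¹ (contr g⁻¹ W F) Z := by
    intro Z hZ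
    rw [← H.sum_dualVec (isSelfDual_contr hW F) hZ X]
    simp only [H.pairing_eq_contr hp hF]
    exact Finset.sum_congr rfl fun n _ => by ring
  have hg : ∀ V, IsSelfDual h g⁻¹ V →
      ∑ a, ∑ b, dualVec g X U a * dualVec g X V b *
        (1 / 2 * (-k * g a b + g.mulVec X a * g.mulVec X b)) =
      1 / 2 * (-k * (1 / 4 * k * pairing g⁻¹ U V)) := by
    intro V hV
    have h1 := H.metric_dualVec hU hV X
    have h2 := H.lower_dualVec hU X
    have h3 : ∑ a, ∑ b, dualVec g X U a * dualVec g X V b *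
        (1 / 2 * (-k * g a b + g.mulVec X a * g.mulVec X b)) =
        1 / 2 * (-k * ∑ a, ∑ b, dualVec g X U a * dualVec g X V b * g a b) +
        1 / 2 * ((∑ a, g.mulVec X a * dualVec g X U a) * ∑ b, g.mulVec X b * dualVec g X V b) := by
      rw [Finset.sum_mul_sum]
      simp only [Finset.mul_sum, ← Finset.sum_add_distrib]
      exact Finset.sum_congr rfl fun _ _ => Finset.sum_congr rfl fun _ _ => by ring
    rw [h3, h1, h2, zero_mul, mul_zero, add_zero]
  have tot := sum_simon (dualVec g X U) (dualVec g X V) (dualVec g X Z)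
    (fun a b => 2 * ∑ m, ∑ r, X m * X r * W m a r b)
    (fun a b => 1 / 2 * (-k * g a b + g.mulVec X a * g.mulVec X b))
    (fun n => 2 * ∑ m, X m * F m n) (fun n => ∑ m, X m * pairing g⁻¹ (W m n) F)
  simp only [hS, mul_zero, Finset.sum_const_zero] at tot
  rw [hY V hV, hY Z hZ, hs Z hZ, hs V hV, hg V hV, hg Z hZ, hK Z hZ, hK V hV] at tot
  have hk3 : k ^ 3 ≠ 0 := pow_ne_zero 3 hX
  apply mul_left_cancel₀ hk3
  linear_combination (-32) * tot

end SimonAlgebra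
end KillingGeometry
end

noncomputable section
namespace KillingGeometry

section LeviCivita

/-- The Levi-Civita symbol. -/
def levi (a b c d : Fin 4) : ℤ :=
  Int.sign (((b : ℕ) - (a : ℕ) : ℤ) * ((c : ℕ) - (a : ℕ)) * ((d : ℕ) - (a : ℕ)) *
    ((c : ℕ) - (b : ℕ)) * ((d : ℕ) - (b : ℕ)) * ((d : ℕ) - (c : ℕ)))

/-- The components of the bivector `e_a ∧ e_b`. -/
def unitBivector (a b i j : Fin 4) : ℤ :=
  (if i = a ∧ j = b then 1 else 0) - (if i = b ∧ j = a then 1 else 0)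

theorem levi_eq : ∀ a b c d : Fin 4, levi a b c d =
    skewMat (unitBivector a b 2 3) (-unitBivector a b 1 3) (unitBivector a b 1 2)
      (unitBivector a b 0 3) (-unitBivector a b 0 2) (unitBivector a b 0 1) c d := by
  intro a b c d
  fin_cases c <;> fin_cases d <;> simp [skewMat] <;> revert a b <;> decide

theorem levi_cyclic : ∀ a b c d : Fin 4, levi a c d b = levi a b c d := by decide

theorem levi_perm : ∀ σ : Equiv.Perm (Fin 4), levi (σ 0) (σ 1) (σ 2) (σ 3) = Equiv.Perm.sign σ := by
  decide

theorem levi_eq_zero : ∀ f : Fin 4 → Fin 4, ¬ Function.Injective f →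
    levi (f 0) (f 1) (f 2) (f 3) = 0 := by
  intro f hf
  by_contra h
  apply hf
  intro i j hij
  by_contra hne
  apply h
  rw [levi, Int.sign_eq_zero_iff_zero]
  fin_cases i <;> fin_cases j <;> simp at hij hne <;> simp [hij]

variable {K : Type*} [Field K]

theorem skewMat_intCast (a b c d e f : ℤ) (i j : Fin 4) :
    ((skewMat a b c d e f i j : ℤ) : K) = skewMat (a : K) b c d e f i j := by
  fin_cases i <;> fin_cases j <;> simp [skewMat]

theorem starMat_eq_sum [CharZero K] {B : Mat K} (hB : B.transpose = -B) (c d : Fin 4) :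
    starMat B c d = 1 / 2 * ∑ a, ∑ b, (levi c d a b : K) * B a b := by
  simp only [levi_eq, skewMat_intCast]
  rw [eq_skewMat hB]
  fin_cases c <;> fin_cases d <;> simp [starMat, skewMat, unitBivector, Fin.sum_univ_four] <;> ring

theorem hodge_wedgeForm {g : Mat ℂ} {h : ℂ} (hg : g.transpose = g) (hu : IsUnit g.det)
    (a b c d : Fin 4) : hodge h g⁻¹ (wedgeForm g a b) c d = h * levi a b c d := by
  have hgs : ∀ i j, g i j = g j i := fun i j => congrFun (congrFun hg j) i
  have e0 : wedgeForm g a b = g * (Matrix.of fun i j => (unitBivector a b i j : ℂ)) * g := by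
    ext i j
    have e1 : ∀ k l : Fin 4, (unitBivector a b k l : ℂ) =
        (if k = a then 1 else 0) * (if l = b then 1 else 0)
        - (if k = b then 1 else 0) * (if l = a then 1 else 0) := by
      intro k l
      simp only [unitBivector]
      push_cast
      simp only [ite_and, ite_mul, one_mul, zero_mul]
    simp only [Matrix.mul_apply, Matrix.of_apply, e1, mul_sub, Finset.sum_sub_distrib, wedgeForm,
      sub_mul]
    simp [hgs a i, hgs b i, mul_comm]
  have e2 : g⁻¹ * wedgeForm g a b * g⁻¹ = Matrix.of fun i j => (unitBivector a b i j : ℂ) := by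
    rw [e0]
    simp only [Matrix.mul_assoc]
    rw [Matrix.mul_nonsing_inv _ hu, Matrix.mul_one, Matrix.nonsing_inv_mul_cancel_left _ _ hu]
  rw [hodge, e2, Matrix.smul_apply, smul_eq_mul, levi_eq, skewMat_intCast]
  simp [starMat]

end LeviCivita

section Contractions

open Complex

theorem IsCoframe.idForm_apply {P g : Mat ℂ} {s h : ℂ} (H : IsCoframe P s g h) (a b c d : Fin 4) :
    idForm g h a b c d =
      1 / 4 * (g a c * g b d - g a d * g b c + I * (h * levi a b c d)) := by
  rw [← hodge_wedgeForm H.transpose_eq H.isUnit_metric]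
  rfl

theorem IsCoframe.mul_inv_mul_self {P g : Mat ℂ} {s h : ℂ} (H : IsCoframe P s g h) {F : Mat ℂ}
    (hF : IsSelfDual h g⁻¹ F) : F * g⁻¹ * F = (-(1 / 4) * pairing g⁻¹ F F) • g := by
  have h1 := H.clifford_pairing hF hF
  rw [← two_smul ℂ] at h1
  apply smul_right_injective (Mat ℂ) (two_ne_zero (α := ℂ))
  dsimp only
  rw [h1, smul_smul]
  congr 1
  ring

theorem IsCoframe.wedge_contract {P g : Mat ℂ} {s h : ℂ} (H : IsCoframe P s g h) {F : Mat ℂ}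
    (hF : IsSelfDual h g⁻¹ F) (φ : Fin 4 → ℂ) (e : Fin 4) :
    ∑ a, ∑ b, (φ e * F a b + φ a * F b e + φ b * F e a) * (g⁻¹ * F * g⁻¹) a b =
      1 / 2 * pairing g⁻¹ F F * φ e := by
  have h1 : g⁻¹ * F * g⁻¹ * F = (-(1 / 4) * pairing g⁻¹ F F) • (1 : Mat ℂ) := by
    rw [Matrix.mul_assoc, Matrix.mul_assoc, ← Matrix.mul_assoc F, H.mul_inv_mul_self hF,
      Matrix.mul_smul, Matrix.nonsing_inv_mul _ H.isUnit_metric]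
  have h2 : F * (g⁻¹ * F * g⁻¹) = (-(1 / 4) * pairing g⁻¹ F F) • (1 : Mat ℂ) := by
    rw [← Matrix.mul_assoc, ← Matrix.mul_assoc, H.mul_inv_mul_self hF,
      Matrix.smul_mul, Matrix.mul_nonsing_inv _ H.isUnit_metric]
  have t1 : ∑ a, ∑ b, φ e * F a b * (g⁻¹ * F * g⁻¹) a b = φ e * pairing g⁻¹ F F := by
    rw [pairing_eq_sum H.inv_transpose _ hF.skew]
    simp only [Finset.mul_sum, mul_assoc]
  have t2 : ∑ a, ∑ b, φ a * F b e * (g⁻¹ * F * g⁻¹) a b = -(1 / 4) * pairing g⁻¹ F F * φ e := by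
    have : ∀ a, ∑ b, φ a * F b e * (g⁻¹ * F * g⁻¹) a b =
        φ a * ((g⁻¹ * F * g⁻¹) * F) a e := by
      intro a
      rw [Matrix.mul_apply (M := g⁻¹ * F * g⁻¹), Finset.mul_sum]
      exact Finset.sum_congr rfl fun _ _ => by ring
    simp only [this, h1, Matrix.smul_apply, Matrix.one_apply, smul_eq_mul]
    simp [mul_comm]
  have t3 : ∑ a, ∑ b, φ b * F e a * (g⁻¹ * F * g⁻¹) a b = -(1 / 4) * pairing g⁻¹ F F * φ e := by
    rw [Finset.sum_comm]
    have : ∀ b, ∑ a, φ b * F e a * (g⁻¹ * F * g⁻¹) a b =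
        φ b * (F * (g⁻¹ * F * g⁻¹)) e b := by
      intro b
      rw [Matrix.mul_apply (M := F), Finset.mul_sum]
      exact Finset.sum_congr rfl fun _ _ => by ring
    simp only [this, h2, Matrix.smul_apply, Matrix.one_apply, smul_eq_mul]
    simp [mul_comm]
  simp only [add_mul, Finset.sum_add_distrib, t1, t2, t3]
  ring

theorem IsCoframe.idForm_contract {P g : Mat ℂ} {s h : ℂ} (H : IsCoframe P s g h) {F : Mat ℂ}
    (hF : IsSelfDual h g⁻¹ F) (m e : Fin 4) :
    ∑ a, ∑ b, (idForm g h m e a b + idForm g h m a b e + idForm g h m b e a)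
        * (g⁻¹ * F * g⁻¹) a b = 3 / 2 * F m e := by
  have hsym : ∀ i j, g i j = g j i := fun i j => congrFun (congrFun H.transpose_eq j) i
  have k1 : ∑ a, ∑ b, idForm g h m e a b * (g⁻¹ * F * g⁻¹) a b = F m e := by
    rw [← pairing_eq_sum H.inv_transpose _ hF.skew, H.pairing_idForm m e hF]
  have k2 : ∑ a, ∑ b, wedgeForm g m e a b * (g⁻¹ * F * g⁻¹) a b = 2 * F m e := by
    rw [← pairing_eq_sum H.inv_transpose _ hF.skew,
      pairing_wedgeForm H.transpose_eq H.isUnit_metric m e hF.skew]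
  have k3 : ∀ a b, (idForm g h m e a b + idForm g h m a b e + idForm g h m b e a)
        * (g⁻¹ * F * g⁻¹) a b = 3 * (idForm g h m e a b * (g⁻¹ * F * g⁻¹) a b)
          - 3 / 4 * (wedgeForm g m e a b * (g⁻¹ * F * g⁻¹) a b) := by
    intro a b
    rw [H.idForm_apply, H.idForm_apply, H.idForm_apply, levi_cyclic m e a b,
      ← levi_cyclic m b e a, wedgeForm, Matrix.of_apply, hsym b a, hsym a e,
      hsym b e]
    ring
  simp only [k3, Finset.sum_sub_distrib, ← Finset.mul_sum, k1, k2]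
  ring

end Contractions
end KillingGeometry
end

noncomputable section
namespace KillingGeometry

section PartialDerivatives

variable {K : Type*} [RCLike K]

/-- The function `f` is differentiable at `x` with partial derivative `∂_i f = f'`. -/
structure HasPD (i : Fin 4) (f : E4 → K) (f' : K) (x : E4) : Prop where
  differentiableAt : DifferentiableAt ℝ f x
  fderiv_eq : fderiv ℝ f x (EuclideanSpace.single i 1) = f'

namespace HasPD

variable {i : Fin 4} {f f₁ f₂ : E4 → K} {f' f₁' f₂' : K} {x : E4}

theorem of_differentiableAt (h : DifferentiableAt ℝ f x) (i : Fin 4) :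
    HasPD i f (fderiv ℝ f x (EuclideanSpace.single i 1)) x := ⟨h, rfl⟩

theorem unique (h₁ : HasPD i f f₁' x) (h₂ : HasPD i f f₂' x) : f₁' = f₂' :=
  h₁.fderiv_eq.symm.trans h₂.fderiv_eq

theorem congr_val (h : HasPD i f f₁' x) (e : f₁' = f₂') : HasPD i f f₂' x := e ▸ h

theorem congr_of_eventuallyEq (h : HasPD i f₁ f' x) (e : f₂ =ᶠ[nhds x] f₁) : HasPD i f₂ f' x :=
  ⟨h.differentiableAt.congr_of_eventuallyEq e, by rw [e.fderiv_eq, h.fderiv_eq]⟩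

theorem const (c : K) : HasPD i (fun _ => c) 0 x :=
  ⟨differentiableAt_const c, by simp⟩

theorem add (h₁ : HasPD i f₁ f₁' x) (h₂ : HasPD i f₂ f₂' x) :
    HasPD i (fun y => f₁ y + f₂ y) (f₁' + f₂') x :=
  ⟨h₁.1.fun_add h₂.1, by rw [fderiv_fun_add h₁.1 h₂.1]; simp [h₁.2, h₂.2]⟩

theorem neg (h : HasPD i f f' x) : HasPD i (fun y => -f y) (-f') x :=
  ⟨h.1.fun_neg, by rw [fderiv_fun_neg]; simp [h.2]⟩

theorem sub (h₁ : HasPD i f₁ f₁' x) (h₂ : HasPD i f₂ f₂' x) :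
    HasPD i (fun y => f₁ y - f₂ y) (f₁' - f₂') x :=
  ⟨h₁.1.fun_sub h₂.1, by rw [fderiv_fun_sub h₁.1 h₂.1]; simp [h₁.2, h₂.2]⟩

theorem mul (h₁ : HasPD i f₁ f₁' x) (h₂ : HasPD i f₂ f₂' x) :
    HasPD i (fun y => f₁ y * f₂ y) (f₁' * f₂ x + f₁ x * f₂') x :=
  ⟨h₁.1.fun_mul h₂.1, by
    rw [fderiv_fun_mul h₁.1 h₂.1]; simp [h₁.2, h₂.2]; ring⟩

theorem const_mul (c : K) (h : HasPD i f f' x) : HasPD i (fun y => c * f y) (c * f') x :=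
  ((const c).mul h).congr_val (by ring)

theorem sum {ι : Type*} {t : Finset ι} {f : ι → E4 → K} {f' : ι → K}
    (h : ∀ j ∈ t, HasPD i (f j) (f' j) x) :
    HasPD i (fun y => ∑ j ∈ t, f j y) (∑ j ∈ t, f' j) x :=
  ⟨DifferentiableAt.fun_sum fun j hj => (h j hj).1, by
    rw [fderiv_fun_sum fun j hj => (h j hj).1]
    simp only [sum_apply]
    exact Finset.sum_congr rfl fun j hj => (h j hj).2⟩

theorem ofReal {f : E4 → ℝ} {f' : ℝ} (h : HasPD i f f' x) :
    HasPD i (fun y => (f y : ℂ)) (f' : ℂ) x := by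
  have := (Complex.ofRealCLM.hasFDerivAt (x := f x)).comp x h.1.hasFDerivAt
  refine ⟨this.differentiableAt, ?_⟩
  have e := this.fderiv
  change fderiv ℝ (fun y => (f y : ℂ)) x = _ at e
  rw [e, ContinuousLinearMap.comp_apply, h.2]
  rfl

end HasPD

theorem hasPD_pd {f : E4 → ℝ} {x : E4} (h : DifferentiableAt ℝ f x) (i : Fin 4) :
    HasPD i f (pd i f x) x := ⟨h, rfl⟩

theorem contDiffOn_pd {f : E4 → ℝ} {U : Set E4} (hU : IsOpen U) {m n : ℕ∞ω}
    (hf : ContDiffOn ℝ n f U) (hmn : m + 1 ≤ n) (i : Fin 4) : ContDiffOn ℝ m (pd i f) U :=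
  (hf.fderiv_of_isOpen hU hmn).clm_apply contDiffOn_const

theorem pd_comm {f : E4 → ℝ} {x : E4} (hf : ContDiffAt ℝ 2 f x) (i j : Fin 4) :
    pd i (pd j f) x = pd j (pd i f) x := by
  have hs := hf.isSymmSndFDerivAt (by simp)
  have hd : DifferentiableAt ℝ (fderiv ℝ f) x :=
    (hf.fderiv_right (m := 1) (by norm_num)).differentiableAt (by norm_num)
  have e : ∀ v w : E4, fderiv ℝ (fun y => fderiv ℝ f y v) x w = fderiv ℝ (fderiv ℝ f) x w v := by
    intro v w
    rw [fderiv_clm_apply hd (differentiableAt_const v)]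
    simp
  exact (e _ _).trans ((hs _ _).trans (e _ _).symm)

/-- The entries of `A` are differentiable at `x` with partial derivatives `∂_i A = A'`. -/
def HasMatPD (i : Fin 4) (A : E4 → Mat K) (A' : Mat K) (x : E4) : Prop :=
  ∀ a b, HasPD i (fun y => A y a b) (A' a b) x

namespace HasMatPD

variable {i : Fin 4} {A B : E4 → Mat K} {A' B' : Mat K} {x : E4}

theorem congr_val (h : HasMatPD i A A' x) (e : A' = B') : HasMatPD i A B' x := e ▸ h

theorem unique (h₁ : HasMatPD i A A' x) (h₂ : HasMatPD i A B' x) : A' = B' := by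
  ext a b
  exact (h₁ a b).unique (h₂ a b)

theorem congr_of_eventuallyEq (h : HasMatPD i A A' x) (e : B =ᶠ[nhds x] A) : HasMatPD i B A' x :=
  fun a b => (h a b).congr_of_eventuallyEq (e.mono fun y hy => by simp only [hy])

theorem const (C : Mat K) : HasMatPD i (fun _ => C) 0 x := fun _ _ => HasPD.const _

theorem add (hA : HasMatPD i A A' x) (hB : HasMatPD i B B' x) :
    HasMatPD i (fun y => A y + B y) (A' + B') x := fun a b => (hA a b).add (hB a b)

theorem sub (hA : HasMatPD i A A' x) (hB : HasMatPD i B B' x) :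
    HasMatPD i (fun y => A y - B y) (A' - B') x := fun a b => (hA a b).sub (hB a b)

theorem mul (hA : HasMatPD i A A' x) (hB : HasMatPD i B B' x) :
    HasMatPD i (fun y => A y * B y) (A' * B x + A x * B') x := by
  intro a b
  simp only [Matrix.mul_apply, Matrix.add_apply, ← Finset.sum_add_distrib]
  exact HasPD.sum fun k _ => (hA a k).mul (hB k b)

theorem smul {f : E4 → K} {f' : K} (hf : HasPD i f f' x) (hA : HasMatPD i A A' x) :
    HasMatPD i (fun y => f y • A y) (f' • A x + f x • A') x := fun a b => hf.mul (hA a b)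

theorem const_smul (c : K) (hA : HasMatPD i A A' x) : HasMatPD i (fun y => c • A y) (c • A') x :=
  fun a b => (hA a b).const_mul c

theorem transpose (hA : HasMatPD i A A' x) :
    HasMatPD i (fun y => (A y).transpose) A'.transpose x := fun a b => hA b a

theorem trace (hA : HasMatPD i A A' x) : HasPD i (fun y => (A y).trace) A'.trace x :=
  HasPD.sum fun a _ => hA a a

theorem starMat (hA : HasMatPD i A A' x) :
    HasMatPD i (fun y => starMat (A y)) (starMat A') x := by
  intro a b
  fin_cases a <;> fin_cases b <;> simp [KillingGeometry.starMat, skewMat] <;>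
    first
    | exact HasPD.const 0
    | exact hA _ _
    | exact (hA _ _).neg

theorem ofReal {A : E4 → Mat ℝ} {A' : Mat ℝ} (h : HasMatPD i A A' x) :
    HasMatPD i (fun y => (A y).map Complex.ofReal) (A'.map Complex.ofReal) x :=
  fun a b => (h a b).ofReal

end HasMatPD

theorem contDiffOn_det {A : E4 → Mat ℝ} {U : Set E4} {n : ℕ∞ω}
    (hA : ∀ a b, ContDiffOn ℝ n (fun y => A y a b) U) :
    ContDiffOn ℝ n (fun y => (A y).det) U := by
  simp only [Matrix.det_apply]
  refine ContDiffOn.sum fun σ _ => ?_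
  exact ContDiffOn.const_smul _ (contDiffOn_prod fun k _ => hA _ _)

theorem contDiffOn_inv {A : E4 → Mat ℝ} {U : Set E4} {n : ℕ∞ω}
    (hA : ∀ a b, ContDiffOn ℝ n (fun y => A y a b) U) (hd : ∀ y ∈ U, IsUnit (A y).det)
    (a b : Fin 4) : ContDiffOn ℝ n (fun y => (A y)⁻¹ a b) U := by
  have : ∀ y, (A y)⁻¹ a b = ((A y).det)⁻¹ * ((A y).updateRow b (Pi.single a 1)).det := by
    intro y
    rw [Matrix.inv_def, Matrix.smul_apply, Matrix.adjugate_apply, Ring.inverse_eq_inv', smul_eq_mul]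
  simp only [this]
  refine ((contDiffOn_det hA).inv fun y hy => (hd y hy).ne_zero).mul (contDiffOn_det fun k l => ?_)
  by_cases hk : k = b
  · subst hk
    simp only [Matrix.updateRow_self]
    exact contDiffOn_const
  · simp only [Matrix.updateRow_ne hk]
    exact hA k l

theorem HasMatPD.inv {i : Fin 4} {A : E4 → Mat ℝ} {A' : Mat ℝ} {x : E4} (hA : HasMatPD i A A' x)
    (hd : ∀ᶠ y in nhds x, IsUnit (A y).det)
    (hi : ∀ a b, DifferentiableAt ℝ (fun y => (A y)⁻¹ a b) x) :
    HasMatPD i (fun y => (A y)⁻¹) (-((A x)⁻¹ * A' * (A x)⁻¹)) x := by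
  have h1 : HasMatPD i (fun y => (A y)⁻¹) (Matrix.of fun a b => pd i (fun y => (A y)⁻¹ a b) x) x :=
    fun a b => hasPD_pd (hi a b) i
  have h2 := (h1.mul hA).congr_of_eventuallyEq (B := fun _ => 1)
    (hd.mono fun y hy => (Matrix.nonsing_inv_mul _ hy).symm)
  have h3 := h2.unique (HasMatPD.const 1)
  refine h1.congr_val ?_
  have h4 := congrArg (fun C => C * (A x)⁻¹) h3
  simp only [Matrix.add_mul, Matrix.zero_mul, Matrix.mul_assoc,
    Matrix.mul_nonsing_inv _ hd.self_of_nhds, Matrix.mul_one] at h4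
  rw [eq_neg_iff_add_eq_zero, Matrix.mul_assoc]
  exact h4

end PartialDerivatives
end KillingGeometry
end

noncomputable section
namespace KillingGeometry

section LeviCivitaConnection

set_option maxHeartbeats 4000000 in
theorem HasMatPD.det_of_connection {i : Fin 4} {A : E4 → Mat ℝ} {Γ : Mat ℝ} {x : E4}
    (hA : HasMatPD i A (Γ.transpose * A x + A x * Γ) x) :
    HasPD i (fun y => (A y).det) (2 * Γ.trace * (A x).det) x := by
  simp only [det_fin_four]
  refine HasPD.congr_val (by
    repeat' first
      | exact hA _ _
      | apply HasPD.sub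
      | apply HasPD.add
      | apply HasPD.mul) ?_
  simp only [Matrix.add_apply, Matrix.mul_apply, Matrix.transpose_apply, Fin.sum_univ_four,
    Matrix.trace, Matrix.diag_apply]
  ring

theorem HasPD.of_sq_eq {i : Fin 4} {h k : E4 → ℝ} {k' : ℝ} {x : E4} (hk : HasPD i k k' x)
    (hc : ContinuousAt h x) (hx : h x ≠ 0) (he : ∀ᶠ y in nhds x, h y ^ 2 = k y) :
    HasPD i h (k' / (2 * h x)) x := by
  have hkx := he.self_of_nhds
  have hkp : 0 < k x := by rw [← hkx]; positivity
  have main : ∀ h : E4 → ℝ, ContinuousAt h x → 0 < h x → (∀ᶠ y in nhds x, h y ^ 2 = k y) →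
      HasPD i h (k' / (2 * h x)) x := by
    intro h hc hx he
    have hkx := he.self_of_nhds
    have e1 : h =ᶠ[nhds x] fun y => Real.sqrt (k y) := by
      filter_upwards [he, hc.eventually (lt_mem_nhds hx)] with y hy hy'
      rw [← hy, Real.sqrt_sq hy'.le]
    refine HasPD.congr_of_eventuallyEq ⟨hk.1.sqrt hkp.ne', ?_⟩ e1
    rw [fderiv_sqrt hk.1 hkp.ne', ← hkx, Real.sqrt_sq hx.le]
    simp [hk.2]
    ring
  rcases lt_or_gt_of_ne hx with h0 | h0
  · have h2 := main (fun y => -h y) hc.neg (by simpa using h0) (by simpa using he)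
    have h3 := h2.neg
    simp only [neg_neg] at h3
    exact h3.congr_val (by field_simp)
  · exact main h hc h0 he

/-- A `C³` Lorentzian metric on an open set of coordinates with a continuous volume form. -/
structure LorentzChart (U : Set E4) (G : E4 → Mat ℝ) (h : E4 → ℝ) : Prop where
  isOpen : IsOpen U
  contDiff_metric : ∀ i j, ContDiffOn ℝ 3 (fun x => G x i j) U
  continuous_vol : ContinuousOn h U
  coframe : ∀ x ∈ U, ∃ P s, IsCoframe P s (G x) (h x)

/-- The matrix `Γ^a_{bi}` of the Levi-Civita connection. -/
def gam (G : E4 → Mat ℝ) (i : Fin 4) (x : E4) : Mat ℝ := Matrix.of fun a b => christoffel G a b i x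

/-- The matrix of partial derivatives `∂_i Γ^a_{bj}`. -/
def dgam (G : E4 → Mat ℝ) (i j : Fin 4) (x : E4) : Mat ℝ :=
  Matrix.of fun a b => pd i (christoffel G a b j) x

/-- The curvature two-form `R^a_{bcd}` as a matrix. -/
def rhat (G : E4 → Mat ℝ) (c d : Fin 4) (x : E4) : Mat ℝ :=
  Matrix.of fun a b => riemannUp G x a b c d

/-- The curvature two-form `R_{abcd}` as a matrix. -/
def rlow (G : E4 → Mat ℝ) (c d : Fin 4) (x : E4) : Mat ℝ := G x * rhat G c d x

theorem rlow_apply (G : E4 → Mat ℝ) (a b c d : Fin 4) (x : E4) :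
    rlow G c d x a b = riemann G x a b c d := by
  rw [rlow, Matrix.mul_apply]
  rfl

namespace LorentzChart

variable {U : Set E4} {G : E4 → Mat ℝ} {h : E4 → ℝ} {x : E4}

theorem mem_nhds (L : LorentzChart U G h) (hx : x ∈ U) : U ∈ nhds x := L.isOpen.mem_nhds hx

theorem isUnit_det (L : LorentzChart U G h) (hx : x ∈ U) : IsUnit (G x).det := by
  obtain ⟨P, s, H⟩ := L.coframe x hx
  exact H.isUnit_metric

theorem metric_transpose (L : LorentzChart U G h) (hx : x ∈ U) : (G x).transpose = G x := by
  obtain ⟨P, s, H⟩ := L.coframe x hx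
  exact H.transpose_eq

theorem metric_symm (L : LorentzChart U G h) (hx : x ∈ U) (a b : Fin 4) : G x a b = G x b a :=
  congrFun (congrFun (L.metric_transpose hx) b) a

theorem inv_symm (L : LorentzChart U G h) (hx : x ∈ U) (a b : Fin 4) :
    (G x)⁻¹ a b = (G x)⁻¹ b a := by
  have : ((G x)⁻¹).transpose = (G x)⁻¹ := by
    rw [Matrix.transpose_nonsing_inv, L.metric_transpose hx]
  exact congrFun (congrFun this b) a

theorem pd_symm (L : LorentzChart U G h) (hx : x ∈ U) (i a b : Fin 4) :
    pd i (fun y => G y a b) x = pd i (fun y => G y b a) x := by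
  have : (fun y => G y a b) =ᶠ[nhds x] fun y => G y b a := by
    filter_upwards [L.mem_nhds hx] with y hy
    exact L.metric_symm hy a b
  rw [pd, pd, this.fderiv_eq]

theorem christoffel_symm (L : LorentzChart U G h) (hx : x ∈ U) (a b c : Fin 4) :
    christoffel G a b c x = christoffel G a c b x := by
  simp only [christoffel]
  congr 1
  refine Finset.sum_congr rfl fun d _ => ?_
  rw [L.pd_symm hx d b c]
  ring

theorem contDiffAt_metric (L : LorentzChart U G h) (hx : x ∈ U) (a b : Fin 4) :
    ContDiffAt ℝ 3 (fun y => G y a b) x := (L.contDiff_metric a b).contDiffAt (L.mem_nhds hx)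

theorem contDiff_inv (L : LorentzChart U G h) (a b : Fin 4) :
    ContDiffOn ℝ 3 (fun y => (G y)⁻¹ a b) U :=
  contDiffOn_inv L.contDiff_metric (fun _ hy => L.isUnit_det hy) a b

theorem contDiff_christoffel (L : LorentzChart U G h) (a b c : Fin 4) :
    ContDiffOn ℝ 2 (christoffel G a b c) U := by
  have hpd : ∀ i a b, ContDiffOn ℝ 2 (pd i fun y => G y a b) U := fun i a b =>
    contDiffOn_pd L.isOpen (L.contDiff_metric a b) (by norm_num) i
  have hinv : ∀ a b, ContDiffOn ℝ 2 (fun y => ginv G y a b) U := fun a b =>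
    (L.contDiff_inv a b).of_le (by norm_num)
  exact contDiffOn_const.mul (ContDiffOn.sum fun d _ =>
    (hinv a d).mul (((hpd b d c).add (hpd c d b)).sub (hpd d b c)))

theorem lower_christoffel (L : LorentzChart U G h) (hx : x ∈ U) (a b c : Fin 4) :
    ∑ k, G x a k * christoffel G k b c x = 1 / 2 *
      (pd b (fun y => G y a c) x + pd c (fun y => G y a b) x - pd a (fun y => G y b c) x) := by
  set v : Fin 4 → ℝ := fun d =>
    pd b (fun y => G y d c) x + pd c (fun y => G y d b) x - pd d (fun y => G y b c) x
  have : ∑ k, G x a k * christoffel G k b c x = 1 / 2 * (G x).mulVec ((G x)⁻¹.mulVec v) a := by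
    simp only [christoffel, Matrix.mulVec, dotProduct, Finset.mul_sum, ginv]
    exact Finset.sum_congr rfl fun _ _ => Finset.sum_congr rfl fun _ _ => by
      simp only [v]; ring
  rw [this, Matrix.mulVec_mulVec, Matrix.mul_nonsing_inv _ (L.isUnit_det hx), Matrix.one_mulVec]

/-- The Levi-Civita connection is metric. -/
theorem hasMatPD_metric (L : LorentzChart U G h) (hx : x ∈ U) (i : Fin 4) :
    HasMatPD i G ((gam G i x).transpose * G x + G x * gam G i x) x := by
  intro a b
  refine (hasPD_pd ((L.contDiffAt_metric hx a b).differentiableAt (by norm_num)) i).congr_val ?_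
  have e1 := L.lower_christoffel hx a b i
  have e2 := L.lower_christoffel hx b a i
  simp only [Matrix.add_apply, Matrix.mul_apply, Matrix.transpose_apply, gam, Matrix.of_apply]
  rw [e1]
  have e3 : ∑ k, christoffel G k a i x * G x k b = ∑ k, G x b k * christoffel G k a i x :=
    Finset.sum_congr rfl fun k _ => by rw [L.metric_symm hx b k, mul_comm]
  rw [e3, e2, L.pd_symm hx i b a]
  ring

theorem hasMatPD_inv (L : LorentzChart U G h) (hx : x ∈ U) (i : Fin 4) :
    HasMatPD i (fun y => (G y)⁻¹)
      (-((G x)⁻¹ * (gam G i x).transpose + gam G i x * (G x)⁻¹)) x := by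
  refine ((L.hasMatPD_metric hx i).inv ?_ fun a b => ?_).congr_val ?_
  · filter_upwards [L.mem_nhds hx] with y hy using L.isUnit_det hy
  · exact ((L.contDiff_inv a b).contDiffAt (L.mem_nhds hx)).differentiableAt (by norm_num)
  · have hu := L.isUnit_det hx
    rw [Matrix.mul_add, Matrix.add_mul]
    simp only [Matrix.mul_assoc]
    rw [Matrix.mul_nonsing_inv _ hu, Matrix.mul_one, Matrix.nonsing_inv_mul_cancel_left _ _ hu]

theorem vol_sq (L : LorentzChart U G h) (hx : x ∈ U) : h x ^ 2 = -(G x).det := by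
  obtain ⟨P, s, H⟩ := L.coframe x hx
  have : (minkMat ℝ).det = -1 := by simp [minkMat, Matrix.det_diagonal, Fin.prod_univ_four]
  rw [H.metric_eq, H.vol_eq, Matrix.det_mul, Matrix.det_mul, Matrix.det_transpose, this]
  linear_combination P.det ^ 2 * H.sq_eq

theorem vol_ne_zero (L : LorentzChart U G h) (hx : x ∈ U) : h x ≠ 0 := by
  intro h0
  have := L.vol_sq hx
  rw [h0] at this
  exact (L.isUnit_det hx).ne_zero (by linarith)

/-- The volume form is parallel. -/
theorem hasPD_vol (L : LorentzChart U G h) (hx : x ∈ U) (i : Fin 4) :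
    HasPD i h ((gam G i x).trace * h x) x := by
  have h1 := ((L.hasMatPD_metric hx i).det_of_connection).neg
  have h2 := HasPD.of_sq_eq h1 (L.continuous_vol.continuousAt (L.mem_nhds hx)) (L.vol_ne_zero hx)
    (by filter_upwards [L.mem_nhds hx] with y hy using L.vol_sq hy)
  refine h2.congr_val ?_
  have h3 := L.vol_sq hx
  have h4 := L.vol_ne_zero hx
  field_simp
  linear_combination -(gam G i x).trace * h3

/-- The covariant derivative commutes with the Hodge dual. -/
theorem hasMatPD_hodge (L : LorentzChart U G h) (hx : x ∈ U) {i : Fin 4} {A : E4 → Mat ℝ}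
    {D : Mat ℝ} (hs : (A x).transpose = -A x)
    (hA : HasMatPD i A (D + (gam G i x).transpose * A x + A x * gam G i x) x) :
    HasMatPD i (fun y => hodge (h y) (G y)⁻¹ (A y))
      (hodge (h x) (G x)⁻¹ D + (gam G i x).transpose * hodge (h x) (G x)⁻¹ (A x)
        + hodge (h x) (G x)⁻¹ (A x) * gam G i x) x := by
  have hi := L.hasMatPD_inv hx i
  have hB := ((hi.mul hA).mul hi).starMat
  refine (HasMatPD.smul (L.hasPD_vol hx i) hB).congr_val ?_
  set gi := (G x)⁻¹
  set Γ := gam G i x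
  set B := gi * A x * gi with hBdef
  have hBs : B.transpose = -B := by
    have : gi.transpose = gi := by
      simp only [gi]
      rw [Matrix.transpose_nonsing_inv, L.metric_transpose hx]
    simp only [hBdef, Matrix.transpose_mul, this, hs, Matrix.mul_assoc, Matrix.neg_mul,
      Matrix.mul_neg]
  have e1 : (-(gi * Γ.transpose + Γ * gi) * A x + gi * (D + Γ.transpose * A x + A x * Γ)) * gi
      + gi * A x * -(gi * Γ.transpose + Γ * gi) =
      gi * D * gi + (-1 : ℝ) • (Γ * B + B * Γ.transpose) := by
    rw [hBdef, neg_one_smul]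
    noncomm_ring
  have e2 := starMat_infinitesimal Γ B hBs
  simp only [hodge]
  rw [e1, starMat_add, starMat_smul, ← hBdef, mul_smul]
  have e3 : Γ.trace • h x • starMat B = h x • (Γ.transpose * starMat B + starMat B * Γ
      + starMat (Γ * B + B * Γ.transpose)) := by rw [e2, smul_comm]
  rw [e3]
  simp only [smul_add, Matrix.mul_smul, Matrix.smul_mul, neg_smul, one_smul, smul_neg]
  abel

theorem hasMatPD_gam (L : LorentzChart U G h) (hx : x ∈ U) (i j : Fin 4) :
    HasMatPD i (gam G j) (dgam G i j x) x := fun a b =>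
  hasPD_pd (((L.contDiff_christoffel a b j).contDiffAt (L.mem_nhds hx)).differentiableAt
    (by norm_num)) i

theorem rhat_eq (L : LorentzChart U G h) (hx : x ∈ U) (c d : Fin 4) :
    rhat G c d x = dgam G c d x - dgam G d c x + gam G c x * gam G d x
      - gam G d x * gam G c x := by
  ext a b
  simp only [rhat, riemannUp, dgam, gam, Matrix.of_apply, Matrix.add_apply, Matrix.sub_apply,
    Matrix.mul_apply, L.christoffel_symm hx a c, L.christoffel_symm hx a d,
    Finset.sum_sub_distrib]
  ring

theorem riemann_skew_right (G : E4 → Mat ℝ) (a b c d : Fin 4) (x : E4) :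
    riemann G x a b d c = -riemann G x a b c d := by
  simp only [riemann, riemannUp, ← Finset.sum_neg_distrib]
  refine Finset.sum_congr rfl fun k _ => ?_
  simp only [Finset.sum_sub_distrib]
  ring

theorem riemannUp_cyclic (L : LorentzChart U G h) (hx : x ∈ U) (a b c d : Fin 4) :
    riemannUp G x a b c d + riemannUp G x a c d b + riemannUp G x a d b c = 0 := by
  have hp : ∀ i b c, pd i (christoffel G a b c) x = pd i (christoffel G a c b) x := by
    intro i b c
    have : christoffel G a b c =ᶠ[nhds x] christoffel G a c b := by
      filter_upwards [L.mem_nhds hx] with y hy using L.christoffel_symm hy a b c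
    rw [pd, pd, this.fderiv_eq]
  simp only [riemannUp, Finset.sum_sub_distrib]
  rw [hp c d b, hp d c b, hp b d c]
  simp only [L.christoffel_symm hx _ d b, L.christoffel_symm hx _ c b, L.christoffel_symm hx _ d c]
  ring

theorem riemann_cyclic (L : LorentzChart U G h) (hx : x ∈ U) (a b c d : Fin 4) :
    riemann G x a b c d + riemann G x a c d b + riemann G x a d b c = 0 := by
  simp only [riemann, ← Finset.sum_add_distrib, ← mul_add, L.riemannUp_cyclic hx, mul_zero,
    Finset.sum_const_zero]

theorem riemann_skew_left (L : LorentzChart U G h) (hx : x ∈ U) (a b c d : Fin 4) :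
    riemann G x b a c d = -riemann G x a b c d := by
  have key : ∀ i j, HasMatPD i (fun y => (gam G j y).transpose * G y + G y * gam G j y)
      ((dgam G i j x).transpose * G x
        + (gam G j x).transpose * ((gam G i x).transpose * G x + G x * gam G i x)
        + (((gam G i x).transpose * G x + G x * gam G i x) * gam G j x
          + G x * dgam G i j x)) x := fun i j =>
    ((L.hasMatPD_gam hx i j).transpose.mul (L.hasMatPD_metric hx i)).add
      ((L.hasMatPD_metric hx i).mul (L.hasMatPD_gam hx i j))
  have e : ∀ i j a b, pd i (pd j fun y => G y a b) x =
      ((dgam G i j x).transpose * G x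
        + (gam G j x).transpose * ((gam G i x).transpose * G x + G x * gam G i x)
        + (((gam G i x).transpose * G x + G x * gam G i x) * gam G j x
          + G x * dgam G i j x)) a b := by
    intro i j a b
    have h1 : (pd j fun y => G y a b) =ᶠ[nhds x]
        fun y => ((gam G j y).transpose * G y + G y * gam G j y) a b := by
      filter_upwards [L.mem_nhds hx] with y hy using (L.hasMatPD_metric hy j a b).fderiv_eq
    exact ((key i j a b).congr_of_eventuallyEq h1).fderiv_eq
  have e2 : rlow G c d x + (rlow G c d x).transpose = 0 := by
    have e3 : ∀ A B : Mat ℝ, A = B → A - B = 0 := fun A B => sub_eq_zero.mpr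
    have e4 := e3 _ _ (Matrix.ext fun a b => (e c d a b).symm.trans ((pd_comm
      ((L.contDiffAt_metric hx a b).of_le (by norm_num)) c d).trans (e d c a b)))
    rw [rlow, Matrix.transpose_mul, L.metric_transpose hx, L.rhat_eq hx]
    rw [← e4]
    simp only [Matrix.transpose_sub, Matrix.transpose_add, Matrix.transpose_mul]
    noncomm_ring
  have e5 := congrFun (congrFun e2 b) a
  simp only [Matrix.add_apply, Matrix.transpose_apply, rlow_apply, Matrix.zero_apply] at e5
  linarith

theorem riemann_pair (L : LorentzChart U G h) (hx : x ∈ U) (a b c d : Fin 4) :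
    riemann G x a b c d = riemann G x c d a b := by
  have s1 := L.riemann_skew_left hx
  have s2 := fun a b c d => riemann_skew_right G a b c d x
  have cy := L.riemann_cyclic hx
  linarith [cy a b c d, cy b c d a, cy c d a b, cy d a b c, s1 a b c d, s1 a c d b, s1 a d b c,
    s1 b c d a, s1 b d a c, s1 c d a b, s2 a b c d, s2 a c d b, s2 a d b c, s2 b c d a, s2 b d a c,
    s2 c d a b, s2 b a c d, s2 c a d b, s2 d a b c, s2 c b d a, s2 d b a c, s2 d c a b]

/-- The second Bianchi identity. -/
theorem bianchi (L : LorentzChart U G h) (hx : x ∈ U) :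
    ∃ D : Fin 4 → Fin 4 → Fin 4 → Mat ℝ, (∀ e c d, HasMatPD e (rlow G c d)
        (D e c d + (gam G e x).transpose * rlow G c d x + rlow G c d x * gam G e x) x) ∧
      ∀ e c d, D e c d + D c d e + D d e c = 0 := by
  let dd : Fin 4 → Fin 4 → Fin 4 → Mat ℝ := fun e c d =>
    Matrix.of fun a b => pd e (pd c (christoffel G a b d)) x
  have hdd : ∀ e c d, HasMatPD e (dgam G c d) (dd e c d) x := fun e c d a b =>
    hasPD_pd (((contDiffOn_pd (m := 1) L.isOpen (L.contDiff_christoffel a b d) (by norm_num)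
      c).contDiffAt (L.mem_nhds hx)).differentiableAt (by norm_num)) e
  have hsym : ∀ e c d, dd e c d = dd c e d := fun e c d => Matrix.ext fun a b =>
    pd_comm ((L.contDiff_christoffel a b d).contDiffAt (L.mem_nhds hx)) e c
  have hr : ∀ e c d, HasMatPD e (rhat G c d) (dd e c d - dd e d c
      + (dgam G e c x * gam G d x + gam G c x * dgam G e d x)
      - (dgam G e d x * gam G c x + gam G d x * dgam G e c x)) x := by
    intro e c d
    refine HasMatPD.congr_of_eventuallyEq ((((hdd e c d).sub (hdd e d c)).add
      ((L.hasMatPD_gam hx e c).mul (L.hasMatPD_gam hx e d))).sub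
      ((L.hasMatPD_gam hx e d).mul (L.hasMatPD_gam hx e c))) ?_
    filter_upwards [L.mem_nhds hx] with y hy using L.rhat_eq hy c d
  refine ⟨fun e c d => G x * ((dd e c d - dd e d c
      + (dgam G e c x * gam G d x + gam G c x * dgam G e d x)
      - (dgam G e d x * gam G c x + gam G d x * dgam G e c x))
      + gam G e x * rhat G c d x - rhat G c d x * gam G e x), fun e c d => ?_, fun e c d => ?_⟩
  · refine ((L.hasMatPD_metric hx e).mul (hr e c d)).congr_val ?_
    simp only [rlow]
    noncomm_ring
  · beta_reduce
    rw [L.rhat_eq hx c d, L.rhat_eq hx d e, L.rhat_eq hx e c, hsym e c d, hsym d e c, hsym d c e]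
    noncomm_ring

end LorentzChart

end LeviCivitaConnection
end KillingGeometry
end

noncomputable section
namespace KillingGeometry

section Complexification

/-- The complexification of a real matrix. -/
def toC (A : Mat ℝ) : Mat ℂ := A.map Complex.ofReal

@[simp] theorem toC_apply (A : Mat ℝ) (i j : Fin 4) : toC A i j = (A i j : ℂ) := rfl

theorem toC_mul (A B : Mat ℝ) : toC (A * B) = toC A * toC B := by
  ext i j; simp [Matrix.mul_apply]

theorem toC_add (A B : Mat ℝ) : toC (A + B) = toC A + toC B := by
  ext i j; simp

theorem toC_neg (A : Mat ℝ) : toC (-A) = -toC A := by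
  ext i j; simp

theorem toC_smul (r : ℝ) (A : Mat ℝ) : toC (r • A) = (r : ℂ) • toC A := by
  ext i j; simp

theorem toC_transpose (A : Mat ℝ) : toC A.transpose = (toC A).transpose := rfl

theorem toC_det (A : Mat ℝ) : (toC A).det = (A.det : ℂ) := by
  rw [det_fin_four, det_fin_four]; simp

theorem toC_one : toC 1 = 1 := by
  ext i j
  rw [toC_apply, Matrix.one_apply, Matrix.one_apply]
  split_ifs <;> simp

theorem toC_inv {A : Mat ℝ} (hA : IsUnit A.det) : (toC A)⁻¹ = toC A⁻¹ := by
  apply Matrix.inv_eq_right_inv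
  rw [← toC_mul, Matrix.mul_nonsing_inv _ hA, toC_one]

theorem toC_starMat (A : Mat ℝ) : toC (starMat A) = starMat (toC A) := by
  ext i j
  fin_cases i <;> fin_cases j <;> simp [starMat, skewMat]

theorem toC_hodge (h : ℝ) (gi A : Mat ℝ) : toC (hodge h gi A) = hodge (h : ℂ) (toC gi) (toC A) := by
  rw [hodge, hodge, toC_smul, toC_starMat, toC_mul, toC_mul]

theorem IsCoframe.toC {P g : Mat ℝ} {s h : ℝ} (H : IsCoframe P s g h) :
    IsCoframe (toC P) (s : ℂ) (KillingGeometry.toC g) (h : ℂ) where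
  isUnit := by
    rw [toC_det, isUnit_iff_ne_zero]
    exact_mod_cast H.isUnit.ne_zero
  sq_eq := by exact_mod_cast H.sq_eq
  metric_eq := by
    have : KillingGeometry.toC (minkMat ℝ) = minkMat ℂ := by
      ext i j
      fin_cases i <;> fin_cases j <;> simp [minkMat]
    rw [H.metric_eq, toC_mul, toC_mul, this, toC_transpose]
  vol_eq := by rw [toC_det, H.vol_eq]; push_cast; rfl

end Complexification

section KillingField

open Complex

/-- Components in a coordinate system of a Killing vector field of a vacuum spacetime. -/
structure KillingChart (U : Set E4) (G : E4 → Mat ℝ) (H : E4 → Fin 4 → Fin 4 → Fin 4 → Fin 4 → ℝ)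
    (X : E4 → Fin 4 → ℝ) (h : E4 → ℝ) : Prop extends LorentzChart U G h where
  vol_eq : ∀ x ∈ U, ∀ a b c d, H x a b c d = h x * levi a b c d
  contDiff_vec : ∀ i, ContDiffOn ℝ 2 (fun x => X x i) U
  killing : ∀ x ∈ U, ∀ a b, nablaLower G X x a b + nablaLower G X x b a = 0
  vacuum : ∀ x ∈ U, ∀ a b, ricci G x a b = 0

/-- The real Killing two-form as a matrix. -/
def killMat (G : E4 → Mat ℝ) (X : E4 → Fin 4 → ℝ) (x : E4) : Mat ℝ := Matrix.of (nablaLower G X x)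

/-- The self-dual two-form `A + i ⋆A`. -/
def sdMat (G : E4 → Mat ℝ) (h : E4 → ℝ) (x : E4) (A : Mat ℝ) : Mat ℂ :=
  toC A + I • toC (hodge (h x) (G x)⁻¹ A)

namespace KillingChart

variable {U : Set E4} {G : E4 → Mat ℝ} {H : E4 → Fin 4 → Fin 4 → Fin 4 → Fin 4 → ℝ}
  {X : E4 → Fin 4 → ℝ} {h : E4 → ℝ} {x : E4}

theorem contDiff_lower (L : KillingChart U G H X h) (b : Fin 4) :
    ContDiffOn ℝ 2 (lower G X b) U :=
  ContDiffOn.sum fun c _ => ((L.contDiff_metric b c).of_le (by norm_num)).mul (L.contDiff_vec c)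

theorem killMat_transpose (L : KillingChart U G H X h) (hx : x ∈ U) :
    (killMat G X x).transpose = -killMat G X x := by
  ext a b
  simp only [killMat, Matrix.transpose_apply, Matrix.neg_apply, Matrix.of_apply]
  linarith [L.killing x hx a b]

theorem nablaLower_contDiff (L : KillingChart U G H X h) (a b : Fin 4) :
    ContDiffOn ℝ 1 (fun y => nablaLower G X y a b) U :=
  (contDiffOn_pd L.isOpen (L.contDiff_lower b) (by norm_num) a).sub
    (ContDiffOn.sum fun c _ => ((L.contDiff_christoffel c a b).of_le (by norm_num)).mul
      ((L.contDiff_lower c).of_le (by norm_num)))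

theorem hasPD_lower (L : KillingChart U G H X h) (hx : x ∈ U) (i b : Fin 4) :
    HasPD i (lower G X b)
      (nablaLower G X x i b + ∑ c, christoffel G c i b x * lower G X c x) x :=
  (hasPD_pd (((L.contDiff_lower b).contDiffAt (L.mem_nhds hx)).differentiableAt (by norm_num))
    i).congr_val (by rw [nablaLower]; ring)

theorem pd_nablaLower (L : KillingChart U G H X h) (hx : x ∈ U) (i a b : Fin 4) :
    pd i (fun y => nablaLower G X y a b) x = pd i (pd a (lower G X b)) x
      - ∑ c, (pd i (christoffel G c a b) x * lower G X c x + christoffel G c a b x *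
        (nablaLower G X x i c + ∑ d, christoffel G d i c x * lower G X d x)) := by
  have h1 : HasPD i (pd a (lower G X b)) (pd i (pd a (lower G X b)) x) x :=
    hasPD_pd (((contDiffOn_pd (m := 1) L.isOpen (L.contDiff_lower b) (by norm_num) a).contDiffAt
      (L.mem_nhds hx)).differentiableAt (by norm_num)) i
  have h2 : ∀ c, HasPD i (christoffel G c a b) (pd i (christoffel G c a b) x) x := fun c =>
    hasPD_pd (((L.contDiff_christoffel c a b).contDiffAt (L.mem_nhds hx)).differentiableAt
      (by norm_num)) i
  exact (h1.sub (HasPD.sum fun c _ => (h2 c).mul (L.hasPD_lower hx i c))).fderiv_eq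

/-- The second covariant derivative of a Killing field is given by the curvature. -/
theorem hasMatPD_killMat (L : KillingChart U G H X h) (hx : x ∈ U) (i : Fin 4) :
    HasMatPD i (killMat G X) (∑ d, X x d • rlow G d i x + (gam G i x).transpose * killMat G X x
      + killMat G X x * gam G i x) x := by
  let T : Fin 4 → Fin 4 → Fin 4 → ℝ := fun c a b => pd c (fun y => nablaLower G X y a b) x
    - ∑ k, christoffel G k c a x * nablaLower G X x k b
    - ∑ k, christoffel G k c b x * nablaLower G X x a k
  have hT : ∀ c a b, T c a b - T a c b = -∑ k, riemannUp G x k b c a * lower G X k x := by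
    intro c a b
    have e1 := L.pd_nablaLower hx c a b
    have e2 := L.pd_nablaLower hx a c b
    have e3 : pd c (pd a (lower G X b)) x = pd a (pd c (lower G X b)) x :=
      pd_comm ((L.contDiff_lower b).contDiffAt (L.mem_nhds hx)) c a
    have hp : ∀ i k b c, pd i (christoffel G k b c) x = pd i (christoffel G k c b) x := by
      intro i k b c
      have : christoffel G k b c =ᶠ[nhds x] christoffel G k c b := by
        filter_upwards [L.mem_nhds hx] with y hy using L.christoffel_symm hy k b c
      rw [pd, pd, this.fderiv_eq]
    have e4 : ∑ k, riemannUp G x k b c a * lower G X k x =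
        ∑ k, (pd c (christoffel G k a b) x * lower G X k x
          - pd a (christoffel G k c b) x * lower G X k x) +
        (∑ k, christoffel G k a b x * ∑ d, christoffel G d c k x * lower G X d x) -
        ∑ k, christoffel G k c b x * ∑ d, christoffel G d a k x * lower G X d x := by
      simp only [riemannUp, add_mul, sub_mul, Finset.sum_mul, Finset.mul_sum,
        Finset.sum_add_distrib, Finset.sum_sub_distrib, hp c _ b a, hp a _ b c,
        L.christoffel_symm hx _ b a, L.christoffel_symm hx _ b c]
      rw [add_sub_assoc]
      congr 1
      conv_rhs => rw [Finset.sum_comm]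
      congr 1
      · exact Finset.sum_congr rfl fun _ _ => Finset.sum_congr rfl fun _ _ => by ring
      · rw [Finset.sum_comm]
        exact Finset.sum_congr rfl fun _ _ => Finset.sum_congr rfl fun _ _ => by ring
    simp only [T]
    rw [e1, e2, e3, e4]
    simp only [mul_add, Finset.sum_add_distrib, Finset.sum_sub_distrib,
      L.christoffel_symm hx _ a c]
    ring
  have hTs : ∀ c a b, T c b a = - T c a b := by
    intro c a b
    have e1 : (fun y => nablaLower G X y b a) =ᶠ[nhds x] fun y => -nablaLower G X y a b := by
      filter_upwards [L.mem_nhds hx] with y hy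
      linarith [L.killing y hy a b]
    have e2 : pd c (fun y => nablaLower G X y b a) x = -pd c (fun y => nablaLower G X y a b) x := by
      rw [pd, pd, e1.fderiv_eq, fderiv_fun_neg]
      rfl
    have e3 : ∀ k l, nablaLower G X x k l = - nablaLower G X x l k := fun k l => by
      linarith [L.killing x hx k l]
    simp only [T, e2, e3 _ a, e3 b, mul_neg, Finset.sum_neg_distrib]
    ring
  have hT2 : ∀ c a b, T c a b = ∑ d, X x d * riemann G x d c a b := by
    intro c a b
    have h1 := hT c a b
    have h2 := hT a b c
    have h3 := hT b c a
    have c1 : ∑ k, riemannUp G x k b c a * lower G X k x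
        + ∑ k, riemannUp G x k c a b * lower G X k x
        + ∑ k, riemannUp G x k a b c * lower G X k x = 0 := by
      rw [← Finset.sum_add_distrib, ← Finset.sum_add_distrib]
      refine Finset.sum_eq_zero fun k _ => ?_
      linear_combination lower G X k x * L.riemannUp_cyclic hx k a b c
    have e : ∑ d, X x d * riemann G x d c a b = ∑ k, riemannUp G x k c a b * lower G X k x := by
      simp only [riemann, lower, Finset.mul_sum]
      rw [Finset.sum_comm]
      exact Finset.sum_congr rfl fun k _ => Finset.sum_congr rfl fun d _ => by
        rw [L.metric_symm hx d k]; ring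
    rw [e]
    have s1 := hTs c a b
    have s2 := hTs a b c
    have s3 := hTs b c a
    linarith
  intro a b
  refine (hasPD_pd (((L.nablaLower_contDiff a b).contDiffAt
    (L.mem_nhds hx)).differentiableAt (by norm_num)) i).congr_val ?_
  have e1 : ∑ d, X x d * riemann G x d i a b = ∑ d, X x d * rlow G d i x a b :=
    Finset.sum_congr rfl fun d _ => by rw [rlow_apply, L.riemann_pair hx]
  have e2 := hT2 i a b
  rw [e1] at e2
  simp only [Matrix.add_apply, Matrix.sum_apply, Matrix.smul_apply, smul_eq_mul, ← e2]
  simp only [T, Matrix.mul_apply, Matrix.transpose_apply, gam, killMat, Matrix.of_apply]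
  have e3 : ∑ j, nablaLower G X x a j * christoffel G j b i x =
      ∑ k, christoffel G k i b x * nablaLower G X x a k :=
    Finset.sum_congr rfl fun k _ => by rw [L.christoffel_symm hx k b i, mul_comm]
  rw [e3]
  simp only [L.christoffel_symm hx _ a i]
  ring

theorem rlow_transpose (L : KillingChart U G H X h) (hx : x ∈ U) (a b : Fin 4) :
    (rlow G a b x).transpose = -rlow G a b x := by
  ext c d
  simp only [Matrix.transpose_apply, Matrix.neg_apply, rlow_apply]
  exact L.riemann_skew_left hx _ _ _ _

theorem rlow_pair (L : KillingChart U G H X h) (hx : x ∈ U) (a b c d : Fin 4) :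
    rlow G a b x c d = rlow G c d x a b := by
  rw [rlow_apply, rlow_apply, L.riemann_pair hx]

theorem hodge_rlow_pair (L : KillingChart U G H X h) (hx : x ∈ U) (a b c d : Fin 4) :
    hodge (h x) (G x)⁻¹ (rlow G a b x) c d = hodge (h x) (G x)⁻¹ (rlow G c d x) a b := by
  obtain ⟨P, s, C⟩ := L.coframe x hx
  refine C.hodge_pair_symm (fun a b => rlow G a b x) (L.rlow_transpose hx) (fun a b => ?_)
    (L.rlow_pair hx) (fun b d => ?_) a b c d
  · ext c d
    rw [Matrix.neg_apply, rlow_apply, rlow_apply, LorentzChart.riemann_skew_right]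
  · have e : ∀ c, ∑ a, (G x)⁻¹ a c * rlow G a b x c d = riemannUp G x c b c d := by
      intro c
      have : ((G x)⁻¹ * rlow G c d x) c b = rhat G c d x c b := by
        rw [rlow, Matrix.nonsing_inv_mul_cancel_left _ _ (L.isUnit_det hx)]
      rw [rhat, Matrix.of_apply, Matrix.mul_apply] at this
      rw [← this]
      exact Finset.sum_congr rfl fun a _ => by rw [L.inv_symm hx a c, L.rlow_pair hx a b c d]
    rw [Finset.sum_comm]
    simp only [e]
    exact L.vacuum x hx b d

theorem hodge_eq_sum (L : KillingChart U G H X h) (hx : x ∈ U) {A : Mat ℝ}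
    (hA : A.transpose = -A) (c d : Fin 4) :
    ∑ r, ∑ s, ∑ m, ∑ n, H x c d r s * ginv G x r m * ginv G x s n * A m n =
      2 * hodge (h x) (G x)⁻¹ A c d := by
  have hgi : ((G x)⁻¹).transpose = (G x)⁻¹ := by
    rw [Matrix.transpose_nonsing_inv, L.metric_transpose hx]
  have hB : ((G x)⁻¹ * A * (G x)⁻¹).transpose = -((G x)⁻¹ * A * (G x)⁻¹) := by
    simp only [Matrix.transpose_mul, hgi, hA, Matrix.mul_assoc, Matrix.neg_mul, Matrix.mul_neg]
  rw [hodge, Matrix.smul_apply, smul_eq_mul, starMat_eq_sum hB]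
  have e : ∀ r s, ((G x)⁻¹ * A * (G x)⁻¹) r s = ∑ m, ∑ n, ginv G x r m * ginv G x s n * A m n := by
    intro r s
    rw [Matrix.mul_apply]
    simp only [Matrix.mul_apply, Finset.sum_mul]
    rw [Finset.sum_comm]
    exact Finset.sum_congr rfl fun m _ => Finset.sum_congr rfl fun n _ => by
      rw [ginv, ginv, L.inv_symm hx s n]; ring
  simp only [e, L.vol_eq x hx, Finset.mul_sum]
  exact Finset.sum_congr rfl fun _ _ => Finset.sum_congr rfl fun _ _ =>
    Finset.sum_congr rfl fun _ _ => Finset.sum_congr rfl fun _ _ => by ring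

theorem killingForm_eq (L : KillingChart U G H X h) (hx : x ∈ U) (a b : Fin 4) :
    killingForm G H X x a b = sdMat G h x (killMat G X x) a b := by
  have e := L.hodge_eq_sum hx (L.killMat_transpose hx) a b
  rw [killingForm]
  change _ + _ * (((1 / 2) * ∑ r, ∑ s, ∑ m, ∑ n,
    H x a b r s * ginv G x r m * ginv G x s n * killMat G X x m n : ℝ) : ℂ) = _
  rw [e]
  simp [sdMat, killMat]

theorem weylSD_eq (L : KillingChart U G H X h) (hx : x ∈ U) (a b c d : Fin 4) :
    weylSD G H x a b c d = sdMat G h x (rlow G a b x) c d := by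
  have hw : ∀ a b c d, weyl G x a b c d = rlow G a b x c d := by
    intro a b c d
    have hs : scalarCurv G x = 0 := by simp [scalarCurv, L.vacuum x hx]
    rw [weyl, hs, rlow_apply, L.riemann_pair hx]
    simp [L.vacuum x hx]
  have e := L.hodge_eq_sum hx (L.rlow_transpose hx a b) c d
  rw [weylSD]
  simp only [hw]
  rw [e]
  simp [sdMat]
  ring

theorem killingFormUp_eq (L : KillingChart U G H X h) (hx : x ∈ U) (a b : Fin 4) :
    killingFormUp G H X x a b =
      ((toC (G x))⁻¹ * sdMat G h x (killMat G X x) * (toC (G x))⁻¹) a b := by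
  rw [toC_inv (L.isUnit_det hx), Matrix.mul_apply]
  simp only [Matrix.mul_apply, Finset.sum_mul]
  rw [Finset.sum_comm]
  exact Finset.sum_congr rfl fun m _ => Finset.sum_congr rfl fun n _ => by
    rw [L.killingForm_eq hx, ginv, ginv, toC_apply, toC_apply, L.inv_symm hx b n]; ring

theorem isSelfDual_sdMat (L : KillingChart U G H X h) (hx : x ∈ U) {A : Mat ℝ}
    (hA : A.transpose = -A) : IsSelfDual (h x : ℂ) (toC (G x))⁻¹ (sdMat G h x A) := by
  obtain ⟨P, s, C⟩ := L.coframe x hx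
  have := C.toC.isSelfDual_add (A := toC A) (by rw [← toC_transpose, hA, toC_neg])
  rwa [toC_inv (L.isUnit_det hx), ← toC_hodge, ← toC_inv (L.isUnit_det hx)] at this

theorem killingFormSq_eq (L : KillingChart U G H X h) (hx : x ∈ U) :
    killingFormSq G H X x = pairing (toC (G x))⁻¹ (sdMat G h x (killMat G X x))
      (sdMat G h x (killMat G X x)) := by
  obtain ⟨P, s, C⟩ := L.coframe x hx
  rw [pairing_eq_sum C.toC.inv_transpose _ (L.isSelfDual_sdMat hx (L.killMat_transpose hx)).skew]
  simp only [killingFormSq, L.killingForm_eq hx, L.killingFormUp_eq hx]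

theorem ernst_eq (L : KillingChart U G H X h) (hx : x ∈ U) (m : Fin 4) :
    ernst G H X x m = 2 * ∑ a, (X x a : ℂ) * sdMat G h x (killMat G X x) a m := by
  simp only [ernst, L.killingForm_eq hx]

theorem weylKilling_eq (L : KillingChart U G H X h) (hx : x ∈ U) (b : Fin 4) :
    weylKilling G H X x b = ∑ m, (X x m : ℂ) * pairing (toC (G x))⁻¹
      (sdMat G h x (rlow G m b x)) (sdMat G h x (killMat G X x)) := by
  obtain ⟨P, s, C⟩ := L.coframe x hx
  simp only [weylKilling, L.weylSD_eq hx, L.killingFormUp_eq hx, Finset.mul_sum, mul_assoc,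
    pairing_eq_sum C.toC.inv_transpose _ (L.isSelfDual_sdMat hx (L.killMat_transpose hx)).skew]

theorem idSD_eq (L : KillingChart U G H X h) (hx : x ∈ U) (a b c d : Fin 4) :
    idSD G H x a b c d = idForm (toC (G x)) (h x) a b c d := by
  obtain ⟨P, s, C⟩ := L.coframe x hx
  rw [C.toC.idForm_apply, idSD, L.vol_eq x hx]
  simp
  ring

/-- The covariant derivative of a self-dual form. -/
theorem hasMatPD_sdMat (L : KillingChart U G H X h) (hx : x ∈ U) {i : Fin 4} {A : E4 → Mat ℝ}
    {D : Mat ℝ} (hs : (A x).transpose = -A x)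
    (hA : HasMatPD i A (D + (gam G i x).transpose * A x + A x * gam G i x) x) :
    HasMatPD i (fun y => sdMat G h y (A y)) (sdMat G h x D
      + (toC (gam G i x)).transpose * sdMat G h x (A x)
      + sdMat G h x (A x) * toC (gam G i x)) x := by
  refine (HasMatPD.add hA.ofReal (HasMatPD.const_smul I
    (L.hasMatPD_hodge hx hs hA).ofReal)).congr_val ?_
  change toC _ + I • toC _ = _
  simp only [sdMat, toC_add, toC_mul, toC_transpose, smul_add, Matrix.mul_add, Matrix.add_mul,
    Matrix.mul_smul, Matrix.smul_mul]
  abel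

theorem sdMat_add (G : E4 → Mat ℝ) (h : E4 → ℝ) (x : E4) (A B : Mat ℝ) :
    sdMat G h x (A + B) = sdMat G h x A + sdMat G h x B := by
  simp only [sdMat, hodge_add, toC_add, smul_add]
  abel

theorem sdMat_smul (G : E4 → Mat ℝ) (h : E4 → ℝ) (x : E4) (r : ℝ) (A : Mat ℝ) :
    sdMat G h x (r • A) = (r : ℂ) • sdMat G h x A := by
  simp only [sdMat, hodge_smul, toC_smul, smul_add]
  rw [smul_comm I]

theorem sdMat_sum {ι : Type*} (t : Finset ι) (G : E4 → Mat ℝ) (h : E4 → ℝ) (x : E4)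
    (A : ι → Mat ℝ) : sdMat G h x (∑ i ∈ t, A i) = ∑ i ∈ t, sdMat G h x (A i) :=
  map_sum (AddMonoidHom.mk' (sdMat G h x) (sdMat_add G h x)) A t

/-- The derivative of the contraction of two complex two-forms. -/
theorem hasPD_pairing (L : KillingChart U G H X h) (hx : x ∈ U) {i : Fin 4} {A B : E4 → Mat ℂ}
    {DA DB : Mat ℂ}
    (hA : HasMatPD i A (DA + (toC (gam G i x)).transpose * A x + A x * toC (gam G i x)) x)
    (hB : HasMatPD i B (DB + (toC (gam G i x)).transpose * B x + B x * toC (gam G i x)) x) :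
    HasPD i (fun y => pairing (toC (G y))⁻¹ (A y) (B y))
      (pairing (toC (G x))⁻¹ DA (B x) + pairing (toC (G x))⁻¹ (A x) DB) x := by
  have hi : HasMatPD i (fun y => (toC (G y))⁻¹)
      (-((toC (G x))⁻¹ * (toC (gam G i x)).transpose + toC (gam G i x) * (toC (G x))⁻¹)) x := by
    refine ((L.hasMatPD_inv hx i).ofReal.congr_of_eventuallyEq ?_).congr_val ?_
    · filter_upwards [L.mem_nhds hx] with y hy using toC_inv (L.isUnit_det hy)
    · change toC _ = _
      rw [toC_neg, toC_add, toC_mul, toC_mul, toC_transpose, toC_inv (L.isUnit_det hx)]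
  refine ((((hA.mul hi).mul hB).mul hi).trace.neg).congr_val ?_
  set gi := (toC (G x))⁻¹
  set Γ := toC (gam G i x)
  rw [pairing, pairing, ← neg_add, ← Matrix.trace_add]
  congr 1
  rw [← sub_eq_zero, ← Matrix.trace_sub]
  have e : ((((DA + Γ.transpose * A x + A x * Γ) * gi + A x * -(gi * Γ.transpose + Γ * gi)) * B x
      + A x * gi * (DB + Γ.transpose * B x + B x * Γ)) * gi
      + A x * gi * B x * -(gi * Γ.transpose + Γ * gi)) - (DA * gi * B x * gi + A x * gi * DB * gi) =
      Γ.transpose * (A x * gi * B x * gi) - (A x * gi * B x * gi) * Γ.transpose := by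
    noncomm_ring
  rw [e, Matrix.trace_sub, Matrix.trace_mul_comm, sub_self]

end KillingChart

end KillingField
end KillingGeometry
end

noncomputable section
namespace KillingGeometry

section SimonChart

open Complex

/-- Components in a coordinate system of a Killing field of a vacuum spacetime with vanishing Simon
tensor, `ℱ² ≠ 0`, that is non-null on a dense set. -/
structure SimonChart (U : Set E4) (G : E4 → Mat ℝ) (H : E4 → Fin 4 → Fin 4 → Fin 4 → Fin 4 → ℝ)
    (X : E4 → Fin 4 → ℝ) (h : E4 → ℝ) : Prop extends KillingChart U G H X h where
  simon_eq : ∀ x ∈ U, ∀ a b n, simon G H X x a b n = 0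
  sq_ne_zero : ∀ x ∈ U, killingFormSq G H X x ≠ 0
  dense : U ⊆ closure {x ∈ U | normSqNeg G X x ≠ 0}

/-- The self-dual Killing form as a matrix. -/
def sdKill (G : E4 → Mat ℝ) (X : E4 → Fin 4 → ℝ) (h : E4 → ℝ) (x : E4) : Mat ℂ :=
  sdMat G h x (killMat G X x)

/-- The self-dual Weyl tensor as a family of matrices. -/
def sdWeyl (G : E4 → Mat ℝ) (h : E4 → ℝ) (x : E4) (a b : Fin 4) : Mat ℂ :=
  sdMat G h x (rlow G a b x)

/-- The complex scalar `ℱ²`. -/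
def sdSq (G : E4 → Mat ℝ) (X : E4 → Fin 4 → ℝ) (h : E4 → ℝ) (x : E4) : ℂ :=
  pairing (toC (G x))⁻¹ (sdKill G X h x) (sdKill G X h x)

/-- The Ernst one-form. -/
def sdErnst (G : E4 → Mat ℝ) (X : E4 → Fin 4 → ℝ) (h : E4 → ℝ) (x : E4) (m : Fin 4) : ℂ :=
  2 * ∑ a, (X x a : ℂ) * sdKill G X h x a m

/-- The proportionality factor between `𝒞` and `ℱ ⊗ ℱ - (1/3) ℐ ℱ²`. -/
def weylFactor (G : E4 → Mat ℝ) (X : E4 → Fin 4 → ℝ) (h : E4 → ℝ) (x : E4) : ℂ :=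
  3 / 2 * pairing (toC (G x))⁻¹ (contr (toC (G x))⁻¹ (sdWeyl G h x) (sdKill G X h x))
    (sdKill G X h x) / sdSq G X h x ^ 2

namespace KillingChart

variable {U : Set E4} {G : E4 → Mat ℝ} {H : E4 → Fin 4 → Fin 4 → Fin 4 → Fin 4 → ℝ}
  {X : E4 → Fin 4 → ℝ} {h : E4 → ℝ} {x : E4}

theorem isSelfDual_sdKill (L : KillingChart U G H X h) (hx : x ∈ U) :
    IsSelfDual (h x : ℂ) (toC (G x))⁻¹ (sdKill G X h x) :=
  L.isSelfDual_sdMat hx (L.killMat_transpose hx)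

theorem isSelfDual_sdWeyl (L : KillingChart U G H X h) (hx : x ∈ U) (a b : Fin 4) :
    IsSelfDual (h x : ℂ) (toC (G x))⁻¹ (sdWeyl G h x a b) :=
  L.isSelfDual_sdMat hx (L.rlow_transpose hx a b)

theorem sdWeyl_pair (L : KillingChart U G H X h) (hx : x ∈ U) (a b c d : Fin 4) :
    sdWeyl G h x a b c d = sdWeyl G h x c d a b := by
  simp only [sdWeyl, sdMat, Matrix.add_apply, Matrix.smul_apply, toC_apply]
  rw [L.rlow_pair hx, L.hodge_rlow_pair hx]

theorem hasMatPD_sdKill (L : KillingChart U G H X h) (hx : x ∈ U) (i : Fin 4) :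
    HasMatPD i (sdKill G X h) (∑ d, (X x d : ℂ) • sdWeyl G h x d i
      + (toC (gam G i x)).transpose * sdKill G X h x
      + sdKill G X h x * toC (gam G i x)) x := by
  refine (L.hasMatPD_sdMat hx (L.killMat_transpose hx) (L.hasMatPD_killMat hx i)).congr_val ?_
  simp only [sdMat_sum, sdMat_smul]
  rfl

theorem bianchi_sdWeyl (L : KillingChart U G H X h) (hx : x ∈ U) :
    ∃ D : Fin 4 → Fin 4 → Fin 4 → Mat ℂ, (∀ e c d, HasMatPD e (fun y => sdWeyl G h y c d)
        (D e c d + (toC (gam G e x)).transpose * sdWeyl G h x c d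
          + sdWeyl G h x c d * toC (gam G e x)) x) ∧
      ∀ e c d, D e c d + D c d e + D d e c = 0 := by
  obtain ⟨D, hD, hc⟩ := L.bianchi hx
  refine ⟨fun e c d => sdMat G h x (D e c d), fun e c d =>
    L.hasMatPD_sdMat hx (L.rlow_transpose hx c d) (hD e c d), fun e c d => ?_⟩
  rw [← sdMat_add, ← sdMat_add, hc, ← zero_smul ℝ (0 : Mat ℝ), sdMat_smul]
  simp

theorem hasPD_sdSq (L : KillingChart U G H X h) (hx : x ∈ U) (i : Fin 4) :
    HasPD i (sdSq G X h) (2 * ∑ d, (X x d : ℂ) * pairing (toC (G x))⁻¹ (sdWeyl G h x d i)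
      (sdKill G X h x)) x := by
  refine (L.hasPD_pairing hx (L.hasMatPD_sdKill hx i) (L.hasMatPD_sdKill hx i)).congr_val ?_
  rw [pairing_comm _ (sdKill G X h x), pairing_sum_left]
  simp only [pairing_smul_left]
  ring

theorem differentiableAt_inv (L : KillingChart U G H X h) (hx : x ∈ U) (a b : Fin 4) :
    DifferentiableAt ℝ (fun y => (toC (G y))⁻¹ a b) x := by
  have h1 := ((L.hasMatPD_inv hx 0).ofReal a b).differentiableAt
  refine h1.congr_of_eventuallyEq ?_
  filter_upwards [L.mem_nhds hx] with y hy
  rw [toC_inv (L.isUnit_det hy)]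
  rfl

theorem differentiableAt_sdKill (L : KillingChart U G H X h) (hx : x ∈ U) (a b : Fin 4) :
    DifferentiableAt ℝ (fun y => sdKill G X h y a b) x :=
  (L.hasMatPD_sdKill hx 0 a b).differentiableAt

theorem differentiableAt_sdWeyl (L : KillingChart U G H X h) (hx : x ∈ U) (a b c d : Fin 4) :
    DifferentiableAt ℝ (fun y => sdWeyl G h y a b c d) x := by
  obtain ⟨D, hD, -⟩ := L.bianchi_sdWeyl hx
  exact (hD 0 a b c d).differentiableAt

theorem differentiableAt_weylFactor (L : KillingChart U G H X h) (hx : x ∈ U)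
    (h0 : sdSq G X h x ≠ 0) : DifferentiableAt ℝ (weylFactor G X h) x := by
  have h1 : ∀ y, pairing (toC (G y))⁻¹ (contr (toC (G y))⁻¹ (sdWeyl G h y) (sdKill G X h y))
      (sdKill G X h y) = ∑ c, ∑ d, (∑ k, (∑ l, (toC (G y))⁻¹ c l * sdKill G X h y l k)
        * (toC (G y))⁻¹ k d) * pairing (toC (G y))⁻¹ (sdWeyl G h y c d) (sdKill G X h y) := by
    intro y
    simp only [contr, pairing_sum_left, pairing_smul_left, Matrix.mul_apply]
  obtain ⟨D, hD, -⟩ := L.bianchi_sdWeyl hx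
  unfold weylFactor
  simp only [h1, div_eq_mul_inv]
  have hF := L.differentiableAt_sdKill hx
  have hi := L.differentiableAt_inv hx
  have hp : ∀ c d, DifferentiableAt ℝ (fun y =>
      pairing (toC (G y))⁻¹ (sdWeyl G h y c d) (sdKill G X h y)) x := fun c d =>
    (L.hasPD_pairing hx (hD 0 c d) (L.hasMatPD_sdKill hx 0)).differentiableAt
  have hs := (L.hasPD_sdSq hx 0).differentiableAt
  refine DifferentiableAt.fun_mul ?_ ((hs.fun_pow 2).fun_inv (pow_ne_zero 2 h0))
  refine DifferentiableAt.const_mul ?_ _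
  exact DifferentiableAt.fun_sum fun c _ => DifferentiableAt.fun_sum fun d _ =>
    (DifferentiableAt.fun_sum fun k _ => (DifferentiableAt.fun_sum fun l _ =>
      (hi c l).fun_mul (hF l k)).fun_mul (hi k d)).fun_mul (hp c d)

theorem sdSq_eq (L : KillingChart U G H X h) (hx : x ∈ U) :
    killingFormSq G H X x = sdSq G X h x := L.killingFormSq_eq hx

theorem sdErnst_eq (L : KillingChart U G H X h) (hx : x ∈ U) (m : Fin 4) :
    ernst G H X x m = sdErnst G X h x m := L.ernst_eq hx m

end KillingChart

namespace SimonChart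

variable {U : Set E4} {G : E4 → Mat ℝ} {H : E4 → Fin 4 → Fin 4 → Fin 4 → Fin 4 → ℝ}
  {X : E4 → Fin 4 → ℝ} {h : E4 → ℝ} {x : E4}

theorem sdSq_ne_zero (L : SimonChart U G H X h) (hx : x ∈ U) : sdSq G X h x ≠ 0 := by
  rw [← L.sdSq_eq hx]; exact L.sq_ne_zero x hx

theorem sdWeyl_eq_of_ne_zero (L : SimonChart U G H X h) (hx : x ∈ U) (h0 : normSqNeg G X x ≠ 0)
    (a b : Fin 4) : sdWeyl G h x a b = weylFactor G X h x • (sdKill G X h x a b • sdKill G X h x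
      - (1 / 3 * sdSq G X h x) • idForm (toC (G x)) (h x) a b) := by
  obtain ⟨P, s, C⟩ := L.coframe x hx
  have hl : ∀ a, ((lower G X a x : ℝ) : ℂ) = (toC (G x)).mulVec (fun i => (X x i : ℂ)) a := by
    intro a
    simp [lower, Matrix.mulVec, dotProduct]
  have hn : ((normSqNeg G X x : ℝ) : ℂ) =
      -((fun i => (X x i : ℂ)) ⬝ᵥ (toC (G x)).mulVec (fun i => (X x i : ℂ))) := by
    rw [normSqNeg, dotProduct]
    push_cast
    simp only [hl]
  refine C.toC.eq_of_simon (X := fun i => (X x i : ℂ)) (L.isSelfDual_sdWeyl hx) (L.sdWeyl_pair hx)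
    (L.isSelfDual_sdKill hx) (L.sdSq_ne_zero hx) ?_ (fun a b n => ?_) a b
  · intro h1
    rw [h1, neg_zero] at hn
    exact h0 (by exact_mod_cast hn)
  · have h1 := L.simon_eq x hx a b n
    have hg : ∀ a b, ((gammaTensor G X x a b : ℝ) : ℂ) =
        -((fun i => (X x i : ℂ)) ⬝ᵥ (toC (G x)).mulVec (fun i => (X x i : ℂ))) * toC (G x) a b
        + (toC (G x)).mulVec (fun i => (X x i : ℂ)) a
          * (toC (G x)).mulVec (fun i => (X x i : ℂ)) b := by
      intro a b
      rw [gammaTensor]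
      push_cast
      rw [hn, hl, hl, toC_apply]
    simp only [simon, hg, weylElectric, L.weylSD_eq hx, L.ernst_eq hx, L.weylKilling_eq hx] at h1
    exact h1

theorem sdWeyl_eq (L : SimonChart U G H X h) (hx : x ∈ U) (a b : Fin 4) :
    sdWeyl G h x a b = weylFactor G X h x • (sdKill G X h x a b • sdKill G X h x
      - (1 / 3 * sdSq G X h x) • idForm (toC (G x)) (h x) a b) := by
  ext c d
  have hl : ContinuousOn (fun y => sdWeyl G h y a b c d) U := fun y hy =>
    (L.differentiableAt_sdWeyl hy a b c d).continuousAt.continuousWithinAt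
  have hr : ContinuousOn (fun y => (weylFactor G X h y • (sdKill G X h y a b • sdKill G X h y
      - (1 / 3 * sdSq G X h y) • idForm (toC (G y)) (h y) a b)) c d) U := by
    have hQ : ContinuousOn (weylFactor G X h) U := fun y hy =>
      (L.differentiableAt_weylFactor hy (L.sdSq_ne_zero hy)).continuousAt.continuousWithinAt
    have hF : ∀ a b, ContinuousOn (fun y => sdKill G X h y a b) U := fun a b y hy =>
      (L.differentiableAt_sdKill hy a b).continuousAt.continuousWithinAt
    have hs : ContinuousOn (sdSq G X h) U := fun y hy =>
      (L.hasPD_sdSq hy 0).differentiableAt.continuousAt.continuousWithinAt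
    have hg : ∀ a b, ContinuousOn (fun y => (G y a b : ℂ)) U := fun a b =>
      continuous_ofReal.comp_continuousOn (L.contDiff_metric a b).continuousOn
    have hh : ContinuousOn (fun y => (h y : ℂ)) U :=
      continuous_ofReal.comp_continuousOn L.continuous_vol
    have hI : ContinuousOn (fun y => idForm (toC (G y)) (h y) a b c d) U := by
      refine ContinuousOn.congr (f := fun y => 1 / 4 * ((G y a c : ℂ) * (G y b d : ℂ)
        - (G y a d : ℂ) * (G y b c : ℂ) + I * ((h y : ℂ) * levi a b c d))) ?_ fun y hy => ?_
      · exact continuousOn_const.mul ((((hg _ _).mul (hg _ _)).sub ((hg _ _).mul (hg _ _))).add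
          (continuousOn_const.mul (hh.mul continuousOn_const)))
      · obtain ⟨P, s, C⟩ := L.coframe y hy
        exact C.toC.idForm_apply a b c d
    exact hQ.mul (((hF a b).mul (hF c d)).sub ((continuousOn_const.mul hs).mul hI))
  exact Set.EqOn.of_subset_closure (s := {x ∈ U | normSqNeg G X x ≠ 0})
    (fun y hy => congrFun (congrFun (L.sdWeyl_eq_of_ne_zero hy.1 hy.2 a b) c) d) hl hr
    (Set.sep_subset _ _) L.dense hx

theorem pairing_sdWeyl_sdKill (L : SimonChart U G H X h) (hx : x ∈ U) (a b : Fin 4) :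
    pairing (toC (G x))⁻¹ (sdWeyl G h x a b) (sdKill G X h x) =
      2 / 3 * (weylFactor G X h x * sdSq G X h x) * sdKill G X h x a b := by
  obtain ⟨P, s, C⟩ := L.coframe x hx
  rw [L.sdWeyl_eq hx, pairing_smul_left, pairing_sub_left, pairing_smul_left, pairing_smul_left,
    C.toC.pairing_idForm a b (L.isSelfDual_sdKill hx)]
  change _ * (_ * sdSq G X h x - _) = _
  ring

theorem hasPD_sdSq (L : SimonChart U G H X h) (hx : x ∈ U) (i : Fin 4) :
    HasPD i (sdSq G X h) (2 / 3 * weylFactor G X h x * sdSq G X h x * sdErnst G X h x i) x := by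
  refine (L.toKillingChart.hasPD_sdSq hx i).congr_val ?_
  simp only [L.pairing_sdWeyl_sdKill hx, sdErnst, Finset.mul_sum]
  exact Finset.sum_congr rfl fun d _ => by ring

theorem pairing_sdWeyl_sdWeyl (L : SimonChart U G H X h) (hx : x ∈ U) (a b m e : Fin 4) :
    pairing (toC (G x))⁻¹ (sdWeyl G h x a b) (sdWeyl G h x m e) = weylFactor G X h x ^ 2 *
      (1 / 3 * sdSq G X h x * (sdKill G X h x m e * sdKill G X h x a b)
        + 1 / 9 * sdSq G X h x ^ 2 * idForm (toC (G x)) (h x) m e a b) := by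
  obtain ⟨P, s, C⟩ := L.coframe x hx
  have h1 := L.pairing_sdWeyl_sdKill hx a b
  have h2 : pairing (toC (G x))⁻¹ (sdWeyl G h x a b) (idForm (toC (G x)) (h x) m e) =
      sdWeyl G h x m e a b := by
    rw [pairing_comm, C.toC.pairing_idForm m e (L.isSelfDual_sdWeyl hx a b), L.sdWeyl_pair hx]
  rw [L.sdWeyl_eq hx m e, pairing_smul_right, pairing_sub_right, pairing_smul_right,
    pairing_smul_right, h1, h2, L.sdWeyl_eq hx m e]
  simp only [Matrix.smul_apply, Matrix.sub_apply, smul_eq_mul]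
  ring

/-- The exterior derivative of `q ℱ`, contracted with `ℱ`, by the Bianchi identity. -/
theorem hasPD_weylFactor (L : SimonChart U G H X h) (hx : x ∈ U) (e : Fin 4) :
    HasPD e (weylFactor G X h) (-(weylFactor G X h x ^ 2 / 6) * sdErnst G X h x e) x := by
  obtain ⟨P, s, C⟩ := L.coframe x hx
  obtain ⟨D, hD, hc⟩ := L.bianchi_sdWeyl hx
  set gi := (toC (G x))⁻¹ with hgi
  set F := sdKill G X h x with hF
  set Q := weylFactor G X h x with hQ
  set s2 := sdSq G X h x with hs2
  set σ := sdErnst G X h x with hσ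
  have hFs := L.isSelfDual_sdKill hx
  rw [← hF, ← hgi] at hFs
  have hFsk : ∀ a b, F b a = - F a b := fun a b => congrFun (congrFun hFs.skew a) b
  let q : Fin 4 → ℂ := fun i => fderiv ℝ (weylFactor G X h) x (EuclideanSpace.single i 1)
  have hq : ∀ i, HasPD i (weylFactor G X h) (q i) x := fun i =>
    ⟨L.differentiableAt_weylFactor hx (L.sdSq_ne_zero hx), rfl⟩
  let φ : Fin 4 → ℂ := fun i => 2 / 3 * (q i * s2 + Q * (2 / 3 * Q * s2 * σ i))
  let N : Fin 4 → Mat ℂ := fun i => ∑ d, (X x d : ℂ) • sdWeyl G h x d i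
  have hd : ∀ i a b, pairing gi (D i a b) F + pairing gi (sdWeyl G h x a b) (N i) =
      φ i * F a b + 2 / 3 * (Q * s2) * (N i a b
        + ((toC (gam G i x)).transpose * F + F * toC (gam G i x)) a b) := by
    intro i a b
    have h1 := L.hasPD_pairing hx (hD i a b) (L.hasMatPD_sdKill hx i)
    have h2 := (((hq i).mul (L.hasPD_sdSq hx i)).const_mul (2 / 3)).mul (L.hasMatPD_sdKill hx i a b)
    have h3 := h1.unique (h2.congr_of_eventuallyEq (by
      filter_upwards [L.mem_nhds hx] with y hy using L.pairing_sdWeyl_sdKill hy a b))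
    rw [h3]
    simp only [φ, N, Matrix.add_apply, ← hs2, ← hQ, ← hσ, ← hF]
    ring
  have hΓ : ∀ a b, ((toC (gam G e x)).transpose * F + F * toC (gam G e x)) a b
      + ((toC (gam G a x)).transpose * F + F * toC (gam G a x)) b e
      + ((toC (gam G b x)).transpose * F + F * toC (gam G b x)) e a = 0 := by
    intro a b
    have e1 : ∀ i a b, ((toC (gam G i x)).transpose * F + F * toC (gam G i x)) a b =
        ∑ k, ((christoffel G k a i x : ℂ) * F k b - (christoffel G k b i x : ℂ) * F k a) := by
      intro i a b
      rw [Matrix.add_apply, Matrix.mul_apply, Matrix.mul_apply, ← Finset.sum_add_distrib]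
      refine Finset.sum_congr rfl fun k _ => ?_
      rw [hFsk k a]
      simp [gam]
      ring
    rw [e1, e1, e1, ← Finset.sum_add_distrib, ← Finset.sum_add_distrib]
    refine Finset.sum_eq_zero fun k _ => ?_
    rw [L.christoffel_symm hx k a e, L.christoffel_symm hx k b a, L.christoffel_symm hx k e b]
    ring
  have hcyc : ∀ a b, (pairing gi (sdWeyl G h x a b) (N e) + pairing gi (sdWeyl G h x b e) (N a)
      + pairing gi (sdWeyl G h x e a) (N b)) =
      (φ e * F a b + φ a * F b e + φ b * F e a) + 2 / 3 * (Q * s2) *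
        (N e a b + N a b e + N b e a) := by
    intro a b
    have h0 : pairing gi (D e a b) F + pairing gi (D a b e) F + pairing gi (D b e a) F = 0 := by
      rw [← pairing_add_left, ← pairing_add_left, hc, ← zero_smul ℂ (0 : Mat ℂ),
        pairing_smul_left, zero_mul]
    linear_combination hd e a b + hd a b e + hd b e a - h0 + 2 / 3 * (Q * s2) * hΓ a b
  let J : Fin 4 → Fin 4 → Fin 4 → ℂ := fun i a b =>
    ∑ m, (X x m : ℂ) * idForm (toC (G x)) (h x) m i a b
  have hN : ∀ i a b, N i a b = Q * (1 / 2 * σ i * F a b - 1 / 3 * s2 * J i a b) := by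
    intro i a b
    simp only [N, J, Matrix.sum_apply, Matrix.smul_apply, smul_eq_mul, L.sdWeyl_eq hx,
      Matrix.sub_apply, hσ, sdErnst, ← hs2, ← hF, ← hQ, Finset.mul_sum, Finset.sum_mul,
      ← Finset.sum_sub_distrib]
    exact Finset.sum_congr rfl fun m _ => by ring
  have hWN : ∀ i a b, pairing gi (sdWeyl G h x a b) (N i) =
      Q ^ 2 * (1 / 6 * s2 * (σ i * F a b) + 1 / 9 * s2 ^ 2 * J i a b) := by
    intro i a b
    rw [pairing_comm, pairing_sum_left]
    simp only [J, pairing_smul_left]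
    have e1 : ∀ m, pairing gi (sdWeyl G h x m i) (sdWeyl G h x a b) = Q ^ 2 *
        (1 / 3 * s2 * (F m i * F a b) + 1 / 9 * s2 ^ 2 * idForm (toC (G x)) (h x) m i a b) :=
      fun m => (pairing_comm _ _ _).trans (L.pairing_sdWeyl_sdWeyl hx a b m i)
    simp only [e1, hσ, sdErnst, ← hF, Finset.mul_sum, Finset.sum_mul, ← Finset.sum_add_distrib]
    exact Finset.sum_congr rfl fun m _ => by ring
  have hw : ∀ ψ : Fin 4 → ℂ, ∑ a, ∑ b, (ψ e * F a b + ψ a * F b e + ψ b * F e a)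
      * (gi * F * gi) a b = 1 / 2 * s2 * ψ e := fun ψ => C.toC.wedge_contract hFs ψ e
  have hJ : ∑ a, ∑ b, (J e a b + J a b e + J b e a) * (gi * F * gi) a b = 3 / 4 * σ e := by
    have h1 : ∀ m, ∑ a, ∑ b, (idForm (toC (G x)) (h x) m e a b + idForm (toC (G x)) (h x) m a b e
        + idForm (toC (G x)) (h x) m b e a) * (gi * F * gi) a b = 3 / 2 * F m e :=
      fun m => C.toC.idForm_contract hFs m e
    have h2 : ∑ a, ∑ b, (J e a b + J a b e + J b e a) * (gi * F * gi) a b =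
        ∑ m, (X x m : ℂ) * ∑ a, ∑ b, (idForm (toC (G x)) (h x) m e a b
          + idForm (toC (G x)) (h x) m a b e + idForm (toC (G x)) (h x) m b e a)
            * (gi * F * gi) a b := by
      simp only [J, ← Finset.sum_add_distrib, Finset.sum_mul, Finset.mul_sum]
      conv_rhs => rw [Finset.sum_comm]; enter [2, a]; rw [Finset.sum_comm]
      exact Finset.sum_congr rfl fun a _ => Finset.sum_congr rfl fun b _ =>
        Finset.sum_congr rfl fun m _ => by ring
    rw [h2]
    simp only [h1, hσ, sdErnst, ← hF, Finset.mul_sum]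
    exact Finset.sum_congr rfl fun m _ => by ring
  have htot : Q ^ 2 * (1 / 6 * s2 * (1 / 2 * s2 * σ e) + 1 / 9 * s2 ^ 2 * (3 / 4 * σ e)) =
      1 / 2 * s2 * φ e + 2 / 3 * (Q * s2) *
        (Q * (1 / 2 * (1 / 2 * s2 * σ e) - 1 / 3 * s2 * (3 / 4 * σ e))) := by
    rw [← hJ, ← hw σ, ← hw φ]
    simp only [Finset.mul_sum, ← Finset.sum_add_distrib, ← Finset.sum_sub_distrib]
    refine Finset.sum_congr rfl fun a _ => Finset.sum_congr rfl fun b _ => ?_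
    have := hcyc a b
    simp only [hWN, hN] at this
    linear_combination (gi * F * gi) a b * this
  have hs0 : s2 ≠ 0 := L.sdSq_ne_zero hx
  refine (hq e).congr_val ?_
  have h2 : s2 ^ 2 ≠ 0 := pow_ne_zero 2 hs0
  apply mul_left_cancel₀ h2
  simp only [φ] at htot
  linear_combination (-3) * htot

/-- The Ernst one-form has no zero where the Killing field is non-null. -/
theorem sdErnst_ne_zero (L : SimonChart U G H X h) (hx : x ∈ U) (h0 : normSqNeg G X x ≠ 0) :
    ∃ m, sdErnst G X h x m ≠ 0 := by
  by_contra! hcon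
  obtain ⟨P, s, C⟩ := L.coframe x hx
  have h1 := C.toC.dot_mul_dot (L.isSelfDual_sdKill hx) (L.isSelfDual_sdKill hx)
    (fun i => (X x i : ℂ))
  have h2 : Matrix.vecMul (fun i => (X x i : ℂ)) (sdKill G X h x) = 0 := by
    ext m
    have := hcon m
    rw [sdErnst] at this
    simpa [Matrix.vecMul, dotProduct] using this
  rw [h2, zero_dotProduct] at h1
  have h3 : (fun i => (X x i : ℂ)) ⬝ᵥ (toC (G x)).mulVec (fun i => (X x i : ℂ)) ≠ 0 := by
    intro h3
    apply h0
    have : ((normSqNeg G X x : ℝ) : ℂ) = 0 := by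
      rw [normSqNeg]
      simp only [dotProduct, Matrix.mulVec] at h3
      push_cast [lower]
      simp only [toC_apply] at h3
      rw [h3, neg_zero]
    exact_mod_cast this
  exact (mul_ne_zero (mul_ne_zero (by norm_num) h3) (L.sdSq_ne_zero hx)) h1.symm

end SimonChart

end SimonChart
end KillingGeometry
end

noncomputable section
namespace KillingGeometry

theorem subset_closure_of_dense {M : Type*} [TopologicalSpace M] {e : OpenPartialHomeomorph M E4}
    {A : Set M} (hA : Dense A) : e.target ⊆ closure {x ∈ e.target | e.symm x ∈ A} := by
  intro x hx
  rw [mem_closure_iff_nhds]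
  intro t ht
  have h1 : e.symm x ∈ closure A := hA _
  have h2 : (e.source ∩ e ⁻¹' t) ∈ nhds (e.symm x) := by
    refine Filter.inter_mem (e.open_source.mem_nhds (e.map_target hx)) ?_
    exact (e.continuousAt (e.map_target hx)).preimage_mem_nhds (by rwa [e.right_inv hx])
  obtain ⟨p, ⟨hp1, hp2⟩, hp3⟩ := mem_closure_iff_nhds.mp h1 _ h2
  exact ⟨e p, hp2, e.map_source hp1, by rwa [e.left_inv hp1]⟩

section Frame

variable {M : Type*} [TopologicalSpace M] [ChartedSpace E4 M]

theorem mdifferentiable_of_mem_maximalAtlas {e : OpenPartialHomeomorph M E4}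
    (he : e ∈ IsManifold.maximalAtlas (𝓡 4) 4 M) : e.MDifferentiable (𝓡 4) (𝓡 4) :=
  ⟨(contMDiffOn_of_mem_maximalAtlas he).mdifferentiableOn (by norm_num),
    (contMDiffOn_symm_of_mem_maximalAtlas he).mdifferentiableOn (by norm_num)⟩

/-- The derivative of the inverse of a chart, in the model space. -/
def frameMap (e : OpenPartialHomeomorph M E4) (x : E4) : E4 →L[ℝ] E4 :=
  mfderiv (𝓡 4) (𝓡 4) e.symm x

/-- The derivative of a chart, in the model space. -/
def coframeMap (e : OpenPartialHomeomorph M E4) (p : M) : E4 →L[ℝ] E4 :=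
  mfderiv (𝓡 4) (𝓡 4) e p

theorem coframeMap_frameMap {e : OpenPartialHomeomorph M E4}
    (he : e ∈ IsManifold.maximalAtlas (𝓡 4) 4 M) {x : E4} (hx : x ∈ e.target) (v : E4) :
    coframeMap e (e.symm x) (frameMap e x v) = v :=
  DFunLike.congr_fun ((mdifferentiable_of_mem_maximalAtlas he).comp_symm_deriv hx) v

theorem frameMap_coframeMap {e : OpenPartialHomeomorph M E4}
    (he : e ∈ IsManifold.maximalAtlas (𝓡 4) 4 M) {x : E4} (hx : x ∈ e.target) (v : E4) :
    frameMap e x (coframeMap e (e.symm x) v) = v := by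
  have h := DFunLike.congr_fun
    ((mdifferentiable_of_mem_maximalAtlas he).symm_comp_deriv (e.map_target hx)) v
  have h' : frameMap e (e (e.symm x)) (coframeMap e (e.symm x) v) = v := h
  rwa [e.right_inv hx] at h'

/-- The coordinate vectors, in the model space. -/
def frameVec (e : OpenPartialHomeomorph M E4) (x : E4) (i : Fin 4) : E4 :=
  frameMap e x (EuclideanSpace.single i 1)

theorem sum_smul_single (v : E4) : ∑ i, v i • (EuclideanSpace.single i (1 : ℝ) : E4) = v := by
  ext j
  simp [Pi.single_apply]

theorem frameMap_apply (e : OpenPartialHomeomorph M E4) (x v : E4) :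
    frameMap e x v = ∑ i, v i • frameVec e x i := by
  conv_lhs => rw [← sum_smul_single v]
  simp [map_sum, map_smul, frameVec]

/-- The basis of coordinate vectors. -/
def frameBasis {e : OpenPartialHomeomorph M E4} (he : e ∈ IsManifold.maximalAtlas (𝓡 4) 4 M)
    {x : E4} (hx : x ∈ e.target) : Module.Basis (Fin 4) ℝ E4 :=
  (EuclideanSpace.basisFun (Fin 4) ℝ).toBasis.map
    (LinearEquiv.ofLinearMap (frameMap e x : E4 →ₗ[ℝ] E4) (coframeMap e (e.symm x) : E4 →ₗ[ℝ] E4)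
      (LinearMap.ext (frameMap_coframeMap he hx)) (LinearMap.ext (coframeMap_frameMap he hx)))

theorem frameBasis_apply {e : OpenPartialHomeomorph M E4}
    (he : e ∈ IsManifold.maximalAtlas (𝓡 4) 4 M) {x : E4} (hx : x ∈ e.target) (i : Fin 4) :
    frameBasis he hx i = frameVec e x i := by
  simp [frameBasis, frameVec]

theorem coe_frameBasis {e : OpenPartialHomeomorph M E4}
    (he : e ∈ IsManifold.maximalAtlas (𝓡 4) 4 M) {x : E4} (hx : x ∈ e.target) :
    ⇑(frameBasis he hx) = frameVec e x := funext (frameBasis_apply he hx)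

/-- A field of bilinear forms, in the model space. -/
def modelForm (g : ∀ p : M, LinearMap.BilinForm ℝ (TangentSpace (𝓡 4) p)) (p : M) :
    LinearMap.BilinForm ℝ E4 := g p

/-- A field of four-forms, in the model space. -/
def modelVol (η : ∀ p : M, (TangentSpace (𝓡 4) p) [⋀^Fin 4]→ₗ[ℝ] ℝ) (p : M) :
    E4 [⋀^Fin 4]→ₗ[ℝ] ℝ := η p

/-- A vector field, in the model space. -/
def modelVec (ξ : ∀ p : M, TangentSpace (𝓡 4) p) (p : M) : E4 := ξ p

theorem metricIn_eq (g : ∀ p : M, LinearMap.BilinForm ℝ (TangentSpace (𝓡 4) p))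
    (e : OpenPartialHomeomorph M E4) (x : E4) (i j : Fin 4) :
    metricIn g e x i j = modelForm g (e.symm x) (frameVec e x i) (frameVec e x j) := rfl

theorem volIn_eq (η : ∀ p : M, (TangentSpace (𝓡 4) p) [⋀^Fin 4]→ₗ[ℝ] ℝ)
    (e : OpenPartialHomeomorph M E4) (x : E4) (a b c d : Fin 4) :
    volIn η e x a b c d = modelVol η (e.symm x) (frameVec e x ∘ ![a, b, c, d]) := by
  have h : frameVec e x ∘ ![a, b, c, d] =
      ![frameVec e x a, frameVec e x b, frameVec e x c, frameVec e x d] := by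
    ext i : 1
    fin_cases i <;> rfl
  rw [h]
  rfl

theorem volIn_eq_levi (η : ∀ p : M, (TangentSpace (𝓡 4) p) [⋀^Fin 4]→ₗ[ℝ] ℝ)
    (e : OpenPartialHomeomorph M E4) (x : E4) (a b c d : Fin 4) :
    volIn η e x a b c d = volIn η e x 0 1 2 3 * levi a b c d := by
  have hid : (![0, 1, 2, 3] : Fin 4 → Fin 4) = id := by
    ext i : 1
    fin_cases i <;> rfl
  rw [volIn_eq, volIn_eq, hid, Function.comp_id]
  set f : Fin 4 → Fin 4 := ![a, b, c, d] with hf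
  have hl : levi a b c d = levi (f 0) (f 1) (f 2) (f 3) := rfl
  rw [hl]
  by_cases hi : Function.Injective f
  · set s := Equiv.ofBijective f (Finite.injective_iff_bijective.mp hi) with hs
    have hsf : f = s := rfl
    rw [hsf, AlternatingMap.map_perm, levi_perm]
    rcases Int.units_eq_one_or (Equiv.Perm.sign s) with h | h <;> simp [h]
  · rw [levi_eq_zero f hi, AlternatingMap.map_eq_zero_of_not_injective _ _ fun h => hi h.of_comp]
    simp

theorem vecIn_eq (ξ : ∀ p : M, TangentSpace (𝓡 4) p)
    (e : OpenPartialHomeomorph M E4) (x : E4) (i : Fin 4) :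
    vecIn ξ e x i = coframeMap e (e.symm x) (modelVec ξ (e.symm x)) i := rfl

theorem sum_vecIn_smul {e : OpenPartialHomeomorph M E4}
    (he : e ∈ IsManifold.maximalAtlas (𝓡 4) 4 M) {x : E4} (hx : x ∈ e.target)
    (ξ : ∀ p : M, TangentSpace (𝓡 4) p) :
    ∑ i, vecIn ξ e x i • frameVec e x i = modelVec ξ (e.symm x) := by
  simp only [vecIn_eq]
  rw [← frameMap_apply, frameMap_coframeMap he hx]

theorem lower_eq {e : OpenPartialHomeomorph M E4}
    (he : e ∈ IsManifold.maximalAtlas (𝓡 4) 4 M) {x : E4} (hx : x ∈ e.target)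
    (g : ∀ p : M, LinearMap.BilinForm ℝ (TangentSpace (𝓡 4) p))
    (ξ : ∀ p : M, TangentSpace (𝓡 4) p) (a : Fin 4) :
    lower (metricIn g e) (vecIn ξ e) a x =
      modelForm g (e.symm x) (frameVec e x a) (modelVec ξ (e.symm x)) := by
  rw [← sum_vecIn_smul he hx, map_sum]
  simp only [map_smul, smul_eq_mul, lower, metricIn_eq]
  exact Finset.sum_congr rfl fun i _ => mul_comm _ _

theorem normSqNeg_eq {e : OpenPartialHomeomorph M E4}
    (he : e ∈ IsManifold.maximalAtlas (𝓡 4) 4 M) {x : E4} (hx : x ∈ e.target)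
    (g : ∀ p : M, LinearMap.BilinForm ℝ (TangentSpace (𝓡 4) p))
    (ξ : ∀ p : M, TangentSpace (𝓡 4) p) :
    normSqNeg (metricIn g e) (vecIn ξ e) x =
      -modelForm g (e.symm x) (modelVec ξ (e.symm x)) (modelVec ξ (e.symm x)) := by
  have h : ∑ a, vecIn ξ e x a * lower (metricIn g e) (vecIn ξ e) a x =
      modelForm g (e.symm x) (∑ a, vecIn ξ e x a • frameVec e x a) (modelVec ξ (e.symm x)) := by
    simp only [lower_eq he hx, map_sum, map_smul, LinearMap.sum_apply, LinearMap.smul_apply,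
      smul_eq_mul]
  rw [normSqNeg, h, sum_vecIn_smul he hx]

theorem minkMat_eq : minkMat ℝ = Matrix.of minkowski := by
  ext i j
  fin_cases i <;> fin_cases j <;> simp [minkMat, minkowski]

variable (S : C3Spacetime M)

theorem exists_coframe {e : OpenPartialHomeomorph M E4}
    (he : e ∈ IsManifold.maximalAtlas (𝓡 4) 4 M) {x : E4} (hx : x ∈ e.target) :
    ∃ P s, IsCoframe P s (metricIn S.metric e x) (volIn S.vol e x 0 1 2 3) := by
  obtain ⟨b, hb⟩ : ∃ b : Module.Basis (Fin 4) ℝ E4,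
      ∀ i j, modelForm S.metric (e.symm x) (b i) (b j) = minkowski i j := S.signature (e.symm x)
  have hv : |modelVol S.vol (e.symm x) b| = 1 := S.vol_unit (e.symm x) b hb
  refine ⟨b.toMatrix (frameVec e x), modelVol S.vol (e.symm x) b, ?_, ?_, ?_, ?_⟩
  · rw [← coe_frameBasis he hx, ← Module.Basis.det_apply]
    exact b.isUnit_det _
  · rw [← abs_mul_abs_self, hv, one_mul]
  · ext i j
    rw [metricIn_eq, ← b.sum_toMatrix_smul_self (frameVec e x) i,
      ← b.sum_toMatrix_smul_self (frameVec e x) j, minkMat_eq]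
    simp only [map_sum, map_smul, LinearMap.sum_apply, LinearMap.smul_apply, smul_eq_mul, hb,
      Matrix.mul_apply, Matrix.transpose_apply, Matrix.of_apply, Finset.sum_mul]
    refine Finset.sum_congr rfl fun k _ => ?_
    rw [← Finset.sum_mul, mul_comm]
  · have hid : (![0, 1, 2, 3] : Fin 4 → Fin 4) = id := by
      ext i : 1
      fin_cases i <;> rfl
    rw [volIn_eq, hid, Function.comp_id]
    conv_lhs => rw [AlternatingMap.eq_smul_basis_det b (modelVol S.vol (e.symm x))]
    rw [AlternatingMap.smul_apply, smul_eq_mul, Module.Basis.det_apply]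

variable {S}

theorem lorentzChart {e : OpenPartialHomeomorph M E4}
    (he : e ∈ IsManifold.maximalAtlas (𝓡 4) 4 M) :
    LorentzChart e.target (metricIn S.metric e) (fun x => volIn S.vol e x 0 1 2 3) where
  isOpen := e.open_target
  contDiff_metric := S.contDiff_metric e he
  continuous_vol := S.continuous_vol e he 0 1 2 3
  coframe _ hx := exists_coframe S he hx

theorem killingChart (hvac : S.IsVacuum) {ξ : ∀ p : M, TangentSpace (𝓡 4) p}
    (hξ : S.IsKilling ξ) {e : OpenPartialHomeomorph M E4}
    (he : e ∈ IsManifold.maximalAtlas (𝓡 4) 4 M) :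
    KillingChart e.target (metricIn S.metric e) (volIn S.vol e) (vecIn ξ e)
      (fun x => volIn S.vol e x 0 1 2 3) where
  toLorentzChart := lorentzChart he
  vol_eq x _ a b c d := volIn_eq_levi S.vol e x a b c d
  contDiff_vec := hξ.contDiff e he
  killing := hξ.killing e he
  vacuum := hvac e he

theorem simonChart (hvac : S.IsVacuum) {ξ : ∀ p : M, TangentSpace (𝓡 4) p}
    (hξ : S.IsKilling ξ) (hdense : Dense {p : M | S.metric p (ξ p) (ξ p) ≠ 0})
    (hsimon : S.SimonVanishes ξ)
    (hF : ∀ e ∈ IsManifold.maximalAtlas (𝓡 4) 4 M, ∀ x ∈ e.target,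
      killingFormSq (metricIn S.metric e) (volIn S.vol e) (vecIn ξ e) x ≠ 0)
    {e : OpenPartialHomeomorph M E4} (he : e ∈ IsManifold.maximalAtlas (𝓡 4) 4 M) :
    SimonChart e.target (metricIn S.metric e) (volIn S.vol e) (vecIn ξ e)
      (fun x => volIn S.vol e x 0 1 2 3) where
  toKillingChart := killingChart hvac hξ he
  simon_eq := hsimon e he
  sq_ne_zero := hF e he
  dense := by
    refine (subset_closure_of_dense hdense).trans (closure_mono ?_)
    rintro x ⟨hx, h⟩
    refine ⟨hx, ?_⟩
    rw [normSqNeg_eq he hx]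
    exact neg_ne_zero.mpr h

end Frame

end KillingGeometry

end

noncomputable section
namespace KillingGeometry

section ChartChange

open Complex

/-- The Jacobian matrix `∂φ^k/∂x^i`. -/
def jac (φ : E4 → E4) (x : E4) : Mat ℝ := Matrix.of fun k i => pd i (fun y => φ y k) x

theorem fderiv_single_eq {φ : E4 → E4} {x : E4} (h : DifferentiableAt ℝ φ x) (i k : Fin 4) :
    fderiv ℝ φ x (EuclideanSpace.single i 1) k = jac φ x k i := by
  have := ((EuclideanSpace.proj k : E4 →L[ℝ] ℝ).hasFDerivAt (x := φ x)).comp x h.hasFDerivAt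
  have e := this.fderiv
  change fderiv ℝ (fun y => φ y k) x = _ at e
  rw [jac, Matrix.of_apply, pd, e]
  rfl

theorem HasPD.comp {K : Type*} [RCLike K] {f : E4 → K} {f' : Fin 4 → K} {φ : E4 → E4} {x : E4}
    (hf : ∀ k, HasPD k f (f' k) (φ x)) (hφ : DifferentiableAt ℝ φ x) (i : Fin 4) :
    HasPD i (fun y => f (φ y)) (∑ k, (jac φ x k i : K) * f' k) x := by
  have h := ((hf 0).differentiableAt.hasFDerivAt).comp x hφ.hasFDerivAt
  refine ⟨h.differentiableAt, ?_⟩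
  have e := h.fderiv
  change fderiv ℝ (fun y => f (φ y)) x = _ at e
  rw [e, ContinuousLinearMap.comp_apply, ← sum_smul_single (fderiv ℝ φ x _), map_sum]
  refine Finset.sum_congr rfl fun k _ => ?_
  rw [map_smul, (hf k).fderiv_eq, fderiv_single_eq hφ, RCLike.real_smul_eq_coe_mul]

/-- The coordinate change `φ` transforms the components `G', X', h'` of a metric, a vector field
and a volume form into `G, X, h`. -/
structure ChartChange (N : Set E4) (φ : E4 → E4) (G : E4 → Mat ℝ) (X : E4 → Fin 4 → ℝ) (h : E4 → ℝ)
    (G' : E4 → Mat ℝ) (X' : E4 → Fin 4 → ℝ) (h' : E4 → ℝ) : Prop where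
  isOpen : IsOpen N
  contDiffOn : ContDiffOn ℝ 2 φ N
  metric_eq : ∀ x ∈ N, G x = (jac φ x).transpose * G' (φ x) * jac φ x
  vec_eq : ∀ x ∈ N, X' (φ x) = (jac φ x).mulVec (X x)
  vol_eq : ∀ x ∈ N, h x = h' (φ x) * (jac φ x).det

theorem killMat_eq_half {U : Set E4} {G : E4 → Mat ℝ} {H : E4 → Fin 4 → Fin 4 → Fin 4 → Fin 4 → ℝ}
    {X : E4 → Fin 4 → ℝ} {h : E4 → ℝ} {x : E4} (L : KillingChart U G H X h) (hx : x ∈ U)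
    (a b : Fin 4) :
    killMat G X x a b = (1 / 2) * (pd a (lower G X b) x - pd b (lower G X a) x) := by
  have h1 := L.killing x hx a b
  have h2 : ∑ c, christoffel G c b a x * lower G X c x =
      ∑ c, christoffel G c a b x * lower G X c x :=
    Finset.sum_congr rfl fun c _ => by rw [L.christoffel_symm hx c a b]
  simp only [killMat, Matrix.of_apply]
  simp only [nablaLower] at h1 ⊢
  linarith

namespace ChartChange

variable {N U U' : Set E4} {φ : E4 → E4} {G G' : E4 → Mat ℝ} {X X' : E4 → Fin 4 → ℝ}
  {h h' : E4 → ℝ} {H H' : E4 → Fin 4 → Fin 4 → Fin 4 → Fin 4 → ℝ} {x : E4}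

theorem contDiffAt (T : ChartChange N φ G X h G' X' h') (hx : x ∈ N) : ContDiffAt ℝ 2 φ x :=
  T.contDiffOn.contDiffAt (T.isOpen.mem_nhds hx)

theorem differentiableAt (T : ChartChange N φ G X h G' X' h') (hx : x ∈ N) :
    DifferentiableAt ℝ φ x := (T.contDiffAt hx).differentiableAt (by norm_num)

theorem lower_eq (T : ChartChange N φ G X h G' X' h') (hx : x ∈ N) (a : Fin 4) :
    lower G X a x = ∑ k, jac φ x k a * lower G' X' k (φ x) := by
  have e : ∀ (A : E4 → Mat ℝ) (Y : E4 → Fin 4 → ℝ) y, (fun k => lower A Y k y) = (A y).mulVec (Y y) :=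
    fun A Y y => rfl
  have e1 : lower G X a x = (G x).mulVec (X x) a := rfl
  have e2 : ∑ k, jac φ x k a * lower G' X' k (φ x) =
      (jac φ x).transpose.mulVec ((G' (φ x)).mulVec (X' (φ x))) a := rfl
  rw [e1, e2, T.vec_eq x hx, T.metric_eq x hx]
  simp only [Matrix.mulVec_mulVec, Matrix.mul_assoc]

theorem hasPD_jac (T : ChartChange N φ G X h G' X' h') (hx : x ∈ N) (i k a : Fin 4) :
    HasPD i (fun y => jac φ y k a) (pd i (pd a fun y => φ y k) x) x := by
  have hk : ContDiffAt ℝ 2 (fun y => φ y k) x := by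
    have := (EuclideanSpace.proj k : E4 →L[ℝ] ℝ).contDiff (n := 2) |>.contDiffAt.comp x
      (T.contDiffAt hx)
    exact this
  have : ContDiffAt ℝ 1 (pd a fun y => φ y k) x :=
    (hk.fderiv_right (m := 1) (by norm_num)).clm_apply contDiffAt_const
  exact hasPD_pd (this.differentiableAt (by norm_num)) i

theorem jac_symm (T : ChartChange N φ G X h G' X' h') (hx : x ∈ N) (i k a : Fin 4) :
    pd i (pd a fun y => φ y k) x = pd a (pd i fun y => φ y k) x := by
  have hk : ContDiffAt ℝ 2 (fun y => φ y k) x := by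
    have := (EuclideanSpace.proj k : E4 →L[ℝ] ℝ).contDiff (n := 2) |>.contDiffAt.comp x
      (T.contDiffAt hx)
    exact this
  exact pd_comm hk i a

theorem pd_lower (T : ChartChange N φ G X h G' X' h') (hx : x ∈ N)
    (L' : KillingChart U' G' H' X' h') (hx' : φ x ∈ U') (a b : Fin 4) :
    pd a (lower G X b) x = ∑ k, (pd a (pd b fun y => φ y k) x * lower G' X' k (φ x) +
      jac φ x k b * ∑ l, jac φ x l a * pd l (lower G' X' k) (φ x)) := by
  have h1 : HasPD a (fun y => ∑ k, jac φ y k b * lower G' X' k (φ y)) (∑ k,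
      (pd a (pd b fun y => φ y k) x * lower G' X' k (φ x) +
      jac φ x k b * ∑ l, jac φ x l a * pd l (lower G' X' k) (φ x))) x := by
    refine HasPD.sum fun k _ => (T.hasPD_jac hx a k b).mul ?_
    exact HasPD.comp (fun l => hasPD_pd (((L'.contDiff_lower k).contDiffAt
      (L'.mem_nhds hx')).differentiableAt (by norm_num)) l) (T.differentiableAt hx) a
  refine (h1.congr_of_eventuallyEq ?_).fderiv_eq
  filter_upwards [T.isOpen.mem_nhds hx] with y hy
  exact T.lower_eq hy b

theorem killMat_eq (T : ChartChange N φ G X h G' X' h') (hx : x ∈ N)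
    (L : KillingChart U G H X h) (hxU : x ∈ U)
    (L' : KillingChart U' G' H' X' h') (hx' : φ x ∈ U') :
    killMat G X x = (jac φ x).transpose * killMat G' X' (φ x) * jac φ x := by
  ext a b
  have e1 : ∑ k, pd b (pd a fun y => φ y k) x * lower G' X' k (φ x) =
      ∑ k, pd a (pd b fun y => φ y k) x * lower G' X' k (φ x) :=
    Finset.sum_congr rfl fun k _ => by rw [T.jac_symm hx]
  have e2 : ∑ k, jac φ x k a * ∑ l, jac φ x l b * pd l (lower G' X' k) (φ x) =
      ∑ k, ∑ l, jac φ x k b * (jac φ x l a * pd k (lower G' X' l) (φ x)) := by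
    simp only [Finset.mul_sum]
    rw [Finset.sum_comm]
    exact Finset.sum_congr rfl fun k _ => Finset.sum_congr rfl fun l _ => by ring
  rw [killMat_eq_half L hxU, T.pd_lower hx L' hx', T.pd_lower hx L' hx']
  simp only [Finset.sum_add_distrib]
  rw [e1, e2, add_sub_add_left_eq_sub]
  simp only [Matrix.mul_apply, Matrix.transpose_apply, killMat_eq_half L' hx', Finset.mul_sum,
    Finset.sum_mul, ← Finset.sum_sub_distrib]
  exact Finset.sum_congr rfl fun k _ => Finset.sum_congr rfl fun l _ => by ring

theorem isUnit_jac (T : ChartChange N φ G X h G' X' h') (hx : x ∈ N)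
    (L : LorentzChart U G h) (hxU : x ∈ U) : IsUnit (jac φ x).det := by
  rw [isUnit_iff_ne_zero]
  intro h0
  exact L.vol_ne_zero hxU (by rw [T.vol_eq x hx, h0, mul_zero])

theorem sdKill_eq (T : ChartChange N φ G X h G' X' h') (hx : x ∈ N)
    (L : KillingChart U G H X h) (hxU : x ∈ U)
    (L' : KillingChart U' G' H' X' h') (hx' : φ x ∈ U') :
    sdKill G X h x =
      (toC (jac φ x)).transpose * sdKill G' X' h' (φ x) * toC (jac φ x) := by
  have hJ := T.isUnit_jac hx L.toLorentzChart hxU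
  rw [sdKill, sdMat, T.killMat_eq hx L hxU L' hx', T.vol_eq x hx, T.metric_eq x hx,
    hodge_congr _ hJ (L'.metric_transpose hx') (L'.killMat_transpose hx'), sdKill, sdMat]
  simp only [toC_mul, toC_transpose, Matrix.mul_add, Matrix.add_mul, Matrix.mul_smul,
    Matrix.smul_mul]

theorem sdSq_eq (T : ChartChange N φ G X h G' X' h') (hx : x ∈ N)
    (L : KillingChart U G H X h) (hxU : x ∈ U)
    (L' : KillingChart U' G' H' X' h') (hx' : φ x ∈ U') :
    sdSq G X h x = sdSq G' X' h' (φ x) := by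
  have hJ : IsUnit (toC (jac φ x)).det := by
    rw [toC_det]
    exact (T.isUnit_jac hx L.toLorentzChart hxU).map Complex.ofRealHom
  have hJt : IsUnit (toC (jac φ x)).transpose.det := by rwa [Matrix.det_transpose]
  rw [sdSq, sdSq, T.sdKill_eq hx L hxU L' hx', T.metric_eq x hx]
  simp only [toC_mul, toC_transpose, pairing]
  set J := toC (jac φ x)
  set F := sdKill G' X' h' (φ x)
  set g := toC (G' (φ x))
  have e : ∀ A : Mat ℂ, J.transpose * A * J * (J.transpose * g * J)⁻¹ =
      J.transpose * (A * g⁻¹) * (J.transpose)⁻¹ := by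
    intro A
    rw [Matrix.mul_inv_rev, Matrix.mul_inv_rev]
    simp only [Matrix.mul_assoc]
    rw [Matrix.mul_nonsing_inv_cancel_left _ _ hJ]
  have e2 : J.transpose * F * J * (J.transpose * g * J)⁻¹ * (J.transpose * F * J) *
      (J.transpose * g * J)⁻¹ = J.transpose * (F * g⁻¹ * (F * g⁻¹)) * (J.transpose)⁻¹ := by
    rw [Matrix.mul_assoc (J.transpose * F * J * (J.transpose * g * J)⁻¹), e]
    simp only [Matrix.mul_assoc]
    rw [Matrix.nonsing_inv_mul_cancel_left _ _ hJt]
  rw [e2, Matrix.trace_mul_comm, ← Matrix.mul_assoc, Matrix.nonsing_inv_mul _ hJt, Matrix.one_mul]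
  simp only [Matrix.mul_assoc]

theorem sdErnst_eq (T : ChartChange N φ G X h G' X' h') (hx : x ∈ N)
    (L : KillingChart U G H X h) (hxU : x ∈ U)
    (L' : KillingChart U' G' H' X' h') (hx' : φ x ∈ U') (i : Fin 4) :
    sdErnst G X h x i = ∑ k, (jac φ x k i : ℂ) * sdErnst G' X' h' (φ x) k := by
  have e : ∀ k, (X' (φ x) k : ℂ) = ∑ a, (jac φ x k a : ℂ) * (X x a : ℂ) := by
    intro k
    rw [T.vec_eq x hx]
    simp [Matrix.mulVec, dotProduct]
  simp only [sdErnst, T.sdKill_eq hx L hxU L' hx', e, Matrix.mul_apply, Matrix.transpose_apply,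
    toC_apply, Finset.mul_sum, Finset.sum_mul]
  rw [Finset.sum_comm]
  refine Finset.sum_congr rfl fun k _ => ?_
  rw [Finset.sum_comm]
  exact Finset.sum_congr rfl fun l _ => Finset.sum_congr rfl fun m _ => by ring

theorem weylFactor_eq_of_ne_zero (T : ChartChange N φ G X h G' X' h') (hx : x ∈ N)
    (L : SimonChart U G H X h) (hN : N ⊆ U)
    (L' : SimonChart U' G' H' X' h') (hN' : Set.MapsTo φ N U') (h0 : normSqNeg G X x ≠ 0) :
    weylFactor G X h x = weylFactor G' X' h' (φ x) := by
  obtain ⟨i, hi⟩ := L.sdErnst_ne_zero (hN hx) h0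
  have h1 := L.hasPD_sdSq (hN hx) i
  have h2 := (HasPD.comp (fun k => L'.hasPD_sdSq (hN' hx) k) (T.differentiableAt hx)
    i).congr_of_eventuallyEq (f₂ := sdSq G X h) (by
      filter_upwards [T.isOpen.mem_nhds hx] with y hy
      exact T.sdSq_eq hy L.toKillingChart (hN hy) L'.toKillingChart (hN' hy))
  have h3 := h1.unique h2
  have h4 : ∑ k, (jac φ x k i : ℂ) * (2 / 3 * weylFactor G' X' h' (φ x) * sdSq G' X' h' (φ x) *
      sdErnst G' X' h' (φ x) k) =
      2 / 3 * weylFactor G' X' h' (φ x) * sdSq G X h x * sdErnst G X h x i := by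
    rw [T.sdErnst_eq hx L.toKillingChart (hN hx) L'.toKillingChart (hN' hx),
      T.sdSq_eq hx L.toKillingChart (hN hx) L'.toKillingChart (hN' hx), Finset.mul_sum]
    exact Finset.sum_congr rfl fun k _ => by ring
  have h5 := h3.trans h4
  have h6 := L.sdSq_ne_zero (hN hx)
  have h7 : (weylFactor G X h x - weylFactor G' X' h' (φ x)) * (sdSq G X h x * sdErnst G X h x i) = 0 := by
    linear_combination (3 / 2 : ℂ) * h5
  exact sub_eq_zero.mp ((mul_eq_zero.mp h7).resolve_right (mul_ne_zero h6 hi))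

theorem weylFactor_eq (T : ChartChange N φ G X h G' X' h') (hx : x ∈ N)
    (L : SimonChart U G H X h) (hN : N ⊆ U)
    (L' : SimonChart U' G' H' X' h') (hN' : Set.MapsTo φ N U') :
    weylFactor G X h x = weylFactor G' X' h' (φ x) := by
  have c1 : ContinuousAt (weylFactor G X h) x :=
    (L.differentiableAt_weylFactor (hN hx) (L.sdSq_ne_zero (hN hx))).continuousAt
  have c2 : ContinuousAt (fun y => weylFactor G' X' h' (φ y)) x :=
    (L'.differentiableAt_weylFactor (hN' hx) (L'.sdSq_ne_zero (hN' hx))).continuousAt.comp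
      (f := φ) (T.contDiffAt hx).continuousAt
  by_contra hne
  have h1 : ∀ᶠ y in nhds x, weylFactor G X h y - weylFactor G' X' h' (φ y) ≠ 0 :=
    (c1.sub c2).eventually_ne (sub_ne_zero.mpr hne)
  have h2 := mem_closure_iff_frequently.mp (L.dense (hN hx))
  obtain ⟨y, hy, hy1, hy2⟩ := (h2.and_eventually (h1.and (T.isOpen.mem_nhds hx))).exists
  exact hy1 (sub_eq_zero.mpr (T.weylFactor_eq_of_ne_zero hy2 L hN L' hN' hy.2))

end ChartChange

end ChartChange

end KillingGeometry

end

noncomputable section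
namespace KillingGeometry

section Overlap

section Topology

variable {M : Type*} [TopologicalSpace M]

/-- The set of coordinates in `e` of the points covered by `e'`. -/
def overlap (e e' : OpenPartialHomeomorph M E4) : Set E4 := e.target ∩ e.symm ⁻¹' e'.source

theorem isOpen_overlap (e e' : OpenPartialHomeomorph M E4) : IsOpen (overlap e e') :=
  e.isOpen_inter_preimage_symm e'.open_source

theorem symm_transition {e e' : OpenPartialHomeomorph M E4} {x : E4} (hx : x ∈ overlap e e') :
    e'.symm (e' (e.symm x)) = e.symm x :=
  e'.left_inv hx.2

end Topology

variable {M : Type*} [TopologicalSpace M] [ChartedSpace E4 M]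
  {e e' : OpenPartialHomeomorph M E4} {x : E4}

theorem contDiffOn_transition (he : e ∈ IsManifold.maximalAtlas (𝓡 4) 4 M)
    (he' : e' ∈ IsManifold.maximalAtlas (𝓡 4) 4 M) :
    ContDiffOn ℝ 4 (fun y => e' (e.symm y)) (overlap e e') := by
  have h : ContMDiffOn (𝓡 4) (𝓡 4) 4 (fun y => e' (e.symm y)) (overlap e e') :=
    (contMDiffOn_of_mem_maximalAtlas he').comp
      ((contMDiffOn_symm_of_mem_maximalAtlas he).mono Set.inter_subset_left) fun y hy => hy.2
  exact contMDiffOn_iff_contDiffOn.mp h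

theorem differentiableAt_transition (he : e ∈ IsManifold.maximalAtlas (𝓡 4) 4 M)
    (he' : e' ∈ IsManifold.maximalAtlas (𝓡 4) 4 M) (hx : x ∈ overlap e e') :
    DifferentiableAt ℝ (fun y => e' (e.symm y)) x :=
  ((contDiffOn_transition he he').contDiffAt ((isOpen_overlap e e').mem_nhds hx)).differentiableAt
    (by norm_num)

theorem fderiv_transition (he : e ∈ IsManifold.maximalAtlas (𝓡 4) 4 M)
    (he' : e' ∈ IsManifold.maximalAtlas (𝓡 4) 4 M) (hx : x ∈ overlap e e') (v : E4) :
    fderiv ℝ (fun y => e' (e.symm y)) x v = coframeMap e' (e.symm x) (frameMap e x v) := by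
  have h := mfderiv_comp (I := 𝓡 4) (I' := 𝓡 4) (I'' := 𝓡 4) x
    ((mdifferentiable_of_mem_maximalAtlas he').mdifferentiableAt hx.2)
    ((mdifferentiable_of_mem_maximalAtlas he).mdifferentiableAt_symm hx.1)
  have h2 : mfderiv (𝓡 4) (𝓡 4) (e' ∘ e.symm) x = fderiv ℝ (fun y => e' (e.symm y)) x :=
    mfderiv_eq_fderiv
  rw [← h2, h]
  rfl

theorem frameVec_transition (he : e ∈ IsManifold.maximalAtlas (𝓡 4) 4 M)
    (he' : e' ∈ IsManifold.maximalAtlas (𝓡 4) 4 M) (hx : x ∈ overlap e e') (i : Fin 4) :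
    frameVec e x i = ∑ k, jac (fun y => e' (e.symm y)) x k i • frameVec e' (e' (e.symm x)) k := by
  have h := frameMap_coframeMap he' (e'.map_source hx.2) (frameVec e x i)
  rw [symm_transition hx, frameVec, ← fderiv_transition he he' hx, frameMap_apply] at h
  rw [frameVec, ← h]
  exact Finset.sum_congr rfl fun k _ => by
    rw [fderiv_single_eq (differentiableAt_transition he he' hx)]

theorem chartChange (he : e ∈ IsManifold.maximalAtlas (𝓡 4) 4 M)
    (he' : e' ∈ IsManifold.maximalAtlas (𝓡 4) 4 M) (S : C3Spacetime M)
    (ξ : ∀ p : M, TangentSpace (𝓡 4) p) :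
    ChartChange (overlap e e') (fun y => e' (e.symm y)) (metricIn S.metric e) (vecIn ξ e)
      (fun x => volIn S.vol e x 0 1 2 3) (metricIn S.metric e') (vecIn ξ e')
      (fun x => volIn S.vol e' x 0 1 2 3) where
  isOpen := isOpen_overlap e e'
  contDiffOn := (contDiffOn_transition he he').of_le (by norm_num)
  metric_eq x hx := by
    ext i j
    rw [metricIn_eq, frameVec_transition he he' hx i, frameVec_transition he he' hx j]
    simp only [map_sum, map_smul, LinearMap.sum_apply, LinearMap.smul_apply, smul_eq_mul,
      Matrix.mul_apply, Matrix.transpose_apply, metricIn_eq, symm_transition hx]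
    exact Finset.sum_congr rfl fun k _ => mul_comm _ _
  vec_eq x hx := by
    ext k
    have h := frameMap_apply e x (coframeMap e (e.symm x) (modelVec ξ (e.symm x)))
    rw [frameMap_coframeMap he hx.1] at h
    have h2 : coframeMap e' (e.symm x) (modelVec ξ (e.symm x)) =
        ∑ i, vecIn ξ e x i • coframeMap e' (e.symm x) (frameVec e x i) := by
      rw [← sum_vecIn_smul he hx.1 ξ, map_sum]
      simp only [map_smul]
    rw [vecIn_eq, symm_transition hx, h2]
    simp only [frameVec, ← fderiv_transition he he' hx, Matrix.mulVec, dotProduct,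
      ← fderiv_single_eq (differentiableAt_transition he he' hx)]
    simp [mul_comm]
  vol_eq x hx := by
    have hid : (![0, 1, 2, 3] : Fin 4 → Fin 4) = id := by
      ext i : 1
      fin_cases i <;> rfl
    set b := frameBasis he' (e'.map_source hx.2) with hb
    have hJ : b.toMatrix (frameVec e x) = jac (fun y => e' (e.symm y)) x := by
      ext k i
      rw [Module.Basis.toMatrix_apply, frameVec_transition he he' hx i]
      simp only [← frameBasis_apply he' (e'.map_source hx.2), ← hb, map_sum, map_smul,
        Module.Basis.repr_self]
      simp [Finsupp.single_apply]
    rw [volIn_eq, volIn_eq, hid, Function.comp_id, Function.comp_id, symm_transition hx]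
    conv_lhs => rw [AlternatingMap.eq_smul_basis_det b (modelVol S.vol (e.symm x))]
    rw [AlternatingMap.smul_apply, smul_eq_mul, Module.Basis.det_apply, hJ, hb, coe_frameBasis]

end Overlap

end KillingGeometry

end

noncomputable section
namespace KillingGeometry

section Global

open Complex

theorem fderiv_eq_zero_of_hasPD {f : E4 → ℂ} {x : E4} (h : ∀ i, HasPD i f 0 x) :
    fderiv ℝ f x = 0 := by
  ext v
  · rw [← sum_smul_single v, map_sum]
    simp [map_smul, (h _).fderiv_eq]

theorem HasPD.const_div {f : E4 → ℂ} {f' : ℂ} {x : E4} {i : Fin 4} (h : HasPD i f f' x) (c : ℂ)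
    (h0 : f x ≠ 0) : HasPD i (fun y => c / f y) (-c * f' / f x ^ 2) x := by
  have hd : DifferentiableAt ℝ (fun y => c / f y) x := by
    simp only [div_eq_mul_inv]
    exact (differentiableAt_const c).fun_mul (h.1.fun_inv h0)
  refine (of_differentiableAt hd i).congr_val ?_
  have h1 := h.mul (of_differentiableAt hd i)
  have h2 : HasPD i (fun y => f y * (c / f y)) 0 x := by
    refine (const c).congr_of_eventuallyEq ?_
    filter_upwards [h.differentiableAt.continuousAt.eventually_ne h0] with y hy
    field_simp
  have h3 := h1.unique h2
  field_simp at h3 ⊢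
  linear_combination h3

variable {M : Type*} [TopologicalSpace M] [ChartedSpace E4 M]

/-- The factor `weylFactor` as a function on the manifold. -/
def globalFactor (S : C3Spacetime M) (ξ : ∀ p : M, TangentSpace (𝓡 4) p) (p : M) : ℂ :=
  weylFactor (metricIn S.metric (chartAt E4 p)) (vecIn ξ (chartAt E4 p))
    (fun x => volIn S.vol (chartAt E4 p) x 0 1 2 3) (chartAt E4 p p)

/-- The scalar `ℱ²` as a function on the manifold. -/
def globalSq (S : C3Spacetime M) (ξ : ∀ p : M, TangentSpace (𝓡 4) p) (p : M) : ℂ :=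
  sdSq (metricIn S.metric (chartAt E4 p)) (vecIn ξ (chartAt E4 p))
    (fun x => volIn S.vol (chartAt E4 p) x 0 1 2 3) (chartAt E4 p p)

/-- In every coordinate system the spacetime and the vector field satisfy `SimonChart`. -/
def IsSimon (S : C3Spacetime M) (ξ : ∀ p : M, TangentSpace (𝓡 4) p) : Prop :=
  ∀ e ∈ IsManifold.maximalAtlas (𝓡 4) 4 M,
    SimonChart e.target (metricIn S.metric e) (volIn S.vol e) (vecIn ξ e)
      (fun x => volIn S.vol e x 0 1 2 3)

namespace IsSimon

variable [IsManifold (𝓡 4) 4 M] {S : C3Spacetime M} {ξ : ∀ p : M, TangentSpace (𝓡 4) p}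
  {e : OpenPartialHomeomorph M E4} {x : E4}

theorem globalFactor_eq (L : IsSimon S ξ) (he : e ∈ IsManifold.maximalAtlas (𝓡 4) 4 M)
    (hx : x ∈ e.target) : globalFactor S ξ (e.symm x) =
      weylFactor (metricIn S.metric e) (vecIn ξ e) (fun x => volIn S.vol e x 0 1 2 3) x := by
  have he' := IsManifold.chart_mem_maximalAtlas (I := 𝓡 4) (n := 4) (e.symm x)
  exact ((chartChange he he' S ξ).weylFactor_eq ⟨hx, mem_chart_source _ _⟩ (L e he)
    Set.inter_subset_left (L _ he') fun y hy => OpenPartialHomeomorph.map_source _ hy.2).symm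

theorem globalSq_eq (L : IsSimon S ξ) (he : e ∈ IsManifold.maximalAtlas (𝓡 4) 4 M)
    (hx : x ∈ e.target) : globalSq S ξ (e.symm x) =
      sdSq (metricIn S.metric e) (vecIn ξ e) (fun x => volIn S.vol e x 0 1 2 3) x := by
  have he' := IsManifold.chart_mem_maximalAtlas (I := 𝓡 4) (n := 4) (e.symm x)
  exact ((chartChange he he' S ξ).sdSq_eq ⟨hx, mem_chart_source _ _⟩ (L e he).toKillingChart hx
    (L _ he').toKillingChart
    (OpenPartialHomeomorph.map_source _ (mem_chart_source _ _))).symm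

theorem hasPD_globalFactor (L : IsSimon S ξ) (he : e ∈ IsManifold.maximalAtlas (𝓡 4) 4 M)
    (hx : x ∈ e.target) (i : Fin 4) : HasPD i (fun y => globalFactor S ξ (e.symm y))
      (-(globalFactor S ξ (e.symm x) ^ 2 / 6) *
        sdErnst (metricIn S.metric e) (vecIn ξ e) (fun x => volIn S.vol e x 0 1 2 3) x i) x := by
  rw [L.globalFactor_eq he hx]
  refine ((L e he).hasPD_weylFactor hx i).congr_of_eventuallyEq ?_
  filter_upwards [e.open_target.mem_nhds hx] with y hy
  exact L.globalFactor_eq he hy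

theorem hasPD_globalSq (L : IsSimon S ξ) (he : e ∈ IsManifold.maximalAtlas (𝓡 4) 4 M)
    (hx : x ∈ e.target) (i : Fin 4) : HasPD i (fun y => globalSq S ξ (e.symm y))
      (2 / 3 * globalFactor S ξ (e.symm x) * globalSq S ξ (e.symm x) *
        sdErnst (metricIn S.metric e) (vecIn ξ e) (fun x => volIn S.vol e x 0 1 2 3) x i) x := by
  rw [L.globalFactor_eq he hx, L.globalSq_eq he hx]
  refine ((L e he).hasPD_sdSq hx i).congr_of_eventuallyEq ?_
  filter_upwards [e.open_target.mem_nhds hx] with y hy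
  exact L.globalSq_eq he hy

theorem hasPD_sq_mul_factor (L : IsSimon S ξ) (he : e ∈ IsManifold.maximalAtlas (𝓡 4) 4 M)
    (hx : x ∈ e.target) (i : Fin 4) : HasPD i
      (fun y => globalSq S ξ (e.symm y) * ((globalFactor S ξ (e.symm y) *
        globalFactor S ξ (e.symm y)) * (globalFactor S ξ (e.symm y) *
        globalFactor S ξ (e.symm y)))) 0 x := by
  have hQ := L.hasPD_globalFactor he hx i
  have hQ2 := hQ.mul hQ
  exact ((L.hasPD_globalSq he hx i).mul (hQ2.mul hQ2)).congr_val (by ring)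

theorem isLocallyConstant_sq_mul_factor (L : IsSimon S ξ) :
    IsLocallyConstant fun p => globalSq S ξ p * globalFactor S ξ p ^ 4 := by
  rw [IsLocallyConstant.iff_eventually_eq]
  intro p
  have he := IsManifold.chart_mem_maximalAtlas (I := 𝓡 4) (n := 4) p
  set e := chartAt E4 p with hedef
  have hp : p ∈ e.source := mem_chart_source E4 p
  obtain ⟨r, hr, hball⟩ := Metric.isOpen_iff.mp e.open_target (e p) (e.map_source hp)
  have hc {y z} := Metric.isOpen_ball.is_const_of_fderiv_eq_zero (𝕜 := ℝ) (x := y) (y := z)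
    (convex_ball (e p) r).isPreconnected
    (fun y hy => (L.hasPD_sq_mul_factor he (hball hy) 0).differentiableAt.differentiableWithinAt)
    (fun y hy => fderiv_eq_zero_of_hasPD (L.hasPD_sq_mul_factor he (hball hy)))
  filter_upwards [e.open_source.mem_nhds hp,
    (e.continuousAt hp).preimage_mem_nhds (Metric.ball_mem_nhds _ hr)] with q hq hqr
  have h := hc hqr (Metric.mem_ball_self hr)
  simp only [e.left_inv hq, e.left_inv hp] at h
  linear_combination h

theorem globalSq_ne_zero (L : IsSimon S ξ) (p : M) : globalSq S ξ p ≠ 0 :=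
  (L _ (IsManifold.chart_mem_maximalAtlas (I := 𝓡 4) (n := 4) p)).sdSq_ne_zero
    (OpenPartialHomeomorph.map_source _ (mem_chart_source _ _))

theorem isLocallyFlat_of_factor_eq_zero (L : IsSimon S ξ) (h : ∀ p, globalFactor S ξ p = 0) :
    S.IsLocallyFlat := by
  intro e he x hx a b c d
  have h1 := (L e he).sdWeyl_eq hx c d
  rw [← L.globalFactor_eq he hx, h, zero_smul] at h1
  have h2 := congrArg Complex.re (congrFun (congrFun h1 a) b)
  rw [← rlow_apply]
  simpa [sdWeyl, sdMat] using h2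

theorem factor_ne_zero [PreconnectedSpace M] (L : IsSimon S ξ) (hflat : ¬S.IsLocallyFlat) (p : M) :
    globalFactor S ξ p ≠ 0 := by
  intro h0
  refine hflat (L.isLocallyFlat_of_factor_eq_zero fun q => ?_)
  have h := L.isLocallyConstant_sq_mul_factor.apply_eq_of_preconnectedSpace q p
  simp only [h0] at h
  have h1 : globalSq S ξ q * globalFactor S ξ q ^ 4 = 0 := by rw [h]; ring
  exact pow_eq_zero_iff (by norm_num) |>.mp
    ((mul_eq_zero.mp h1).resolve_left (L.globalSq_ne_zero q))

theorem hasPD_potential (L : IsSimon S ξ) (h0 : ∀ p, globalFactor S ξ p ≠ 0)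
    (he : e ∈ IsManifold.maximalAtlas (𝓡 4) 4 M)
    (hx : x ∈ e.target) (i : Fin 4) : HasPD i (fun y => 6 / globalFactor S ξ (e.symm y))
      (ernst (metricIn S.metric e) (volIn S.vol e) (vecIn ξ e) x i) x := by
  refine ((L.hasPD_globalFactor he hx i).const_div 6 (h0 _)).congr_val ?_
  rw [(L e he).toKillingChart.sdErnst_eq hx i]
  have := h0 (e.symm x)
  field_simp

theorem isErnstPotential (L : IsSimon S ξ) (h0 : ∀ p, globalFactor S ξ p ≠ 0) :
    S.IsErnstPotential ξ fun p => 6 / globalFactor S ξ p := by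
  refine ⟨fun p => ?_, fun e he x hx m => (L.hasPD_potential h0 he hx m).fderiv_eq.symm⟩
  have he := IsManifold.chart_mem_maximalAtlas (I := 𝓡 4) (n := 4) p
  set e := chartAt E4 p with hedef
  have hp : p ∈ e.source := mem_chart_source E4 p
  have h1 := (L.hasPD_potential h0 he (e.map_source hp) 0).differentiableAt.mdifferentiableAt
  have h2 := (mdifferentiable_of_mem_maximalAtlas he).mdifferentiableAt hp
  refine (h1.comp p h2).congr_of_eventuallyEq ?_
  filter_upwards [e.open_source.mem_nhds hp] with q hq
  simp [e.left_inv hq]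

theorem weylSD_eq (L : IsSimon S ξ) (he : e ∈ IsManifold.maximalAtlas (𝓡 4) 4 M)
    (hx : x ∈ e.target) (a b d f : Fin 4) :
    weylSD (metricIn S.metric e) (volIn S.vol e) x a b d f = globalFactor S ξ (e.symm x) *
      (killingForm (metricIn S.metric e) (volIn S.vol e) (vecIn ξ e) x a b *
          killingForm (metricIn S.metric e) (volIn S.vol e) (vecIn ξ e) x d f
        - 1 / 3 * idSD (metricIn S.metric e) (volIn S.vol e) x a b d f *
          killingFormSq (metricIn S.metric e) (volIn S.vol e) (vecIn ξ e) x) := by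
  have K := (L e he).toKillingChart
  have h := congrFun (congrFun ((L e he).sdWeyl_eq hx a b) d) f
  rw [K.weylSD_eq hx, K.killingForm_eq hx, K.killingForm_eq hx, K.idSD_eq hx, K.sdSq_eq hx,
    L.globalFactor_eq he hx]
  refine h.trans ?_
  simp only [Matrix.smul_apply, Matrix.sub_apply, smul_eq_mul, sdKill]
  ring

end IsSimon

end Global

end KillingGeometry

end

open KillingGeometry in
theorem lemma4 {M : Type*} [TopologicalSpace M] [T2Space M] [ParacompactSpace M]
    [ConnectedSpace M] [ChartedSpace E4 M] [IsManifold (𝓡 4) 4 M]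
    (S : C3Spacetime M) (hvac : S.IsVacuum) (hflat : ¬ S.IsLocallyFlat)
    (ξ : ∀ p : M, TangentSpace (𝓡 4) p) (hξ : S.IsKilling ξ)
    (hdense : Dense {p : M | S.metric p (ξ p) (ξ p) ≠ 0})
    (hsimon : S.SimonVanishes ξ)
    (hF : ∀ e ∈ IsManifold.maximalAtlas (𝓡 4) 4 M, ∀ x ∈ e.target,
      killingFormSq (metricIn S.metric e) (volIn S.vol e) (vecIn ξ e) x ≠ 0) :
    ∃ σ : M → ℂ, S.IsErnstPotential ξ σ ∧
      ∃ c A : ℂ, A ≠ 0 ∧ (∀ p, c - σ p ≠ 0) ∧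
        ∀ e ∈ IsManifold.maximalAtlas (𝓡 4) 4 M, ∀ x ∈ e.target,
          (∀ a b d f,
            weylSD (metricIn S.metric e) (volIn S.vol e) x a b d f =
              -6 / (c - σ (e.symm x)) *
                (killingForm (metricIn S.metric e) (volIn S.vol e) (vecIn ξ e) x a b *
                    killingForm (metricIn S.metric e) (volIn S.vol e) (vecIn ξ e) x d f
                  - 1 / 3 * idSD (metricIn S.metric e) (volIn S.vol e) x a b d f *
                    killingFormSq (metricIn S.metric e) (volIn S.vol e) (vecIn ξ e) x)) ∧
          killingFormSq (metricIn S.metric e) (volIn S.vol e) (vecIn ξ e) x =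
            A * (c - σ (e.symm x)) ^ 4 := by
  have L : IsSimon S ξ := fun e he => simonChart hvac hξ hdense hsimon hF he
  have h0 := L.factor_ne_zero hflat
  obtain ⟨p₀⟩ := (inferInstance : Nonempty M)
  set K := globalSq S ξ p₀ * globalFactor S ξ p₀ ^ 4 with hK
  refine ⟨fun p => 6 / globalFactor S ξ p, L.isErnstPotential h0, 0, K / 6 ^ 4,
    div_ne_zero (mul_ne_zero (L.globalSq_ne_zero p₀) (pow_ne_zero 4 (h0 p₀))) (by norm_num),
    fun p => ?_, fun e he x hx => ⟨fun a b d f => ?_, ?_⟩⟩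
  · rw [zero_sub]
    exact neg_ne_zero.mpr (div_ne_zero (by norm_num) (h0 p))
  · rw [L.weylSD_eq he hx]
    congr 1
    have := h0 (e.symm x)
    field_simp
    ring
  · have h1 : globalSq S ξ (e.symm x) * globalFactor S ξ (e.symm x) ^ 4 = K :=
      L.isLocallyConstant_sq_mul_factor.apply_eq_of_preconnectedSpace _ _
    rw [(L e he).toKillingChart.sdSq_eq hx, ← L.globalSq_eq he hx, ← h1]
    have := h0 (e.symm x)
    field_simp
    ring
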